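/- **Theorem 1.** The all-targets change-making problem can be solved in $\tilde O(t^{4/3})$ time. In detail: an instance consists of $n$ distinct positive integers $v_1,\dots,v_n$ (coin values) and an integer $t\ge 0$. For $0\le j\le t$ let $$D[j]=\min\Big\{\sum_{i=1}^n m_i \;:\; m_1,\dots,m_n\in\mathbb{N},\ \sum_{i=1}^n m_iv_i=j\Big\}\in\mathbb{N}\cup\{\infty\},$$ with $D[j]=\infty$ if there is no solution. Then there are a deterministic word-RAM program $P$ and constants $c,k,C$ such that for every instance and every word size $w\ge c\log_2(n+t+2)$ such that all coin values are less than $2^w$, the program $P$, given $n$, $t$ and the list $v_1,\dots,v_n$ in any order, halts with the whole array $D[0],\dots,D[t]$ in memory after at most $$C\,\Big((t+1)^{4/3}\,\big(\log (t+2)\big)^{k}+\#\{i: v_i>t\}\Big)$$ unit-cost steps on $w$-bit words. In particular, if all coin values are at most $t$, the running time is $\tilde O(t^{4/3})$. -/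

import Mathlib

/-! ### A word RAM with word size `w`

Every register and every memory cell holds a `w`-bit word, i.e. a natural number below `2 ^ w`.
There are finitely many registers in any given program (a register is named by a literal in the
program), while the memory is addressed indirectly through registers.  Each instruction and each
evaluated test takes one unit of time. -/

namespace WordRAM

/-- Binary operations on words. -/
inductive BinOp : Type
  | add | sub | mul | div | mod | and | or | xor | shl | shr

/-- Semantics of the binary operations; addition, subtraction, multiplication and left shift are
modulo `2 ^ w`.  All results are `w`-bit words when the arguments are. -/
def BinOp.eval (w : ℕ) : BinOp → ℕ → ℕ → ℕ
  | .add, a, b => (a + b) % 2 ^ w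
  | .sub, a, b => (a + (2 ^ w - b)) % 2 ^ w
  | .mul, a, b => (a * b) % 2 ^ w
  | .div, a, b => a / b
  | .mod, a, b => a % b
  | .and, a, b => a &&& b
  | .or, a, b => a ||| b
  | .xor, a, b => a ^^^ b
  | .shl, a, b => (a <<< b) % 2 ^ w
  | .shr, a, b => a >>> b

/-- Elementary instructions; the `ℕ`-arguments other than the literal of `const` name registers. -/
inductive Instr : Type
  /-- `dst := literal` -/
  | const (dst literal : ℕ)
  /-- `dst := src` -/
  | move (dst src : ℕ)
  /-- `dst := a op b` -/
  | bin (op : BinOp) (dst a b : ℕ)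
  /-- `dst := memory[addr]` -/
  | load (dst addr : ℕ)
  /-- `memory[addr] := src` -/
  | store (addr src : ℕ)

/-- Contents of the registers and of the memory. -/
@[ext] structure State : Type where
  reg : ℕ → ℕ
  mem : ℕ → ℕ

/-- Effect of one elementary instruction. -/
def Instr.exec (w : ℕ) : Instr → State → State
  | .const d x, s => { s with reg := Function.update s.reg d (x % 2 ^ w) }
  | .move d a, s => { s with reg := Function.update s.reg d (s.reg a) }
  | .bin op d a b, s => { s with reg := Function.update s.reg d (op.eval w (s.reg a) (s.reg b)) }
  | .load d a, s => { s with reg := Function.update s.reg d (s.mem (s.reg a)) }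
  | .store a b, s => { s with mem := Function.update s.mem (s.reg a) (s.reg b) }

/-- Tests comparing the contents of two registers. -/
inductive Test : Type
  | lt (a b : ℕ)
  | le (a b : ℕ)
  | eq (a b : ℕ)
  | ne (a b : ℕ)

/-- The truth of a test in a state. -/
def Test.holds : Test → State → Prop
  | .lt a b, s => s.reg a < s.reg b
  | .le a b, s => s.reg a ≤ s.reg b
  | .eq a b, s => s.reg a = s.reg b
  | .ne a b, s => s.reg a ≠ s.reg b

/-- Programs: finite pieces of code with conditional branching and while-loops. -/
inductive Program : Type
  | instr (i : Instr)
  | seq (P Q : Program)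
  | ifElse (b : Test) (P Q : Program)
  | while (b : Test) (P : Program)

/-- `Runs w P s T s'`: on a machine with word size `w`, the program `P` started in state `s` halts
after exactly `T` units of time in state `s'`. -/
inductive Runs (w : ℕ) : Program → State → ℕ → State → Prop
  | instr (i : Instr) (s : State) : Runs w (.instr i) s 1 (i.exec w s)
  | seq {P Q : Program} {s s' s'' : State} {T T' : ℕ} :
      Runs w P s T s' → Runs w Q s' T' s'' → Runs w (.seq P Q) s (T + T') s''
  | ifTrue {b : Test} {P Q : Program} {s s' : State} {T : ℕ} :
      b.holds s → Runs w P s T s' → Runs w (.ifElse b P Q) s (1 + T) s'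
  | ifFalse {b : Test} {P Q : Program} {s s' : State} {T : ℕ} :
      ¬ b.holds s → Runs w Q s T s' → Runs w (.ifElse b P Q) s (1 + T) s'
  | whileTrue {b : Test} {P : Program} {s s' s'' : State} {T T' : ℕ} :
      b.holds s → Runs w P s T s' → Runs w (.while b P) s' T' s'' →
      Runs w (.while b P) s (1 + T + T') s''
  | whileFalse {b : Test} {P : Program} {s : State} :
      ¬ b.holds s → Runs w (.while b P) s 1 s

end WordRAM

/-! ### All-targets change-making -/

namespace ChangeMaking

/-- The minimum number of coins, with values among `v 0, …, v (n - 1)` and each value usable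
arbitrarily often, that sum to exactly `j`; it is `⊤` if there is no solution. -/
noncomputable def minCoins {n : ℕ} (v : Fin n → ℕ) (j : ℕ) : ℕ∞ :=
  ⨅ (m : Fin n → ℕ) (_ : ∑ i, m i * v i = j), ((∑ i, m i : ℕ) : ℕ∞)

/-- Representation of an element of `ℕ ∪ {∞}` by a word: `∞` is `0`, and `d` is `d + 1`. -/
noncomputable def encode (d : ℕ∞) : ℕ := if d = ⊤ then 0 else d.toNat + 1

/-- The initial state on the instance `(v, t)`: register `0` holds the number `n` of coin values,
register `1` holds `t`, memory cells `0, …, n - 1` hold the coin values, and all the rest is `0`. -/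
def inputState {n : ℕ} (v : Fin n → ℕ) (t : ℕ) : WordRAM.State where
  reg := fun r => if r = 0 then n else if r = 1 then t else 0
  mem := fun a => if h : a < n then v ⟨a, h⟩ else 0

/-- The program `P`, on a machine with word size `w`, solves the all-targets problem for the
instance `(v, t)` in time `T`: it halts after `T` units of time, and then memory cell `j` holds the
minimum number of coins summing to `j`, for every `j = 0, …, t`. -/
def SolvesIn (w : ℕ) (P : WordRAM.Program) {n : ℕ} (v : Fin n → ℕ) (t T : ℕ) : Prop :=
  ∃ s : WordRAM.State, WordRAM.Runs w P (inputState v t) T s ∧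
    ∀ j ≤ t, s.mem j = encode (minCoins v j)

end ChangeMaking

/-! ### A small imperative language compiled to the word RAM -/

namespace WordRAM

/-- The operations on unbounded natural numbers which the word operations implement as long as
nothing overflows. -/
def BinOp.exact : BinOp → ℕ → ℕ → ℕ
  | .add, a, b => a + b
  | .sub, a, b => a - b
  | .mul, a, b => a * b
  | .div, a, b => a / b
  | .mod, a, b => a % b
  | .and, a, b => a &&& b
  | .or, a, b => a ||| b
  | .xor, a, b => a ^^^ b
  | .shl, a, b => a <<< b
  | .shr, a, b => a >>> b

/-- A sufficient condition for a word operation to agree with the exact operation. -/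
def BinOp.Fits (w : ℕ) : BinOp → ℕ → ℕ → Prop
  | .add, a, b => a + b < 2 ^ w
  | .sub, a, b => b ≤ a ∧ a < 2 ^ w
  | .mul, a, b => a * b < 2 ^ w
  | .shl, a, b => a <<< b < 2 ^ w
  | _, _, _ => True

theorem BinOp.eval_eq_exact {w : ℕ} {op : BinOp} {a b : ℕ} (h : op.Fits w a b) :
    op.eval w a b = op.exact a b := by
  cases op <;> simp only [BinOp.Fits, BinOp.eval, BinOp.exact] at *
  case sub =>
    have : a + (2 ^ w - b) = a - b + 2 ^ w := by omega
    rw [this, Nat.add_mod_right, Nat.mod_eq_of_lt (by omega)]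
  all_goals exact Nat.mod_eq_of_lt h

/-- Expressions. The operations `bin` are meant to be exact, the operations `wrap` are meant modulo
`2 ^ w`; both are compiled to the same instructions. -/
inductive Expr : Type
  | lit (n : ℕ)
  | var (x : ℕ)
  | bin (op : BinOp) (a b : Expr)
  | wrap (op : BinOp) (a b : Expr)
  | load (a : Expr)
  | iteLt (a b x y : Expr)

instance : Add Expr := ⟨.bin .add⟩
instance : Sub Expr := ⟨.bin .sub⟩
instance : Mul Expr := ⟨.bin .mul⟩
instance : Div Expr := ⟨.bin .div⟩
instance : Mod Expr := ⟨.bin .mod⟩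
instance (n : ℕ) : OfNat Expr n := ⟨.lit n⟩

/-- Variables and memory. -/
structure Store : Type where
  var : ℕ → ℕ
  mem : ℕ → ℕ

/-- The value of an expression. -/
def Expr.val (w : ℕ) (σ : Store) : Expr → ℕ
  | .lit n => n
  | .var x => σ.var x
  | .bin op a b => op.exact (a.val w σ) (b.val w σ)
  | .wrap op a b => op.eval w (a.val w σ) (b.val w σ)
  | .load a => σ.mem (a.val w σ)
  | .iteLt a b x y => if a.val w σ < b.val w σ then x.val w σ else y.val w σ

/-- No exact operation in the expression overflows. -/
def Expr.Safe (w : ℕ) (σ : Store) : Expr → Prop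
  | .lit n => n < 2 ^ w
  | .var _ => True
  | .bin op a b => a.Safe w σ ∧ b.Safe w σ ∧ op.Fits w (a.val w σ) (b.val w σ)
  | .wrap _ a b => a.Safe w σ ∧ b.Safe w σ
  | .load a => a.Safe w σ
  | .iteLt a b x y => a.Safe w σ ∧ b.Safe w σ ∧
      (a.val w σ < b.val w σ → x.Safe w σ) ∧ (¬ a.val w σ < b.val w σ → y.Safe w σ)

/-- A bound on the time to evaluate an expression. -/
def Expr.cost : Expr → ℕ
  | .lit _ => 1
  | .var _ => 1
  | .bin _ a b => a.cost + b.cost + 1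
  | .wrap _ a b => a.cost + b.cost + 1
  | .load a => a.cost + 1
  | .iteLt a b x y => a.cost + b.cost + (1 + (x.cost + y.cost))

section Simp

variable (w : ℕ) (σ : Store) (a b x y : Expr) (n : ℕ)

@[simp] theorem Expr.val_ofNat : (no_index (OfNat.ofNat n) : Expr).val w σ = n := rfl
@[simp] theorem Expr.val_var : (Expr.var n).val w σ = σ.var n := rfl
@[simp] theorem Expr.val_add : (a + b).val w σ = a.val w σ + b.val w σ := rfl
@[simp] theorem Expr.val_sub : (a - b).val w σ = a.val w σ - b.val w σ := rfl
@[simp] theorem Expr.val_mul : (a * b).val w σ = a.val w σ * b.val w σ := rfl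
@[simp] theorem Expr.val_div : (a / b).val w σ = a.val w σ / b.val w σ := rfl
@[simp] theorem Expr.val_mod : (a % b).val w σ = a.val w σ % b.val w σ := rfl
@[simp] theorem Expr.val_shl :
    (Expr.bin .shl a b).val w σ = a.val w σ <<< b.val w σ := rfl
@[simp] theorem Expr.val_shr :
    (Expr.bin .shr a b).val w σ = a.val w σ >>> b.val w σ := rfl
@[simp] theorem Expr.val_wrap (op : BinOp) :
    (Expr.wrap op a b).val w σ = op.eval w (a.val w σ) (b.val w σ) := rfl
@[simp] theorem Expr.val_load : (Expr.load a).val w σ = σ.mem (a.val w σ) := rfl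
@[simp] theorem Expr.val_iteLt : (Expr.iteLt a b x y).val w σ =
    if a.val w σ < b.val w σ then x.val w σ else y.val w σ := rfl

@[simp] theorem Expr.safe_ofNat : (no_index (OfNat.ofNat n) : Expr).Safe w σ ↔ n < 2 ^ w := Iff.rfl
@[simp] theorem Expr.safe_var : (Expr.var n).Safe w σ := trivial
@[simp] theorem Expr.safe_add : (a + b).Safe w σ ↔
    a.Safe w σ ∧ b.Safe w σ ∧ a.val w σ + b.val w σ < 2 ^ w := Iff.rfl
@[simp] theorem Expr.safe_sub : (a - b).Safe w σ ↔
    a.Safe w σ ∧ b.Safe w σ ∧ b.val w σ ≤ a.val w σ ∧ a.val w σ < 2 ^ w := Iff.rfl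
@[simp] theorem Expr.safe_mul : (a * b).Safe w σ ↔
    a.Safe w σ ∧ b.Safe w σ ∧ a.val w σ * b.val w σ < 2 ^ w := Iff.rfl
@[simp] theorem Expr.safe_div : (a / b).Safe w σ ↔ a.Safe w σ ∧ b.Safe w σ :=
  ⟨fun h => ⟨h.1, h.2.1⟩, fun h => ⟨h.1, h.2, trivial⟩⟩
@[simp] theorem Expr.safe_mod : (a % b).Safe w σ ↔ a.Safe w σ ∧ b.Safe w σ :=
  ⟨fun h => ⟨h.1, h.2.1⟩, fun h => ⟨h.1, h.2, trivial⟩⟩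
@[simp] theorem Expr.safe_shl : (Expr.bin .shl a b).Safe w σ ↔
    a.Safe w σ ∧ b.Safe w σ ∧ a.val w σ <<< b.val w σ < 2 ^ w := Iff.rfl
@[simp] theorem Expr.safe_shr : (Expr.bin .shr a b).Safe w σ ↔ a.Safe w σ ∧ b.Safe w σ :=
  ⟨fun h => ⟨h.1, h.2.1⟩, fun h => ⟨h.1, h.2, trivial⟩⟩
@[simp] theorem Expr.safe_wrap (op : BinOp) :
    (Expr.wrap op a b).Safe w σ ↔ a.Safe w σ ∧ b.Safe w σ := Iff.rfl
@[simp] theorem Expr.safe_load : (Expr.load a).Safe w σ ↔ a.Safe w σ := Iff.rfl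
@[simp] theorem Expr.safe_iteLt : (Expr.iteLt a b x y).Safe w σ ↔ a.Safe w σ ∧ b.Safe w σ ∧
    (a.val w σ < b.val w σ → x.Safe w σ) ∧ (¬ a.val w σ < b.val w σ → y.Safe w σ) := Iff.rfl

@[simp] theorem Expr.cost_ofNat : (no_index (OfNat.ofNat n) : Expr).cost = 1 := rfl
@[simp] theorem Expr.cost_var : (Expr.var n).cost = 1 := rfl
@[simp] theorem Expr.cost_add : (a + b).cost = a.cost + b.cost + 1 := rfl
@[simp] theorem Expr.cost_sub : (a - b).cost = a.cost + b.cost + 1 := rfl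
@[simp] theorem Expr.cost_mul : (a * b).cost = a.cost + b.cost + 1 := rfl
@[simp] theorem Expr.cost_div : (a / b).cost = a.cost + b.cost + 1 := rfl
@[simp] theorem Expr.cost_mod : (a % b).cost = a.cost + b.cost + 1 := rfl
@[simp] theorem Expr.cost_bin (op : BinOp) :
    (Expr.bin op a b).cost = a.cost + b.cost + 1 := rfl
@[simp] theorem Expr.cost_wrap (op : BinOp) :
    (Expr.wrap op a b).cost = a.cost + b.cost + 1 := rfl
@[simp] theorem Expr.cost_load : (Expr.load a).cost = a.cost + 1 := rfl
@[simp] theorem Expr.cost_iteLt :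
    (Expr.iteLt a b x y).cost = a.cost + b.cost + (1 + (x.cost + y.cost)) := rfl

end Simp

/-- Variable `x` lives in register `2 * x`. -/
def State.toStore (s : State) : Store := ⟨fun x => s.reg (2 * x), s.mem⟩

/-- Evaluate an expression into the temporary register `2 * d + 1`. -/
def Expr.compile : Expr → ℕ → Program
  | .lit n, d => .instr (.const (2 * d + 1) n)
  | .var x, d => .instr (.move (2 * d + 1) (2 * x))
  | .bin op a b, d => .seq (a.compile d) (.seq (b.compile (d + 1))
      (.instr (.bin op (2 * d + 1) (2 * d + 1) (2 * (d + 1) + 1))))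
  | .wrap op a b, d => .seq (a.compile d) (.seq (b.compile (d + 1))
      (.instr (.bin op (2 * d + 1) (2 * d + 1) (2 * (d + 1) + 1))))
  | .load a, d => .seq (a.compile d) (.instr (.load (2 * d + 1) (2 * d + 1)))
  | .iteLt a b x y, d => .seq (a.compile d) (.seq (b.compile (d + 1))
      (.ifElse (.lt (2 * d + 1) (2 * (d + 1) + 1)) (x.compile d) (y.compile d)))

/-- What evaluating an expression into temporary `d` may do to the state. -/
def TempStep (d : ℕ) (s s' : State) : Prop :=
  s'.toStore = s.toStore ∧ ∀ r < d, s'.reg (2 * r + 1) = s.reg (2 * r + 1)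

theorem TempStep.trans {d e : ℕ} {s s' s'' : State} (h : TempStep d s s') (h' : TempStep e s' s'')
    (hde : d ≤ e) : TempStep d s s'' :=
  ⟨h'.1.trans h.1, fun r hr => (h'.2 r (by omega)).trans (h.2 r hr)⟩

theorem tempStep_update (d x : ℕ) (s : State) :
    TempStep d s { s with reg := Function.update s.reg (2 * d + 1) x } := by
  refine ⟨?_, fun r hr => ?_⟩
  · simp only [State.toStore, Store.mk.injEq, and_true]
    funext y
    exact Function.update_of_ne (by omega) _ _
  · exact Function.update_of_ne (by omega) _ _

/-- Code for temporary `d` touches only the temporaries from `d` on, and variables live in even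
registers. Hence evaluating the right operand into temporary `d + 1` cannot disturb the left one,
and the store never changes. -/
theorem Expr.runs_compile {w : ℕ} (e : Expr) : ∀ (d : ℕ) (s : State), e.Safe w s.toStore →
    ∃ T s', T ≤ e.cost ∧ Runs w (e.compile d) s T s' ∧ TempStep d s s' ∧
      s'.reg (2 * d + 1) = e.val w s.toStore := by
  have binary : ∀ (op : BinOp) (a b : Expr),
      (∀ (d : ℕ) (s : State), a.Safe w s.toStore → ∃ T s', T ≤ a.cost ∧
        Runs w (a.compile d) s T s' ∧ TempStep d s s' ∧ s'.reg (2 * d + 1) = a.val w s.toStore) →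
      (∀ (d : ℕ) (s : State), b.Safe w s.toStore → ∃ T s', T ≤ b.cost ∧
        Runs w (b.compile d) s T s' ∧ TempStep d s s' ∧ s'.reg (2 * d + 1) = b.val w s.toStore) →
      ∀ (d : ℕ) (s : State), a.Safe w s.toStore → b.Safe w s.toStore →
      ∃ T s', T ≤ a.cost + b.cost + 1 ∧ Runs w (.seq (a.compile d) (.seq (b.compile (d + 1))
        (.instr (.bin op (2 * d + 1) (2 * d + 1) (2 * (d + 1) + 1))))) s T s' ∧ TempStep d s s' ∧
        s'.reg (2 * d + 1) = op.eval w (a.val w s.toStore) (b.val w s.toStore) := by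
    intro op a b iha ihb d s ha hb
    obtain ⟨T₁, s₁, hT₁, hr₁, hs₁, hv₁⟩ := iha d s ha
    obtain ⟨T₂, s₂, hT₂, hr₂, hs₂, hv₂⟩ := ihb (d + 1) s₁ (by rwa [hs₁.1])
    refine ⟨_, _, ?_, .seq hr₁ (.seq hr₂ (.instr _ _)),
      (hs₁.trans hs₂ (by omega)).trans (tempStep_update d _ _) le_rfl, ?_⟩
    · omega
    · rw [hs₁.1] at hv₂
      simp [Instr.exec, hv₂, hs₂.2 d (by omega), hv₁]
  induction e with
  | lit n =>
    intro d s h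
    refine ⟨1, _, le_rfl, .instr _ _, tempStep_update d _ _, ?_⟩
    simpa [Instr.exec, Expr.val] using Nat.mod_eq_of_lt h
  | var x =>
    intro d s _
    refine ⟨1, _, le_rfl, .instr _ _, tempStep_update d _ _, ?_⟩
    simp [Instr.exec, Expr.val, State.toStore]
  | bin op a b iha ihb =>
    intro d s h
    obtain ⟨T, s', hT, hr, hs, hv⟩ := binary op a b iha ihb d s h.1 h.2.1
    exact ⟨T, s', hT, hr, hs, hv.trans (BinOp.eval_eq_exact h.2.2)⟩
  | wrap op a b iha ihb =>
    intro d s h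
    exact binary op a b iha ihb d s h.1 h.2
  | load a iha =>
    intro d s h
    obtain ⟨T₁, s₁, hT₁, hr₁, hs₁, hv₁⟩ := iha d s h
    refine ⟨_, _, ?_, .seq hr₁ (.instr _ _), hs₁.trans (tempStep_update d _ _) le_rfl, ?_⟩
    · simp only [Expr.cost]; omega
    · have : s₁.mem = s.mem := congrArg Store.mem hs₁.1
      simp only [Instr.exec, Function.update_self, hv₁, this]
      rfl
  | iteLt a b x y iha ihb ihx ihy =>
    intro d s h
    obtain ⟨ha, hb, hx, hy⟩ := h
    obtain ⟨T₁, s₁, hT₁, hr₁, hs₁, hv₁⟩ := iha d s ha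
    obtain ⟨T₂, s₂, hT₂, hr₂, hs₂, hv₂⟩ := ihb (d + 1) s₁ (by rwa [hs₁.1])
    have hs := hs₁.trans hs₂ (by omega)
    rw [hs₁.1] at hv₂
    have hv₁' := (hs₂.2 d (by omega)).trans hv₁
    by_cases hlt : a.val w s.toStore < b.val w s.toStore
    · obtain ⟨T₃, s₃, hT₃, hr₃, hs₃, hv₃⟩ := ihx d s₂ (by rw [hs.1]; exact hx hlt)
      refine ⟨_, _, ?_, .seq hr₁ (.seq hr₂ (.ifTrue ?_ hr₃)), hs.trans hs₃ le_rfl, ?_⟩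
      · simp only [Expr.cost]; omega
      · simpa [Test.holds, hv₁', hv₂] using hlt
      · simp [hv₃, hs.1, Expr.val, hlt]
    · obtain ⟨T₃, s₃, hT₃, hr₃, hs₃, hv₃⟩ := ihy d s₂ (by rw [hs.1]; exact hy hlt)
      refine ⟨_, _, ?_, .seq hr₁ (.seq hr₂ (.ifFalse ?_ hr₃)), hs.trans hs₃ le_rfl, ?_⟩
      · simp only [Expr.cost]; omega
      · simpa [Test.holds, hv₁', hv₂] using hlt
      · simp [hv₃, hs.1, Expr.val, hlt]

/-- Statements. -/
inductive Stmt : Type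
  | assign (x : ℕ) (e : Expr)
  | store (a e : Expr)
  | seq (S S' : Stmt)
  | ifLt (a b : Expr) (S S' : Stmt)
  | whileLt (a b : Expr) (S : Stmt)

infixr:60 " ;; " => Stmt.seq
infix:62 " ≔ " => Stmt.assign

/-- Compilation of statements. -/
def Stmt.compile : Stmt → Program
  | .assign x e => .seq (e.compile 0) (.instr (.move (2 * x) 1))
  | .store a e => .seq (a.compile 0) (.seq (e.compile 1) (.instr (.store 1 3)))
  | .seq S S' => .seq S.compile S'.compile
  | .ifLt a b S S' =>
      .seq (a.compile 0) (.seq (b.compile 1) (.ifElse (.lt 1 3) S.compile S'.compile))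
  | .whileLt a b S => .seq (.seq (a.compile 0) (b.compile 1))
      (.while (.lt 1 3) (.seq S.compile (.seq (a.compile 0) (b.compile 1))))

/-- `Exec w S σ T Q`: started with the store `σ`, the statement `S` halts after at most `T` units of
time with a store satisfying `Q`. -/
def Exec (w : ℕ) (S : Stmt) (σ : Store) (T : ℕ) (Q : Store → Prop) : Prop :=
  ∀ s : State, s.toStore = σ →
    ∃ T' s', T' ≤ T ∧ Runs w S.compile s T' s' ∧ Q s'.toStore

/-- The store after an assignment to a variable. -/
def Store.set (σ : Store) (x a : ℕ) : Store := ⟨Function.update σ.var x a, σ.mem⟩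

/-- The store after a write to memory. -/
def Store.write (σ : Store) (a b : ℕ) : Store := ⟨σ.var, Function.update σ.mem a b⟩

/-! ### Proof rules for execution with a time bound -/

section Rules

variable {w : ℕ} {σ : Store} {T T' : ℕ} {Q Q' : Store → Prop}

theorem Exec.mono {S : Stmt} (h : Exec w S σ T Q) (hT : T ≤ T') (hQ : ∀ σ', Q σ' → Q' σ') :
    Exec w S σ T' Q' := fun s hs =>
  let ⟨T₁, s', h₁, h₂, h₃⟩ := h s hs
  ⟨T₁, s', h₁.trans hT, h₂, hQ _ h₃⟩

theorem Exec.assign {x : ℕ} {e : Expr} (he : e.Safe w σ) (hQ : Q (σ.set x (e.val w σ))) :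
    Exec w (.assign x e) σ (e.cost + 1) Q := by
  rintro s rfl
  obtain ⟨T₁, s₁, hT₁, hr₁, hs₁, hv₁⟩ := e.runs_compile 0 s he
  refine ⟨_, _, by omega, .seq hr₁ (.instr _ _), ?_⟩
  convert hQ using 1
  simp only [Instr.exec, State.toStore, Store.set, Store.mk.injEq]
  refine ⟨?_, congrArg Store.mem hs₁.1⟩
  funext y
  have := congrFun (congrArg Store.var hs₁.1) y
  simp only [State.toStore] at this hv₁
  by_cases hy : y = x
  · subst hy
    simpa using hv₁
  · rw [Function.update_of_ne (by omega), Function.update_of_ne hy, this]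

theorem Exec.store {a e : Expr} (ha : a.Safe w σ) (he : e.Safe w σ)
    (hQ : Q (σ.write (a.val w σ) (e.val w σ))) :
    Exec w (.store a e) σ (a.cost + e.cost + 1) Q := by
  rintro s rfl
  obtain ⟨T₁, s₁, hT₁, hr₁, hs₁, hv₁⟩ := a.runs_compile 0 s ha
  obtain ⟨T₂, s₂, hT₂, hr₂, hs₂, hv₂⟩ := e.runs_compile 1 s₁ (by rwa [hs₁.1])
  refine ⟨_, _, by omega, .seq hr₁ (.seq hr₂ (.instr _ _)), ?_⟩
  convert hQ using 1
  have h := (hs₁.trans hs₂ (by omega)).1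
  have hm : s₂.mem = s.mem := congrArg Store.mem h
  have hr := congrArg Store.var h
  have h1 : s₂.reg 1 = _ := (hs₂.2 0 (by omega)).trans hv₁
  have h3 : s₂.reg 3 = _ := hv₂
  rw [hs₁.1] at h3
  simp only [Instr.exec, Store.write, h1, h3]
  exact Store.mk.injEq _ _ _ _ ▸ ⟨hr, by rw [hm]; rfl⟩

theorem Exec.seq {S S' : Stmt} (h : Exec w S σ T fun σ' => Exec w S' σ' T' Q) :
    Exec w (.seq S S') σ (T + T') Q := by
  intro s hs
  obtain ⟨T₁, s₁, hT₁, hr₁, h₁⟩ := h s hs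
  obtain ⟨T₂, s₂, hT₂, hr₂, h₂⟩ := h₁ s₁ rfl
  exact ⟨_, s₂, by omega, .seq hr₁ hr₂, h₂⟩

theorem Exec.ifLt {a b : Expr} {S S' : Stmt} (ha : a.Safe w σ) (hb : b.Safe w σ)
    (h : a.val w σ < b.val w σ → Exec w S σ T Q)
    (h' : ¬ a.val w σ < b.val w σ → Exec w S' σ T Q) :
    Exec w (.ifLt a b S S') σ (a.cost + b.cost + 1 + T) Q := by
  rintro s rfl
  obtain ⟨T₁, s₁, hT₁, hr₁, hs₁, hv₁⟩ := a.runs_compile 0 s ha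
  obtain ⟨T₂, s₂, hT₂, hr₂, hs₂, hv₂⟩ := b.runs_compile 1 s₁ (by rwa [hs₁.1])
  have hst := (hs₁.trans hs₂ (by omega)).1
  have h1 : s₂.reg 1 = _ := (hs₂.2 0 (by omega)).trans hv₁
  have h3 : s₂.reg 3 = _ := hv₂
  rw [hs₁.1] at h3
  by_cases hlt : a.val w s.toStore < b.val w s.toStore
  · obtain ⟨T₃, s₃, hT₃, hr₃, h₃⟩ := h hlt s₂ hst
    exact ⟨_, s₃, by omega, .seq hr₁ (.seq hr₂ (.ifTrue (by simpa [Test.holds, h1, h3]) hr₃)), h₃⟩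
  · obtain ⟨T₃, s₃, hT₃, hr₃, h₃⟩ := h' hlt s₂ hst
    exact ⟨_, s₃, by omega,
      .seq hr₁ (.seq hr₂ (.ifFalse (by simpa [Test.holds, h1, h3] using hlt) hr₃)), h₃⟩

/-- The rule for a loop with exactly `N` iterations, the `k`-th of which takes at most `c k` units of
time. -/
theorem Exec.whileLt {a b : Expr} {S : Stmt} (N : ℕ) (I : ℕ → Store → Prop) (c : ℕ → ℕ)
    (h0 : I 0 σ)
    (hsafe : ∀ k ≤ N, ∀ σ', I k σ' → a.Safe w σ' ∧ b.Safe w σ')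
    (hstep : ∀ k < N, ∀ σ', I k σ' →
      a.val w σ' < b.val w σ' ∧ Exec w S σ' (c k) (I (k + 1)))
    (hend : ∀ σ', I N σ' → ¬ a.val w σ' < b.val w σ' ∧ Q σ') :
    Exec w (.whileLt a b S) σ
      (a.cost + b.cost + 1 + ∑ k ∈ Finset.range N, (a.cost + b.cost + 1 + c k)) Q := by
  have htest : ∀ k ≤ N, ∀ s : State, I k s.toStore → ∃ T s', T ≤ a.cost + b.cost ∧
      Runs w (.seq (a.compile 0) (b.compile 1)) s T s' ∧ s'.toStore = s.toStore ∧
      ((Test.lt 1 3).holds s' ↔ a.val w s.toStore < b.val w s.toStore) := by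
    intro k hk s hI
    obtain ⟨ha, hb⟩ := hsafe k hk _ hI
    obtain ⟨T₁, s₁, hT₁, hr₁, hs₁, hv₁⟩ := a.runs_compile 0 s ha
    obtain ⟨T₂, s₂, hT₂, hr₂, hs₂, hv₂⟩ := b.runs_compile 1 s₁ (by rwa [hs₁.1])
    have h1 : s₂.reg 1 = _ := (hs₂.2 0 (by omega)).trans hv₁
    have h3 : s₂.reg 3 = _ := hv₂
    rw [hs₁.1] at h3
    exact ⟨_, s₂, by omega, .seq hr₁ hr₂, (hs₁.trans hs₂ (by omega)).1,
      by simp [Test.holds, h1, h3]⟩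
  -- Induction on the number `j` of iterations still to come; the operands of the next test are
  -- already in registers `1` and `3`.
  have hloop : ∀ j ≤ N, ∀ s : State, I (N - j) s.toStore →
      ((Test.lt 1 3).holds s ↔ a.val w s.toStore < b.val w s.toStore) →
      ∃ T s', T ≤ 1 + ∑ k ∈ Finset.Ico (N - j) N, (a.cost + b.cost + 1 + c k) ∧
        Runs w (.while (.lt 1 3) (.seq S.compile (.seq (a.compile 0) (b.compile 1)))) s T s' ∧
        Q s'.toStore := by
    intro j
    induction j with
    | zero =>
      intro _ s hI hb
      obtain ⟨h₁, h₂⟩ := hend _ hI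
      exact ⟨1, s, by simp, .whileFalse (by rwa [hb]), h₂⟩
    | succ j ih =>
      intro hj s hI hb
      obtain ⟨h₁, h₂⟩ := hstep (N - (j + 1)) (by omega) _ hI
      obtain ⟨T₁, s₁, hT₁, hr₁, hI₁⟩ := h₂ s rfl
      rw [show N - (j + 1) + 1 = N - j by omega] at hI₁
      obtain ⟨T₂, s₂, hT₂, hr₂, hs₂, hb₂⟩ := htest _ (by omega) s₁ hI₁
      obtain ⟨T₃, s₃, hT₃, hr₃, hQ₃⟩ :=
        ih (by omega) s₂ (by rwa [hs₂]) (by rw [hb₂, hs₂])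
      refine ⟨_, s₃, ?_, .whileTrue (hb.2 h₁) (.seq hr₁ hr₂) hr₃, hQ₃⟩
      rw [Finset.sum_eq_sum_Ico_succ_bot (by omega), show N - (j + 1) + 1 = N - j by omega]
      omega
  rintro s rfl
  obtain ⟨T₁, s₁, hT₁, hr₁, hs₁, hb₁⟩ := htest 0 (by omega) s h0
  obtain ⟨T₂, s₂, hT₂, hr₂, hQ₂⟩ :=
    hloop N le_rfl s₁ (by rwa [Nat.sub_self, hs₁]) (by rw [hb₁, hs₁])
  refine ⟨_, s₂, ?_, .seq hr₁ hr₂, hQ₂⟩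
  rw [Nat.sub_self, ← Finset.range_eq_Ico] at hT₂
  omega

/-- The rule for a loop all of whose iterations take at most `c` units of time. -/
theorem Exec.whileLt_const {a b : Expr} {S : Stmt} (N : ℕ) (I : ℕ → Store → Prop) (c : ℕ)
    (h0 : I 0 σ)
    (hsafe : ∀ k ≤ N, ∀ σ', I k σ' → a.Safe w σ' ∧ b.Safe w σ')
    (hstep : ∀ k < N, ∀ σ', I k σ' → a.val w σ' < b.val w σ' ∧ Exec w S σ' c (I (k + 1)))
    (hend : ∀ σ', I N σ' → ¬ a.val w σ' < b.val w σ' ∧ Q σ') :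
    Exec w (.whileLt a b S) σ ((N + 1) * (a.cost + b.cost + 1 + c)) Q := by
  refine (Exec.whileLt N I (fun _ => c) h0 hsafe hstep hend).mono ?_ fun _ h => h
  rw [Finset.sum_const, Finset.card_range, smul_eq_mul]
  nlinarith

end Rules

/-! ### Frame property: what a program leaves unchanged -/

/-- The registers which a program may change. -/
def Program.writes : Program → Set ℕ
  | .instr (.const d _) => {d}
  | .instr (.move d _) => {d}
  | .instr (.bin _ d _ _) => {d}
  | .instr (.load d _) => {d}
  | .instr (.store _ _) => ∅
  | .seq P Q => P.writes ∪ Q.writes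
  | .ifElse _ P Q => P.writes ∪ Q.writes
  | .while _ P => P.writes

theorem Runs.reg_of_notMem {w : ℕ} {P : Program} {s s' : State} {T : ℕ} (h : Runs w P s T s')
    {r : ℕ} (hr : r ∉ P.writes) : s'.reg r = s.reg r := by
  induction h with
  | instr i s =>
    cases i <;> simp_all [Program.writes, Instr.exec, Function.update_of_ne]
  | seq _ _ ih ih' =>
    simp only [Program.writes, Set.mem_union, not_or] at hr
    rw [ih' hr.2, ih hr.1]
  | ifTrue _ _ ih =>
    simp only [Program.writes, Set.mem_union, not_or] at hr
    exact ih hr.1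
  | ifFalse _ _ ih =>
    simp only [Program.writes, Set.mem_union, not_or] at hr
    exact ih hr.2
  | whileTrue _ _ _ ih ih' => rw [ih' hr, ih hr]
  | whileFalse _ => rfl

theorem Expr.notMem_writes_compile (e : Expr) (x d : ℕ) : 2 * x ∉ (e.compile d).writes := by
  induction e generalizing d <;> simp_all [Expr.compile, Program.writes] <;> omega

/-- The variables which a statement may change. -/
def Stmt.writes : Stmt → List ℕ
  | .assign x _ => [x]
  | .store _ _ => []
  | .seq S S' => S.writes ++ S'.writes
  | .ifLt _ _ S S' => S.writes ++ S'.writes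
  | .whileLt _ _ S => S.writes

theorem Stmt.notMem_writes_compile (S : Stmt) {x : ℕ} (hx : x ∉ S.writes) :
    2 * x ∉ S.compile.writes := by
  induction S <;>
    simp_all [Stmt.compile, Stmt.writes, Program.writes, Expr.notMem_writes_compile]

/-- A variable to which a statement does not assign keeps its value. -/
theorem Exec.frame {w : ℕ} {S : Stmt} {σ : Store} {T : ℕ} {Q : Store → Prop}
    (h : Exec w S σ T Q) :
    Exec w S σ T fun σ' => Q σ' ∧ ∀ x ∉ S.writes, σ'.var x = σ.var x := by
  rintro s rfl
  obtain ⟨T₁, s₁, hT₁, hr₁, h₁⟩ := h s rfl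
  exact ⟨T₁, s₁, hT₁, hr₁, h₁, fun x hx => hr₁.reg_of_notMem (S.notMem_writes_compile hx)⟩

/-! ### Loops that fill an array -/

/-- The store in which the first `k` entries of the array at address `d` have been overwritten by the
values of `f`. -/
def fillMem (m : ℕ → ℕ) (d k : ℕ) (f : ℕ → ℕ) : ℕ → ℕ :=
  fun a => if d ≤ a ∧ a < d + k then f (a - d) else m a

theorem fillMem_add {m : ℕ → ℕ} {d k i : ℕ} {f : ℕ → ℕ} (hi : i < k) :
    fillMem m d k f (d + i) = f i := by
  simp [fillMem, hi]

theorem fillMem_of_lt {m : ℕ → ℕ} {d k a : ℕ} {f : ℕ → ℕ} (h : a < d) :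
    fillMem m d k f a = m a := by
  simp [fillMem, h]

theorem fillMem_of_ge {m : ℕ → ℕ} {d k a : ℕ} {f : ℕ → ℕ} (h : d + k ≤ a) :
    fillMem m d k f a = m a := by
  simp [fillMem, h]

theorem fillMem_zero (m : ℕ → ℕ) (d : ℕ) (f : ℕ → ℕ) : fillMem m d 0 f = m := by
  funext a
  simp only [fillMem]
  rw [if_neg (by omega)]

theorem update_fillMem (m : ℕ → ℕ) (d k : ℕ) (f : ℕ → ℕ) :
    Function.update (fillMem m d k f) (d + k) (f k) = fillMem m d (k + 1) f := by
  funext a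
  simp only [fillMem, Function.update_apply]
  by_cases h : a = d + k
  · subst h
    simp
  · rw [if_neg h]
    congr 1
    simp only [eq_iff_iff]
    omega

/-- Fill the `n` entries of the array at address `d` with the values of the expression `e` for
`x = 0, …, n - 1`, where `n`, `d` and `x` are variables. -/
def Stmt.fill (x d n : ℕ) (e : Expr) : Stmt :=
  x ≔ 0 ;; .whileLt (.var x) (.var n) (.store (.var d + .var x) e ;; x ≔ .var x + 1)

theorem Exec.fill {w : ℕ} {σ : Store} {x d n : ℕ} {e : Expr} {Q : Store → Prop} {T : ℕ}
    (f : ℕ → ℕ) (hxd : d ≠ x) (hxn : n ≠ x) (hlt : σ.var d + σ.var n < 2 ^ w)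
    (hf : ∀ k < σ.var n,
      e.Safe w ⟨Function.update σ.var x k, fillMem σ.mem (σ.var d) k f⟩ ∧
      e.val w ⟨Function.update σ.var x k, fillMem σ.mem (σ.var d) k f⟩ = f k)
    (hT : (σ.var n + 1) * (e.cost + 12) + 2 ≤ T)
    (hQ : Q ⟨Function.update σ.var x (σ.var n), fillMem σ.mem (σ.var d) (σ.var n) f⟩) :
    Exec w (Stmt.fill x d n e) σ T Q := by
  refine Exec.mono (T := 2 + (σ.var n + 1) * (e.cost + 12)) (Exec.seq (Exec.assign ?_ ?_)) (by omega)
    fun _ h => h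
  · simp
  refine Exec.mono (Exec.whileLt_const (σ.var n)
    (fun k σ' => σ' = ⟨Function.update σ.var x k, fillMem σ.mem (σ.var d) k f⟩) (e.cost + 9)
    ?_ ?_ ?_ ?_) (T' := (σ.var n + 1) * (e.cost + 12)) ?_ fun _ h => h
  · simp [Store.set, fillMem_zero]
  · simp
  · rintro k hk _ rfl
    refine ⟨by simpa [hxn] using hk, ?_⟩
    obtain ⟨hs, hv⟩ := hf k hk
    refine Exec.mono (Exec.seq (T' := 4) (Exec.store ?_ hs (Exec.assign ?_ ?_)))
      ?_ fun _ h => h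
    · simp [hxd]; omega
    · simp only [Store.write, Expr.safe_add, Expr.safe_var, Expr.safe_ofNat, Expr.val_var,
        Function.update_self, Expr.val_ofNat, true_and]
      omega
    · simp only [hv, Store.write, Store.set, Expr.val_add, Expr.val_var, Function.update_self,
        Function.update_of_ne hxd, Expr.val_ofNat, Function.update_idem, update_fillMem]
    · simp
      omega
  · rintro _ rfl
    exact ⟨by simp [hxn], hQ⟩
  · exact Nat.mul_le_mul_left _ (by simp; omega)

end WordRAM

/-! ### Negacyclic convolution by Nussbaumer's algorithm -/

namespace Nussbaumer

open Finset

variable {A : Type*} [CommRing A]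

/-- The value at `y` of the polynomial whose coefficients are the `q`-th block of length `r`. -/
def row (r : ℕ) (y : A) (F : ℕ → A) (q : ℕ) : A := ∑ j ∈ range r, F (q * r + j) * y ^ j

/-- Every block of length `s * r`, read as a polynomial in `x` and `y = x ^ s`, becomes `2 * s` blocks
of length `r`, the coefficients of the powers of `x`; the upper half of them is zero. -/
def pad (s r : ℕ) (F : ℕ → A) (k : ℕ) : A :=
  if k / r % (2 * s) < s then F (k / r / (2 * s) * (s * r) + (k / r % (2 * s) + s * (k % r))) else 0

/-- A butterfly stage with half-length `l` of the Fourier transform over the ring of polynomials in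
`y` modulo `y ^ r + 1`. -/
def stage (r l : ℕ) (F : ℕ → A) (k : ℕ) : A :=
  let u := (k / r / l / 2 * (2 * l) + k / r % l) * r
  let c := k / r % l * (r / l)
  if k / r / l % 2 < 1 then F (u + k % r) + F (u + l * r + k % r)
  else if k % r < c then F (u + l * r + (k % r + r - c)) - F (u + (k % r + r - c))
  else F (u + (k % r - c)) - F (u + l * r + (k % r - c))

/-- Twice the inverse of `stage`. -/
def unstage (r l : ℕ) (F : ℕ → A) (k : ℕ) : A :=
  let u := (k / r / (2 * l) * (2 * l) + k / r % (2 * l) % l) * r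
  let c := k / r % (2 * l) % l * (r / l)
  if k / r % (2 * l) < l then
    if k % r + c < r then F (u + k % r) + F (u + l * r + (k % r + c))
    else F (u + k % r) - F (u + l * r + (k % r + c - r))
  else
    if k % r + c < r then F (u + k % r) - F (u + l * r + (k % r + c))
    else F (u + k % r) + F (u + l * r + (k % r + c - r))

/-- Products modulo `y ^ 2 + 1` of the blocks of length `2` with the blocks at distance `h`. -/
def base (h : ℕ) (F : ℕ → A) (k : ℕ) : A :=
  if k % 2 < 1 then
    F (k / 2 * 2) * F (h + k / 2 * 2) - F (k / 2 * 2 + 1) * F (h + k / 2 * 2 + 1)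
  else F (k / 2 * 2) * F (h + k / 2 * 2 + 1) + F (k / 2 * 2 + 1) * F (h + k / 2 * 2)

/-- The reverse of `pad`: `2 * s` blocks of length `r` become one of length `s * r`, by `y = x ^ s`. -/
def unpad (s r : ℕ) (F : ℕ → A) (k : ℕ) : A :=
  let u := (k / (s * r) * (2 * s) + k % (s * r) % s) * r
  if k % (s * r) / s < 1 then F (u + k % (s * r) / s) - F (u + s * r + (r - 1))
  else F (u + k % (s * r) / s) + F (u + s * r + (k % (s * r) / s - 1))

/-- The stages of half-lengths `2 ^ (d - 1), …, 2, 1`. -/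
def fft (r : ℕ) : ℕ → (ℕ → A) → ℕ → A
  | 0, F => F
  | d + 1, F => fft r d (stage r (2 ^ d) F)

/-- The inverse stages of half-lengths `1, 2, …, 2 ^ (d - 1)`. -/
def ifft (r : ℕ) : ℕ → (ℕ → A) → ℕ → A
  | 0, F => F
  | d + 1, F => unstage r (2 ^ d) (ifft r d F)

/-- All the transforms down to blocks of length `2`, starting with blocks of length `2 ^ (a + 1)`. -/
def forward (a : ℕ) (F : ℕ → A) : ℕ → A :=
  if a = 0 then F
  else forward (a / 2)
    (fft (2 ^ (a / 2 + 1)) (a - a / 2 + 1) (pad (2 ^ (a - a / 2)) (2 ^ (a / 2 + 1)) F))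
termination_by a

/-- All the inverse transforms. -/
def backward (a : ℕ) (F : ℕ → A) : ℕ → A :=
  if a = 0 then F
  else unpad (2 ^ (a - a / 2)) (2 ^ (a / 2 + 1))
    (ifft (2 ^ (a / 2 + 1)) (a - a / 2 + 1) (backward (a / 2) F))
termination_by a

/-- The number of levels of the recursion. -/
def levels (a : ℕ) : ℕ := if a = 0 then 0 else levels (a / 2) + 1
termination_by a

/-- The power of two by which the result is scaled. -/
def scale (a : ℕ) : ℕ := if a = 0 then 0 else scale (a / 2) + (a - a / 2 + 1)
termination_by a

/-! #### The stages in terms of rows -/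

/-- `stage` in terms of rows. -/
def rowStage (l : ℕ) (ω : A) (G : ℕ → A) (q : ℕ) : A :=
  let p := q / l / 2 * (2 * l) + q % l
  if q / l % 2 < 1 then G p + G (p + l) else ω ^ (q % l) * (G p - G (p + l))

/-- `unstage` in terms of rows. -/
def rowUnstage (l : ℕ) (ω : A) (G : ℕ → A) (q : ℕ) : A :=
  let p := q / (2 * l) * (2 * l) + q % (2 * l) % l
  if q % (2 * l) < l then G p + ω ^ (q % (2 * l) % l) * G (p + l)
  else G p - ω ^ (q % (2 * l) % l) * G (p + l)

/-- Because `y ^ r = -1`, multiplication by `y ^ c` moves the coefficients up by `c` places, and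
those that pass the end return at the bottom with a minus sign. No product of ring elements is
needed. -/
theorem sum_twist {r c : ℕ} (hc : c ≤ r) {y : A} (hy : y ^ r = -1) (g : ℕ → A) :
    ∑ j ∈ range r, (if j < c then -g (j + r - c) else g (j - c)) * y ^ j =
      y ^ c * ∑ j ∈ range r, g j * y ^ j := by
  obtain ⟨d, rfl⟩ := Nat.exists_eq_add_of_le hc
  rw [sum_range_add]
  conv_rhs => rw [Nat.add_comm c d, sum_range_add]
  have h1 : ∀ j ∈ range c, (if j < c then -g (j + (c + d) - c) else g (j - c)) * y ^ j =
      y ^ c * (g (d + j) * y ^ (d + j)) := by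
    intro j hj
    rw [if_pos (mem_range.1 hj), show j + (c + d) - c = d + j by omega]
    have : y ^ c * (g (d + j) * y ^ (d + j)) = g (d + j) * y ^ (c + d) * y ^ j := by ring
    rw [this, hy]
    ring
  have h2 : ∀ j ∈ range d, (if c + j < c then -g (c + j + (c + d) - c) else g (c + j - c)) *
      y ^ (c + j) = y ^ c * (g j * y ^ j) := by
    intro j _
    rw [if_neg (by omega), show c + j - c = j by omega]
    ring
  rw [sum_congr rfl h1, sum_congr rfl h2, ← mul_sum, ← mul_sum]
  ring

/-- Twisting the coefficients on the left gives back `g`, so `sum_twist` can be cancelled with `z`,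
the inverse of `y`. -/
theorem sum_untwist {r c : ℕ} (hc : c ≤ r) {y z : A} (hy : y ^ r = -1) (hz : y * z = 1)
    (g : ℕ → A) :
    ∑ j ∈ range r, (if j + c < r then g (j + c) else -g (j + c - r)) * y ^ j =
      z ^ c * ∑ j ∈ range r, g j * y ^ j := by
  have h := sum_twist hc hy (fun j => if j + c < r then g (j + c) else -g (j + c - r))
  have h1 : ∀ j ∈ range r,
      (if j < c then -(if j + r - c + c < r then g (j + r - c + c) else -g (j + r - c + c - r))
        else (if j - c + c < r then g (j - c + c) else -g (j - c + c - r))) * y ^ j =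
      g j * y ^ j := by
    intro j hj
    rw [mem_range] at hj
    split_ifs with h1 h2 h3
    · omega
    · rw [show j + r - c + c - r = j by omega, neg_neg]
    · rw [show j - c + c = j by omega]
    · omega
  rw [sum_congr rfl h1] at h
  rw [h, ← mul_assoc, ← mul_pow, mul_comm z, hz, one_pow, one_mul]

/-- The twiddle factor `y ^ (r / l)` is a power of the variable itself, and its `l`-th power is `y ^
r = -1`. Multiplying a row by its powers is the signed shift of `sum_twist`, so a butterfly only
adds and subtracts entries. -/
theorem row_stage {r l : ℕ} (hl : 0 < l) (hlr : l ∣ r) {y : A}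
    (hy : y ^ r = -1) (F : ℕ → A) (q : ℕ) :
    row r y (stage r l F) q = rowStage l (y ^ (r / l)) (row r y F) q := by
  rcases Nat.eq_zero_or_pos r with rfl | hr
  · simp [row, rowStage]
  have hd : ∀ j ∈ range r, (q * r + j) / r = q ∧ (q * r + j) % r = j := by
    intro j hj
    rw [mem_range] at hj
    constructor
    · rw [mul_comm, Nat.mul_add_div hr, Nat.div_eq_of_lt hj, add_zero]
    · rw [mul_comm, Nat.mul_add_mod, Nat.mod_eq_of_lt hj]
  have hc : q % l * (r / l) ≤ r := by
    calc q % l * (r / l) ≤ l * (r / l) := Nat.mul_le_mul_right _ (Nat.mod_lt _ hl).le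
      _ = r := Nat.mul_div_cancel' hlr
  simp only [rowStage, row, ← pow_mul]
  generalize hp : q / l / 2 * (2 * l) + q % l = p
  split_ifs with h
  · rw [← sum_add_distrib]
    refine sum_congr rfl fun j hj => ?_
    simp only [stage, hd j hj, h, if_true, hp]
    rw [add_mul p l r]
    ring
  · rw [mul_comm (r / l), ← sum_sub_distrib]
    have := sum_twist hc hy (fun j => F (p * r + j) - F (p * r + l * r + j))
    simp only [add_mul, ← sub_mul]
    rw [← this]
    refine sum_congr rfl fun j hj => ?_
    simp only [stage, hd j hj, h, if_false, hp, neg_sub]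

theorem row_unstage {r l : ℕ} (hl : 0 < l) (hlr : l ∣ r) {y z : A}
    (hy : y ^ r = -1) (hz : y * z = 1) (F : ℕ → A) (q : ℕ) :
    row r y (unstage r l F) q = rowUnstage l (z ^ (r / l)) (row r y F) q := by
  rcases Nat.eq_zero_or_pos r with rfl | hr
  · simp [row, rowUnstage]
  have hd : ∀ j ∈ range r, (q * r + j) / r = q ∧ (q * r + j) % r = j := by
    intro j hj
    rw [mem_range] at hj
    constructor
    · rw [mul_comm, Nat.mul_add_div hr, Nat.div_eq_of_lt hj, add_zero]
    · rw [mul_comm, Nat.mul_add_mod, Nat.mod_eq_of_lt hj]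
  have hc : q % (2 * l) % l * (r / l) ≤ r := by
    calc q % (2 * l) % l * (r / l) ≤ l * (r / l) := Nat.mul_le_mul_right _ (Nat.mod_lt _ hl).le
      _ = r := Nat.mul_div_cancel' hlr
  simp only [rowUnstage, row, ← pow_mul]
  generalize hp : q / (2 * l) * (2 * l) + q % (2 * l) % l = p
  have := sum_untwist hc hy hz (fun j => F (p * r + l * r + j))
  rw [mul_comm (r / l)]
  simp only [add_mul]
  rw [← this]
  split_ifs with h
  · rw [← sum_add_distrib]
    refine sum_congr rfl fun j hj => ?_
    simp only [unstage, hd j hj, h, if_true, hp]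
    split_ifs <;> ring
  · rw [← sum_sub_distrib]
    refine sum_congr rfl fun j hj => ?_
    simp only [unstage, hd j hj, h, if_false, hp]
    split_ifs <;> ring

/-- `fft` in terms of rows. -/
def rowFft (ω : ℕ → A) : ℕ → (ℕ → A) → ℕ → A
  | 0, G => G
  | d + 1, G => rowFft ω d (rowStage (2 ^ d) (ω d) G)

/-- `ifft` in terms of rows. -/
def rowIfft (ω : ℕ → A) : ℕ → (ℕ → A) → ℕ → A
  | 0, G => G
  | d + 1, G => rowUnstage (2 ^ d) (ω d) (rowIfft ω d G)

theorem row_fft {e : ℕ} {y : A} (hy : y ^ 2 ^ e = -1) (d : ℕ) (hd : d ≤ e + 1) (F : ℕ → A) :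
    row (2 ^ e) y (fft (2 ^ e) d F) =
      rowFft (fun d => y ^ (2 ^ e / 2 ^ d)) d (row (2 ^ e) y F) := by
  induction d generalizing F with
  | zero => rfl
  | succ d ih =>
    rw [fft, rowFft, ih (by omega)]
    congr 1
    funext q
    exact row_stage (by positivity) (pow_dvd_pow 2 (by omega)) hy F q

theorem row_ifft {e : ℕ} {y z : A} (hy : y ^ 2 ^ e = -1) (hz : y * z = 1) (d : ℕ)
    (hd : d ≤ e + 1) (F : ℕ → A) :
    row (2 ^ e) y (ifft (2 ^ e) d F) =
      rowIfft (fun d => z ^ (2 ^ e / 2 ^ d)) d (row (2 ^ e) y F) := by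
  induction d with
  | zero => rfl
  | succ d ih =>
    rw [ifft, rowIfft, ← ih (by omega)]
    funext q
    exact row_unstage (by positivity) (pow_dvd_pow 2 (by omega)) hy hz _ q

/-- The points at which `rowFft` evaluates. -/
def point (ω : ℕ → A) : ℕ → ℕ → A
  | 0, _ => 1
  | d + 1, b => if b < 2 ^ d then point ω d b else ω d * point ω d (b - 2 ^ d)

theorem point_pow {ω : ℕ → A} (d : ℕ) (hω : ∀ i < d, ω i ^ 2 ^ i = -1) (b : ℕ) :
    point ω d b ^ 2 ^ d = 1 := by
  induction d generalizing b with
  | zero => simp [point]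
  | succ d ih =>
    have ih := ih fun i hi => hω i (by omega)
    rw [point, pow_succ, pow_mul]
    split_ifs
    · rw [ih, one_pow]
    · rw [mul_pow, ih, hω d (by omega)]
      ring

theorem block_div {l : ℕ} (B i : ℕ) (hi : i < l) : (B * l + i) / l = B ∧ (B * l + i) % l = i := by
  have hl : 0 < l := by omega
  constructor
  · rw [mul_comm, Nat.mul_add_div hl, Nat.div_eq_of_lt hi, add_zero]
  · rw [mul_comm, Nat.mul_add_mod, Nat.mod_eq_of_lt hi]

theorem rowStage_even {l : ℕ} (ω : A) (G : ℕ → A) (B i : ℕ) (hi : i < l) :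
    rowStage l ω G (B * (2 * l) + i) = G (B * (2 * l) + i) + G (B * (2 * l) + i + l) := by
  have h : B * (2 * l) + i = (2 * B) * l + i := by ring
  obtain ⟨h1, h2⟩ := block_div (2 * B) i hi
  rw [← h] at h1 h2
  simp [rowStage, h1, h2]

theorem rowStage_odd {l : ℕ} (ω : A) (G : ℕ → A) (B i : ℕ) (hi : i < l) :
    rowStage l ω G (B * (2 * l) + i + l) =
      ω ^ i * (G (B * (2 * l) + i) - G (B * (2 * l) + i + l)) := by
  have h : B * (2 * l) + i + l = (2 * B + 1) * l + i := by ring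
  obtain ⟨h1, h2⟩ := block_div (2 * B + 1) i hi
  rw [← h] at h1 h2
  simp [rowStage, h1, h2, show (2 * B + 1) / 2 = B by omega]

/-- Decimation in frequency. With `l = 2 ^ d`, a point `u` of the lower half has `u ^ l = 1`, so
that the entries at distance `l` are added. A point `ω d * u` of the upper half has `l`-th power
`-1`, so that they are subtracted, and the factor `ω d ^ i` is left over. The points come in
bit-reversed order. -/
theorem rowFft_eq_eval {ω : ℕ → A} (d : ℕ) (hω : ∀ i < d, ω i ^ 2 ^ i = -1) (G : ℕ → A)
    (B b : ℕ) (hb : b < 2 ^ d) :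
    rowFft ω d G (B * 2 ^ d + b) = ∑ i ∈ range (2 ^ d), G (B * 2 ^ d + i) * point ω d b ^ i := by
  induction d generalizing G B b with
  | zero =>
    obtain rfl : b = 0 := by simpa using hb
    simp [rowFft]
  | succ d ih =>
    have hω' : ∀ i < d, ω i ^ 2 ^ i = -1 := fun i hi => hω i (by omega)
    have hp : 2 ^ (d + 1) = 2 * 2 ^ d := pow_succ' 2 d
    rw [rowFft, point, hp, two_mul (2 ^ d), sum_range_add, ← two_mul]
    rw [hp] at hb
    split_ifs with h
    · rw [show B * (2 * 2 ^ d) + b = (2 * B) * 2 ^ d + b by ring, ih hω' _ _ _ h,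
        ← sum_add_distrib]
      refine sum_congr rfl fun i hi => ?_
      rw [show 2 * B * 2 ^ d + i = B * (2 * 2 ^ d) + i by ring,
        rowStage_even _ _ _ _ (mem_range.1 hi), pow_add, point_pow d hω']
      rw [show B * (2 * 2 ^ d) + (2 ^ d + i) = B * (2 * 2 ^ d) + i + 2 ^ d by ring]
      ring
    · rw [show B * (2 * 2 ^ d) + b = (2 * B + 1) * 2 ^ d + (b - 2 ^ d) by
          rw [add_mul, one_mul, add_assoc]
          congr 1
          · ring
          · omega,
        ih hω' _ _ _ (by omega), ← sum_add_distrib]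
      refine sum_congr rfl fun i hi => ?_
      rw [show (2 * B + 1) * 2 ^ d + i = B * (2 * 2 ^ d) + i + 2 ^ d by ring,
        rowStage_odd _ _ _ _ (mem_range.1 hi), pow_add (ω d * _), mul_pow (ω d) _ (2 ^ d),
        point_pow d hω', hω d (by omega)]
      rw [show B * (2 * 2 ^ d) + (2 ^ d + i) = B * (2 * 2 ^ d) + i + 2 ^ d by ring]
      ring

/-- No orthogonality of characters is involved: the stages are undone one at a time in reverse
order, and each undoing leaves a factor `2`. -/
theorem rowIfft_eq {ω ω' : ℕ → A} (d : ℕ) (hω : ∀ i < d, ω i * ω' i = 1) (G C : ℕ → A) (B : ℕ)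
    (hG : ∀ b < 2 ^ d, G (B * 2 ^ d + b) = rowFft ω d C (B * 2 ^ d + b)) :
    ∀ b < 2 ^ d, rowIfft ω' d G (B * 2 ^ d + b) = 2 ^ d * C (B * 2 ^ d + b) := by
  induction d generalizing C B with
  | zero => simpa [rowIfft, rowFft] using hG
  | succ d ih =>
    have hp : 2 ^ (d + 1) = 2 * 2 ^ d := pow_succ' 2 d
    have hω' : ∀ i < d, ω i * ω' i = 1 := fun i hi => hω i (by omega)
    rw [hp] at hG
    have h0 := ih hω' (rowStage (2 ^ d) (ω d) C) (2 * B) fun b hb => by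
      have := hG b (by omega)
      rwa [show B * (2 * 2 ^ d) = 2 * B * 2 ^ d by ring] at this
    have h1 := ih hω' (rowStage (2 ^ d) (ω d) C) (2 * B + 1) fun b hb => by
      have := hG (2 ^ d + b) (by omega)
      rwa [show B * (2 * 2 ^ d) + (2 ^ d + b) = (2 * B + 1) * 2 ^ d + b by ring] at this
    intro b hb
    rw [hp] at hb ⊢
    obtain ⟨e1, e2⟩ := block_div B b hb
    have key : ∀ i < 2 ^ d, rowIfft ω' d G (B * (2 * 2 ^ d) + i) =
        2 ^ d * (C (B * (2 * 2 ^ d) + i) + C (B * (2 * 2 ^ d) + i + 2 ^ d)) ∧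
        ω' d ^ i * rowIfft ω' d G (B * (2 * 2 ^ d) + i + 2 ^ d) =
        2 ^ d * (C (B * (2 * 2 ^ d) + i) - C (B * (2 * 2 ^ d) + i + 2 ^ d)) := by
      intro i hi
      constructor
      · rw [← rowStage_even (ω d) _ _ _ hi, show B * (2 * 2 ^ d) + i = 2 * B * 2 ^ d + i by ring]
        exact h0 i hi
      · rw [show B * (2 * 2 ^ d) + i + 2 ^ d = (2 * B + 1) * 2 ^ d + i by ring, h1 i hi,
          show (2 * B + 1) * 2 ^ d + i = B * (2 * 2 ^ d) + i + 2 ^ d by ring,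
          rowStage_odd _ _ _ _ hi, ← mul_assoc, mul_comm (ω' d ^ i), mul_assoc,
          ← mul_assoc (ω' d ^ i), ← mul_pow, mul_comm (ω' d), hω d (by omega), one_pow, one_mul]
    simp only [rowIfft, rowUnstage, e1, e2]
    split_ifs with h
    · rw [Nat.mod_eq_of_lt h, (key b h).1, (key b h).2]
      ring
    · have hb' : b % 2 ^ d = b - 2 ^ d := by
        rw [Nat.mod_eq_sub_mod (by omega), Nat.mod_eq_of_lt (by omega)]
      rw [hb', (key _ (by omega)).1, (key _ (by omega)).2,
        show B * (2 * 2 ^ d) + (b - 2 ^ d) + 2 ^ d = B * (2 * 2 ^ d) + b by omega]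
      ring

theorem row_pad {s r : ℕ} (y : A) (F : ℕ → A) (B i : ℕ) (hi : i < 2 * s) :
    row r y (pad s r F) (B * (2 * s) + i) =
      if i < s then ∑ j ∈ range r, F (B * (s * r) + (i + s * j)) * y ^ j else 0 := by
  obtain ⟨e1, e2⟩ := block_div B i hi
  have hd : ∀ j ∈ range r, pad s r F ((B * (2 * s) + i) * r + j) =
      if i < s then F (B * (s * r) + (i + s * j)) else 0 := by
    intro j hj
    obtain ⟨h1, h2⟩ := block_div (B * (2 * s) + i) j (mem_range.1 hj)
    simp only [pad, h1, h2, e1, e2]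
  rw [row, sum_congr rfl fun j hj => by rw [hd j hj]]
  split_ifs <;> simp

theorem sum_range_mul_eq (s r : ℕ) (f : ℕ → A) :
    ∑ k ∈ range (s * r), f k = ∑ i ∈ range s, ∑ j ∈ range r, f (i + s * j) := by
  rw [sum_comm]
  induction r with
  | zero => simp
  | succ r ih =>
    rw [mul_add, mul_one, sum_range_add, ih, sum_range_succ]
    congr 1
    exact sum_congr rfl fun i _ => by rw [add_comm]

/-- The power `x ^ (s + i)` equals `x ^ i` times `x ^ s`. So the block with index `s + i` joins the
block with index `i` after multiplication by `x ^ s`, the variable of the short blocks, which is a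
twist by one place. -/
theorem row_unpad {s r : ℕ} (hr : 0 < r) (x : A) (hx : (x ^ s) ^ r = -1) (F : ℕ → A) (B : ℕ) :
    row (s * r) x (unpad s r F) B =
      ∑ i ∈ range (2 * s), row r (x ^ s) F (B * (2 * s) + i) * x ^ i := by
  rw [row, sum_range_mul_eq, two_mul, sum_range_add, ← sum_add_distrib, ← two_mul]
  refine sum_congr rfl fun i hi => ?_
  rw [mem_range] at hi
  have hs : 0 < s := by omega
  have ht := sum_twist (c := 1) hr hx (fun j => F ((B * (2 * s) + (s + i)) * r + j))
  rw [pow_one] at ht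
  rw [pow_add, ← mul_assoc (row _ _ _ _), row, row, mul_comm _ (x ^ s), ← ht, ← add_mul, ← sum_add_distrib,
    sum_mul]
  refine sum_congr rfl fun j hj => ?_
  rw [mem_range] at hj
  have hlt : i + s * j < s * r := by
    calc i + s * j < s * (j + 1) := by rw [mul_add]; omega
      _ ≤ s * r := Nat.mul_le_mul_left _ hj
  obtain ⟨h1, h2⟩ := block_div B (i + s * j) hlt
  have h3 : (i + s * j) % s = i := by rw [Nat.add_mul_mod_self_left, Nat.mod_eq_of_lt hi]
  have h4 : (i + s * j) / s = j := by rw [Nat.add_mul_div_left _ _ hs, Nat.div_eq_of_lt hi, zero_add]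
  simp only [unpad, h1, h2, h3, h4]
  rw [pow_add, pow_mul, show (B * (2 * s) + (s + i)) * r = (B * (2 * s) + i) * r + s * r by ring]
  split_ifs with h
  · obtain rfl : j = 0 := by omega
    rw [show 0 + r - 1 = r - 1 by omega]
    ring
  · ring

/-- The algorithm computes a multiple of the product of the `b`-th and the `(N + b)`-th block. -/
theorem row_backward (a : ℕ) : ∀ (y : A), y ^ 2 ^ (a + 1) = -1 → ∀ (F : ℕ → A) (N b : ℕ), b < N →
    row (2 ^ (a + 1)) y
      (backward a (base (N * 2 ^ (a + 1) * 2 ^ levels a) (forward a F))) b =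
    2 ^ scale a * (row (2 ^ (a + 1)) y F b * row (2 ^ (a + 1)) y F (N + b)) := by
  -- The ring stays fixed, but the point, the data and the number of pairs must vary: the recursive
  -- call works at the point `y ^ 2 ^ f` with `2 ^ (f + 1)` times as many pairs of blocks.
  induction a using Nat.strong_induction_on with
  | _ a ih =>
    intro y hy F N b hb
    by_cases ha : a = 0
    · subst ha
      have hy2 : y ^ 2 = -1 := by simpa using hy
      rw [backward, forward, levels, scale]
      simp only [if_true, row, zero_add, pow_one, sum_range_succ, sum_range_zero, base]
      have e1 : b * 2 % 2 = 0 := by omega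
      have e2 : (b * 2 + 1) % 2 = 1 := by omega
      have e3 : b * 2 / 2 * 2 = b * 2 := by omega
      have e4 : (b * 2 + 1) / 2 * 2 = b * 2 := by omega
      simp only [e1, e2, e3, e4, zero_lt_one, if_true, lt_irrefl, if_false, pow_zero, mul_one,
        add_zero, add_mul N b 2]
      linear_combination (-(F (b * 2 + 1) * F (N * 2 + b * 2 + 1))) * hy2
    · have hlt : a / 2 < a := Nat.div_lt_self (by omega) (by omega)
      rw [backward, forward, levels, scale, if_neg ha, if_neg ha, if_neg ha, if_neg ha]
      set e := a / 2 + 1 with he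
      set f := a - a / 2 with hf
      have hsr : 2 ^ (a + 1) = 2 ^ f * 2 ^ e := by
        rw [← pow_add]
        congr 1
        omega
      have h2s : 2 ^ (f + 1) = 2 * 2 ^ f := pow_succ' 2 f
      set x := y ^ 2 ^ f with hxdef
      have hx : x ^ 2 ^ e = -1 := by rw [hxdef, ← pow_mul, ← hsr, hy]
      obtain ⟨z, hz⟩ : ∃ z, x * z = 1 := by
        refine ⟨-x ^ (2 ^ e - 1), ?_⟩
        rw [mul_neg, ← pow_succ', Nat.sub_add_cancel Nat.one_le_two_pow, hx, neg_neg]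
      set ω : ℕ → A := fun d => x ^ (2 ^ e / 2 ^ d)
      set ω' : ℕ → A := fun d => z ^ (2 ^ e / 2 ^ d)
      have hω : ∀ i < f + 1, ω i ^ 2 ^ i = -1 := by
        intro i hi
        rw [← pow_mul, Nat.div_mul_cancel (pow_dvd_pow 2 (by omega)), hx]
      have hωω' : ∀ i < f + 1, ω i * ω' i = 1 := fun i _ => by
        simp only [ω, ω', ← mul_pow, hz, one_pow]
      have hN : N * 2 ^ (a + 1) * 2 ^ (levels (a / 2) + 1) =
          (N * 2 ^ (f + 1)) * 2 ^ e * 2 ^ levels (a / 2) := by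
        rw [hsr]
        ring
      rw [hN]
      set F' := fft (2 ^ e) (f + 1) (pad (2 ^ f) (2 ^ e) F) with hF'
      set G := backward (a / 2) (base (N * 2 ^ (f + 1) * 2 ^ e * 2 ^ levels (a / 2))
        (forward (a / 2) F'))
      have hIH := ih (a / 2) hlt x hx F' (N * 2 ^ (f + 1))
      -- the polynomials in `y` given by the blocks
      let p : ℕ → Polynomial A := fun B => ∑ i ∈ range (2 ^ f),
        Polynomial.C (∑ j ∈ range (2 ^ e), F (B * (2 ^ f * 2 ^ e) + (i + 2 ^ f * j)) * x ^ j) *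
          Polynomial.X ^ i
      have hp : ∀ B, (p B).eval y = row (2 ^ (a + 1)) y F B := by
        intro B
        rw [row, hsr, sum_range_mul_eq, Polynomial.eval_finsetSum]
        refine sum_congr rfl fun i _ => ?_
        rw [Polynomial.eval_mul, Polynomial.eval_C, Polynomial.eval_pow, Polynomial.eval_X, sum_mul]
        refine sum_congr rfl fun j _ => ?_
        rw [hxdef, ← pow_mul, mul_assoc, ← pow_add y, add_comm i]
      have hrow : ∀ B c, c < 2 ^ (f + 1) →
          row (2 ^ e) x F' (B * 2 ^ (f + 1) + c) = (p B).eval (point ω (f + 1) c) := by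
        intro B c hc
        rw [hF', row_fft hx _ (by omega), rowFft_eq_eval _ hω _ _ _ hc, Polynomial.eval_finsetSum,
          h2s, two_mul, sum_range_add, ← two_mul]
        rw [sum_congr rfl fun i hi => by
            rw [row_pad _ _ _ _ (by have := mem_range.1 hi; omega), if_pos (mem_range.1 hi)],
          sum_congr (s₁ := range (2 ^ f)) (f := fun i => row _ _ _ _ * _) rfl fun i hi => by
            rw [row_pad _ _ _ _ (by have := mem_range.1 hi; omega), if_neg (by omega), zero_mul],
          sum_const_zero, add_zero]
        exact sum_congr rfl fun i _ => by
          rw [Polynomial.eval_mul, Polynomial.eval_C, Polynomial.eval_pow, Polynomial.eval_X]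
      have hdeg : ∀ B, (p B).degree < (2 ^ f : ℕ) := by
        intro B
        refine (Polynomial.degree_sum_le _ _).trans_lt ?_
        rw [Finset.sup_lt_iff (WithBot.bot_lt_coe _)]
        intro i hi
        exact (Polynomial.degree_C_mul_X_pow_le _ _).trans_lt
          (by exact_mod_cast mem_range.1 hi)
      -- Padding to twice the length is what makes the product fit: a transform of length `2 ^ (f +
      -- 1)` determines all its coefficients without wraparound.
      have hdeg2 : (p b * p (N + b)).natDegree < 2 ^ (f + 1) := by
        have hpos : 0 < 2 ^ f := by positivity
        have h1 : ∀ B, (p B).natDegree < 2 ^ f := fun B => by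
          by_cases h0 : p B = 0
          · rw [h0]; exact hpos
          · exact (Polynomial.natDegree_lt_iff_degree_lt h0).2 (hdeg B)
        have := Polynomial.natDegree_mul_le (p := p b) (q := p (N + b))
        have := h1 b
        have := h1 (N + b)
        omega
      have heval : ∀ u : A, ∑ i ∈ range (2 ^ (f + 1)), (p b * p (N + b)).coeff i * u ^ i =
          (p b).eval u * (p (N + b)).eval u := fun u => by
        rw [← Polynomial.eval_mul, Polynomial.eval_eq_sum_range' hdeg2]
      -- By the induction hypothesis the blocks returned by the recursive call are the transform of
      -- these scaled coefficients of the product; the inverse transform then adds the factor `2 ^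
      -- (f + 1)`.
      set C : ℕ → A := fun q => 2 ^ scale (a / 2) * (p b * p (N + b)).coeff (q - b * 2 ^ (f + 1))
        with hC
      have hG : ∀ c < 2 ^ (f + 1), row (2 ^ e) x G (b * 2 ^ (f + 1) + c) =
          rowFft ω (f + 1) C (b * 2 ^ (f + 1) + c) := by
        intro c hc
        rw [hIH _ (by nlinarith), ← add_assoc, ← add_mul, hrow _ _ hc, hrow _ _ hc,
          rowFft_eq_eval _ hω _ _ _ hc, ← heval, mul_sum]
        refine sum_congr rfl fun i _ => ?_
        rw [hC]
        simp only [Nat.add_sub_cancel_left]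
        ring
      have hI := rowIfft_eq (ω' := ω') (f + 1) hωω' _ C b hG
      rw [hsr, row_unpad (by positivity) y (by rw [← hxdef, hx]), ← h2s, ← hxdef, ← hsr,
        ← hp, ← hp, ← heval, mul_sum]
      refine sum_congr rfl fun i hi => ?_
      rw [row_ifft hx hz _ (by omega), hI i (mem_range.1 hi), hC]
      simp only [Nat.add_sub_cancel_left]
      ring

/-! #### Recovering the coefficients -/

/-- The ring of polynomials modulo `y ^ n + 1` with coefficients modulo `2 ^ w`. -/
abbrev NegRing (w n : ℕ) : Type := AdjoinRoot (Polynomial.X ^ n + 1 : Polynomial (ZMod (2 ^ w)))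

theorem NegRing.natCast_pow (w n : ℕ) : ((2 ^ w : ℕ) : NegRing w n) = 0 := by
  rw [← map_natCast (AdjoinRoot.of _), ZMod.natCast_self, map_zero]

theorem NegRing.root_pow (w n : ℕ) :
    (AdjoinRoot.root _ : NegRing w n) ^ n = -1 := by
  have h := AdjoinRoot.mk_self (f := (Polynomial.X ^ n + 1 : Polynomial (ZMod (2 ^ w))))
  rw [map_add, map_pow, AdjoinRoot.mk_X, map_one] at h
  exact eq_neg_of_add_eq_zero_left h

theorem row_zero_eq_mk (w n : ℕ) (f : ℕ → ℕ) :
    row n (AdjoinRoot.root _ : NegRing w n) (fun j => (f j : NegRing w n)) 0 =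
      AdjoinRoot.mk _ (∑ j ∈ range n, Polynomial.C (f j : ZMod (2 ^ w)) * Polynomial.X ^ j) := by
  rw [row, map_sum]
  refine sum_congr rfl fun j _ => ?_
  rw [map_mul, map_pow, AdjoinRoot.mk_X, AdjoinRoot.mk_C, map_natCast, zero_mul, zero_add]

theorem degree_sum_lt {R : Type*} [CommRing R] (n : ℕ) (f : ℕ → R) :
    (∑ j ∈ range n, Polynomial.C (f j) * Polynomial.X ^ j).degree < (n : WithBot ℕ) := by
  refine (Polynomial.degree_sum_le _ _).trans_lt ?_
  rw [Finset.sup_lt_iff (WithBot.bot_lt_coe _)]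
  intro i hi
  exact (Polynomial.degree_C_mul_X_pow_le _ _).trans_lt (by exact_mod_cast mem_range.1 hi)

theorem coeff_sum_range {R : Type*} [CommRing R] (n : ℕ) (f : ℕ → R) (k : ℕ) :
    (∑ j ∈ range n, Polynomial.C (f j) * Polynomial.X ^ j).coeff k = if k < n then f k else 0 := by
  rw [Polynomial.finsetSum_coeff]
  simp only [Polynomial.coeff_C_mul_X_pow]
  rw [sum_ite_eq]
  simp

/-- The difference of the two polynomials has degree less than `n` and is divisible by the monic `X
^ n + 1`, so it vanishes modulo `2 ^ w`. The condition `w ≠ 0` makes the coefficient ring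
nontrivial. -/
theorem modEq_of_row_eq {w n : ℕ} (hw : w ≠ 0) (hn : 0 < n) {f g : ℕ → ℕ}
    (h : row n (AdjoinRoot.root _ : NegRing w n) (fun j => (f j : NegRing w n)) 0 =
      row n (AdjoinRoot.root _ : NegRing w n) (fun j => (g j : NegRing w n)) 0) :
    ∀ j < n, f j ≡ g j [MOD 2 ^ w] := by
  have : Fact (1 < 2 ^ w) := ⟨Nat.one_lt_two_pow hw⟩
  rw [row_zero_eq_mk, row_zero_eq_mk, AdjoinRoot.mk_eq_mk] at h
  have hdeg : (Polynomial.X ^ n + 1 : Polynomial (ZMod (2 ^ w))).degree = n := by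
    simpa using Polynomial.degree_X_pow_add_C (R := ZMod (2 ^ w)) hn 1
  have hmonic : (Polynomial.X ^ n + 1 : Polynomial (ZMod (2 ^ w))).Monic := by
    simpa using Polynomial.monic_X_pow_add_C (R := ZMod (2 ^ w)) 1 hn.ne'
  have h0 := not_ne_iff.1 fun h0 => hmonic.not_dvd_of_degree_lt h0 (by
    rw [hdeg]
    exact (Polynomial.degree_sub_le _ _).trans_lt
      (max_lt (degree_sum_lt _ _) (degree_sum_lt _ _))) h
  intro j hj
  have := congrArg (fun p => Polynomial.coeff p j) (sub_eq_zero.1 h0)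
  simp only [coeff_sum_range, hj, if_true] at this
  exact (ZMod.natCast_eq_natCast_iff _ _ _).1 this

/-- Both factors vanish on the upper half of the indices, so their product has degree less than `n`
and the relation `y ^ n = -1` is not needed: the negacyclic product is the ordinary one. -/
theorem row_mul_row {n : ℕ} (y : A) (F G : ℕ → A) (hF : ∀ j < n, n ≤ 2 * j → F j = 0)
    (hG : ∀ j < n, n ≤ 2 * j → G j = 0) :
    row n y F 0 * row n y G 0 =
      row n y (fun j => ∑ x ∈ antidiagonal j, F x.1 * G x.2) 0 := by
  have hrow : ∀ H : ℕ → A, row n y H 0 =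
      (∑ j ∈ range n, Polynomial.C (H j) * Polynomial.X ^ j).eval y := by
    intro H
    rw [row, Polynomial.eval_finsetSum]
    exact sum_congr rfl fun j _ => by simp
  have hz : ∀ H : ℕ → A, (∀ j < n, n ≤ 2 * j → H j = 0) → ∀ j, n ≤ 2 * j →
      (∑ j ∈ range n, Polynomial.C (H j) * Polynomial.X ^ j).coeff j = 0 := by
    intro H hH j hj
    rw [coeff_sum_range]
    split_ifs with h
    · exact hH j h hj
    · rfl
  rw [hrow, hrow, hrow, ← Polynomial.eval_mul]
  congr 1
  ext k
  rw [Polynomial.coeff_mul, coeff_sum_range]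
  split_ifs with hk
  · refine sum_congr rfl fun x hx => ?_
    rw [HasAntidiagonal.mem_antidiagonal] at hx
    rw [coeff_sum_range, coeff_sum_range, if_pos (by omega), if_pos (by omega)]
  · refine sum_eq_zero fun x hx => ?_
    rw [HasAntidiagonal.mem_antidiagonal] at hx
    rcases le_or_gt n (2 * x.1) with h | h
    · rw [hz F hF _ h, zero_mul]
    · rw [hz G hG x.2 (by omega), mul_zero]

/-- If the ring elements given by the words `h j` are the result of the algorithm on the words `f j`,
then, in the absence of overflow, the `h j` are the scaled coefficients of the product. -/
theorem eq_of_backward {w a : ℕ} {f h : ℕ → ℕ} (hh : ∀ j < 2 ^ (a + 1), h j < 2 ^ w)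
    (hf : ∀ j < 2 ^ a, f (2 ^ a + j) = 0 ∧ f (2 ^ (a + 1) + 2 ^ a + j) = 0)
    (hfit : ∀ j < 2 ^ (a + 1),
      2 ^ scale a * ∑ x ∈ antidiagonal j, f x.1 * f (2 ^ (a + 1) + x.2) < 2 ^ w)
    (hw : w ≠ 0)
    (hres : ∀ j < 2 ^ (a + 1), (h j : NegRing w (2 ^ (a + 1))) =
      backward a (base (2 ^ (a + 1) * 2 ^ levels a)
        (forward a fun k => (f k : NegRing w (2 ^ (a + 1))))) j) :
    ∀ j < 2 ^ (a + 1),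
      h j = 2 ^ scale a * ∑ x ∈ antidiagonal j, f x.1 * f (2 ^ (a + 1) + x.2) := by
  have h2 : 2 ^ (a + 1) = 2 ^ a + 2 ^ a := by ring
  have hmain := row_backward a _ (NegRing.root_pow w (2 ^ (a + 1)))
    (fun k => (f k : NegRing w (2 ^ (a + 1)))) 1 0 one_pos
  rw [one_mul] at hmain
  have hr1 : row (2 ^ (a + 1)) (AdjoinRoot.root _ : NegRing w (2 ^ (a + 1)))
      (fun k => (f k : NegRing w (2 ^ (a + 1)))) (1 + 0) =
      row (2 ^ (a + 1)) (AdjoinRoot.root _ : NegRing w (2 ^ (a + 1)))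
      (fun k => (f (2 ^ (a + 1) + k) : NegRing w (2 ^ (a + 1)))) 0 := by
    simp [row]
  rw [hr1, row_mul_row] at hmain
  · have key := modEq_of_row_eq (w := w) (n := 2 ^ (a + 1)) (f := h)
      (g := fun j => 2 ^ scale a * ∑ x ∈ antidiagonal j, f x.1 * f (2 ^ (a + 1) + x.2)) hw
      (by positivity) (by
        rw [row, sum_congr rfl fun j hj => by
          rw [show 0 * 2 ^ (a + 1) + j = j by ring, hres j (mem_range.1 hj)]]
        rw [row] at hmain
        simp only [zero_mul, zero_add] at hmain ⊢
        rw [hmain, row, row, mul_sum]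
        refine sum_congr rfl fun j _ => ?_
        push_cast
        simp only [zero_mul, zero_add]
        ring)
    intro j hj
    have := key j hj
    rwa [Nat.ModEq, Nat.mod_eq_of_lt (hh j hj), Nat.mod_eq_of_lt (hfit j hj)] at this
  · intro j hj hj'
    have := (hf (j - 2 ^ a) (by omega)).1
    rw [show 2 ^ a + (j - 2 ^ a) = j by omega] at this
    rw [this, Nat.cast_zero]
  · intro j hj hj'
    have := (hf (j - 2 ^ a) (by omega)).2
    rw [show 2 ^ (a + 1) + 2 ^ a + (j - 2 ^ a) = 2 ^ (a + 1) + j by omega] at this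
    rw [this, Nat.cast_zero]

/-- Every level doubles the amount of data by padding. As the exponent is halved each time, the
total growth is only linear in the exponent, that is, logarithmic in the length of the convolution.
-/
theorem two_pow_levels_le (a : ℕ) : 2 ^ levels a ≤ 2 * a + 1 := by
  have key : ∀ a, a ≠ 0 → 2 ^ levels a ≤ 2 * a := by
    intro a
    induction a using Nat.strong_induction_on with
    | _ a ih =>
      intro ha
      rw [levels, if_neg ha, pow_succ]
      by_cases h1 : a / 2 = 0
      · rw [h1, levels, if_pos rfl]
        omega
      · have := ih (a / 2) (by omega) h1
        omega
  by_cases ha : a = 0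
  · rw [ha, levels, if_pos rfl]
    simp
  · have := key a ha
    omega

/-- The power of two left in the result is thus only about the length times its logarithm, and the
scaled coefficients still fit into words of logarithmic size. -/
theorem scale_eq (a : ℕ) : scale a = a + levels a := by
  induction a using Nat.strong_induction_on with
  | _ a ih =>
    rw [levels, scale]
    split_ifs with ha
    · omega
    · rw [ih (a / 2) (by omega)]
      omega

end Nussbaumer

/-! ### The convolution program -/

namespace WordRAM

section Words

variable {A : Type*} [CommRing A]

/-- The word `v` represents the element `x` of a ring in which `2 ^ w = 0`. -/
def Word (w v : ℕ) (x : A) : Prop := v < 2 ^ w ∧ (v : A) = x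

variable {w v v' : ℕ} {x x' : A}

theorem Word.zero : Word w 0 (0 : A) := ⟨by positivity, Nat.cast_zero⟩

theorem cast_mod_two_pow (hA : ((2 ^ w : ℕ) : A) = 0) (v : ℕ) : ((v % 2 ^ w : ℕ) : A) = v := by
  conv_rhs => rw [← Nat.mod_add_div v (2 ^ w)]
  rw [Nat.cast_add, Nat.cast_mul, hA, zero_mul, add_zero]

theorem Word.add (hA : ((2 ^ w : ℕ) : A) = 0) (h : Word w v x) (h' : Word w v' x') :
    Word w (BinOp.add.eval w v v') (x + x') :=
  ⟨Nat.mod_lt _ (by positivity), by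
    rw [BinOp.eval, cast_mod_two_pow hA, Nat.cast_add, h.2, h'.2]⟩

theorem Word.sub (hA : ((2 ^ w : ℕ) : A) = 0) (h : Word w v x) (h' : Word w v' x') :
    Word w (BinOp.sub.eval w v v') (x - x') :=
  ⟨Nat.mod_lt _ (by positivity), by
    rw [BinOp.eval, cast_mod_two_pow hA, Nat.cast_add, Nat.cast_sub h'.1.le, hA, h.2, h'.2,
      zero_sub, sub_eq_add_neg]⟩

theorem Word.mul (hA : ((2 ^ w : ℕ) : A) = 0) (h : Word w v x) (h' : Word w v' x') :
    Word w (BinOp.mul.eval w v v') (x * x') :=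
  ⟨Nat.mod_lt _ (by positivity), by
    rw [BinOp.eval, cast_mod_two_pow hA, Nat.cast_mul, h.2, h'.2]⟩

/-- The `N` words at address `b` represent the first `N` values of `F`. -/
def Holds (w : ℕ) (F : ℕ → A) (m : ℕ → ℕ) (b N : ℕ) : Prop := ∀ k < N, Word w (m (b + k)) (F k)

end Words

/-- The loop `fill`, when only a property of the values of the expression is known. -/
theorem Exec.fill_of {w : ℕ} {σ : Store} {x d n : ℕ} {e : Expr} {Q : Store → Prop} {T : ℕ}
    (P : ℕ → ℕ → Prop) (hxd : d ≠ x) (hxn : n ≠ x) (hlt : σ.var d + σ.var n < 2 ^ w)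
    (hf : ∀ k < σ.var n, ∀ m : ℕ → ℕ,
      (∀ a, a < σ.var d ∨ σ.var d + σ.var n ≤ a → m a = σ.mem a) →
      e.Safe w ⟨Function.update σ.var x k, m⟩ ∧ P k (e.val w ⟨Function.update σ.var x k, m⟩))
    (hT : (σ.var n + 1) * (e.cost + 12) + 2 ≤ T)
    (hQ : ∀ m : ℕ → ℕ, (∀ a, a < σ.var d ∨ σ.var d + σ.var n ≤ a → m a = σ.mem a) →
      (∀ k < σ.var n, P k (m (σ.var d + k))) → Q ⟨Function.update σ.var x (σ.var n), m⟩) :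
    Exec w (Stmt.fill x d n e) σ T Q := by
  -- the values written, by recursion over the already written ones
  have hex : ∀ N, ∃ f : ℕ → ℕ, ∀ k < N,
      f k = e.val w ⟨Function.update σ.var x k, fillMem σ.mem (σ.var d) k f⟩ := by
    intro N
    induction N with
    | zero => exact ⟨fun _ => 0, fun k hk => absurd hk (Nat.not_lt_zero _)⟩
    | succ N ih =>
      obtain ⟨f, hf⟩ := ih
      have hcongr : ∀ g : ℕ → ℕ, (∀ k < N, g k = f k) → ∀ k ≤ N,
          fillMem σ.mem (σ.var d) k g = fillMem σ.mem (σ.var d) k f := by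
        intro g hg k hk
        funext a
        simp only [fillMem]
        split_ifs with h
        · exact hg _ (by omega)
        · rfl
      refine ⟨Function.update f N
        (e.val w ⟨Function.update σ.var x N, fillMem σ.mem (σ.var d) N f⟩), fun k hk => ?_⟩
      rw [hcongr _ (fun k hk => Function.update_of_ne hk.ne _ _) k (by omega)]
      by_cases h : k = N
      · subst h
        rw [Function.update_self]
      · rw [Function.update_of_ne h]
        exact hf k (by omega)
  obtain ⟨f, hfval⟩ := hex (σ.var n)
  have hout : ∀ k ≤ σ.var n, ∀ a, a < σ.var d ∨ σ.var d + σ.var n ≤ a →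
      fillMem σ.mem (σ.var d) k f a = σ.mem a := by
    intro k hk a ha
    rcases ha with ha | ha
    · exact fillMem_of_lt ha
    · exact fillMem_of_ge (by omega)
  refine Exec.fill f hxd hxn hlt (fun k hk => ⟨(hf k hk _ (hout k hk.le)).1, (hfval k hk).symm⟩) hT
    (hQ _ (hout _ le_rfl) fun k hk => ?_)
  rw [fillMem_add hk, hfval k hk]
  exact (hf k hk _ (hout k hk.le)).2

end WordRAM

namespace Nussbaumer

set_option linter.unusedSimpArgs false

open WordRAM

/-- Loop counter. -/
notation "vI" => 2
/-- Address of the current array. -/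
notation "vSrc" => 3
/-- Address of the spare array. -/
notation "vDst" => 4
/-- Number of entries of the current array. -/
notation "vTot" => 5
/-- Length of the blocks after the transform. -/
notation "vR" => 6
/-- Half-length of a butterfly stage. -/
notation "vL" => 7
/-- Number of blocks into which a block is divided. -/
notation "vS" => 8
/-- Number of levels. -/
notation "vLev" => 9
/-- Exponent of the outermost block length, minus one. -/
notation "vA" => 10
/-- Exponent of the current block length, minus one. -/
notation "vB" => 11
/-- Temporary variable for swaps. -/
notation "vAux" => 12

/-- An entry of the current array. -/
def entry (e : Expr) : Expr := .load (.var vSrc + e)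

/-- Fill the spare array, and exchange it with the current array. -/
def mapArray (e : Expr) : Stmt :=
  Stmt.fill vI vDst vTot e ;; vAux ≔ .var vSrc ;; vSrc ≔ .var vDst ;; vDst ≔ .var vAux

def padExpr : Expr :=
  let k := Expr.var vI
  let r := Expr.var vR
  let s := Expr.var vS
  .iteLt (k / r % (2 * s)) s
    (entry (k / r / (2 * s) * (s * r) + (k / r % (2 * s) + s * (k % r)))) 0

def stageExpr : Expr :=
  let k := Expr.var vI
  let r := Expr.var vR
  let l := Expr.var vL
  let u := (k / r / l / 2 * (2 * l) + k / r % l) * r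
  let c := k / r % l * (r / l)
  .iteLt (k / r / l % 2) 1 (.wrap .add (entry (u + k % r)) (entry (u + l * r + k % r)))
    (.iteLt (k % r) c
      (.wrap .sub (entry (u + l * r + (k % r + r - c))) (entry (u + (k % r + r - c))))
      (.wrap .sub (entry (u + (k % r - c))) (entry (u + l * r + (k % r - c)))))

def unstageExpr : Expr :=
  let k := Expr.var vI
  let r := Expr.var vR
  let l := Expr.var vL
  let u := (k / r / (2 * l) * (2 * l) + k / r % (2 * l) % l) * r
  let c := k / r % (2 * l) % l * (r / l)
  .iteLt (k / r % (2 * l)) l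
    (.iteLt (k % r + c) r
      (.wrap .add (entry (u + k % r)) (entry (u + l * r + (k % r + c))))
      (.wrap .sub (entry (u + k % r)) (entry (u + l * r + (k % r + c - r)))))
    (.iteLt (k % r + c) r
      (.wrap .sub (entry (u + k % r)) (entry (u + l * r + (k % r + c))))
      (.wrap .add (entry (u + k % r)) (entry (u + l * r + (k % r + c - r)))))

def baseExpr : Expr :=
  let k := Expr.var vI
  let h := Expr.var vTot
  .iteLt (k % 2) 1
    (.wrap .sub (.wrap .mul (entry (k / 2 * 2)) (entry (h + k / 2 * 2)))
      (.wrap .mul (entry (k / 2 * 2 + 1)) (entry (h + k / 2 * 2 + 1))))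
    (.wrap .add (.wrap .mul (entry (k / 2 * 2)) (entry (h + k / 2 * 2 + 1)))
      (.wrap .mul (entry (k / 2 * 2 + 1)) (entry (h + k / 2 * 2))))

def unpadExpr : Expr :=
  let k := Expr.var vI
  let r := Expr.var vR
  let s := Expr.var vS
  let u := (k / (s * r) * (2 * s) + k % (s * r) % s) * r
  .iteLt (k % (s * r) / s) 1
    (.wrap .sub (entry (u + k % (s * r) / s)) (entry (u + s * r + (r - 1))))
    (.wrap .add (entry (u + k % (s * r) / s)) (entry (u + s * r + (k % (s * r) / s - 1))))

/-- Compute the block lengths of the current level. -/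
def setLengths : Stmt :=
  vR ≔ .bin .shl 1 (.var vB / 2 + 1) ;; vS ≔ .bin .shl 1 (.var vB - .var vB / 2)

def fftStmt : Stmt := .whileLt 0 (.var vL) (mapArray stageExpr ;; vL ≔ .var vL / 2)

def ifftStmt : Stmt :=
  .whileLt (.var vL) (.var vS + 1) (mapArray unstageExpr ;; vL ≔ 2 * .var vL)

def forwardStmt : Stmt :=
  .whileLt 0 (.var vB) (setLengths ;; vTot ≔ 2 * .var vTot ;; mapArray padExpr ;; vL ≔ .var vS ;;
    fftStmt ;; vB ≔ .var vB / 2 ;; vLev ≔ .var vLev + 1)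

def baseStmt : Stmt := vTot ≔ .var vTot / 2 ;; mapArray baseExpr

def backwardStmt : Stmt :=
  .whileLt 0 (.var vLev) (vLev ≔ .var vLev - 1 ;; vB ≔ .bin .shr (.var vA) (.var vLev) ;;
    setLengths ;; vL ≔ 1 ;; ifftStmt ;; vTot ≔ .var vTot / 2 ;; mapArray unpadExpr)

/-- Replace the two blocks of length `2 ^ (a + 1)` in the current array by their negacyclic
convolution. -/
def mulStmt : Stmt :=
  vB ≔ .var vA ;; vLev ≔ 0 ;; forwardStmt ;; baseStmt ;; backwardStmt

/-! ### Single passes over the arrays: no overflow and the right values -/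

section Spec

variable {A : Type*} [CommRing A] {w P Z : ℕ} {m₀ : ℕ → ℕ} {F F' : ℕ → A} {N N' : ℕ} {σ σ' : Store}

/-- The current array represents the first `N` values of `F`, both arrays have room for `Z` entries,
and the memory below `P` agrees with `m₀`. -/
structure Buffer (w P Z : ℕ) (m₀ : ℕ → ℕ) (F : ℕ → A) (N : ℕ) (σ : Store) : Prop where
  le_src : P ≤ σ.var vSrc
  le_dst : P ≤ σ.var vDst
  disj : σ.var vSrc + Z ≤ σ.var vDst ∨ σ.var vDst + Z ≤ σ.var vSrc
  src_lt : σ.var vSrc + Z < 2 ^ w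
  dst_lt : σ.var vDst + Z < 2 ^ w
  le : N ≤ Z
  holds : Holds w F σ.mem (σ.var vSrc) N
  prot : ∀ a < P, σ.mem a = m₀ a

theorem Buffer.congr (h : Buffer w P Z m₀ F N σ) (h1 : σ'.var vSrc = σ.var vSrc)
    (h2 : σ'.var vDst = σ.var vDst) (h3 : σ'.mem = σ.mem) : Buffer w P Z m₀ F N σ' := by
  obtain ⟨a, b, c, d, e, f, g, i⟩ := h
  constructor <;> simp_all

/-- The two arrays are disjoint, so the current one stays intact while the spare one is being
filled. The hypothesis on `e` may therefore assume of the memory only that the current array is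
still there. -/
theorem exec_mapArray {e : Expr} (hB : Buffer w P Z m₀ F N σ) (hN' : σ.var vTot ≤ Z)
    (he : ∀ k < σ.var vTot, ∀ m : ℕ → ℕ, Holds w F m (σ.var vSrc) N →
      e.Safe w ⟨Function.update σ.var vI k, m⟩ ∧
      Word w (e.val w ⟨Function.update σ.var vI k, m⟩) (F' k)) :
    Exec w (mapArray e) σ ((Z + 1) * (e.cost + 20)) fun σ' =>
      Buffer w P Z m₀ F' (σ.var vTot) σ' ∧
      ∀ x ∉ [vI, vAux, vSrc, vDst], σ'.var x = σ.var x := by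
  have hsub : Exec w (mapArray e) σ ((Z + 1) * (e.cost + 20)) fun σ' =>
      Buffer w P Z m₀ F' (σ.var vTot) σ' := by
    refine Exec.mono (Exec.seq (T' := 6) (Exec.fill_of (fun k v => Word w v (F' k)) (by decide)
      (by decide) (by have := hB.dst_lt; omega) (fun k hk m hm => he k hk m fun j hj => ?_) le_rfl
      fun m hm hP => ?_)) ?_ fun _ h => h
    · rw [hm _ (by have := hB.disj; have := hB.le; omega)]
      exact hB.holds j hj
    · refine Exec.mono (Exec.seq (Exec.assign (by simp) (Exec.seq (Exec.assign (by simp)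
        (Exec.assign (by simp) ?_))))) (by simp) fun _ h => h
      have h1 := hB.le_src
      have h2 := hB.le_dst
      have h3 := hB.disj
      have h4 := hB.src_lt
      have h5 := hB.dst_lt
      constructor <;> (try simp [Store.set])
      · exact h2
      · exact h1
      · omega
      · exact h5
      · exact h4
      · exact hN'
      · intro k hk
        exact hP k hk
      · intro a ha
        rw [hm a (by omega), hB.prot a ha]
    · have : (σ.var vTot + 1) * (e.cost + 12) ≤ (Z + 1) * (e.cost + 12) :=
        Nat.mul_le_mul_right _ (by omega)
      nlinarith
  exact hsub.frame.mono le_rfl fun σ' h => ⟨h.1, fun x hx => h.2 x (by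
    simpa [mapArray, Stmt.fill, Stmt.writes] using hx)⟩

/-- The block of length `b` that contains `q` lies completely below `M`, since `M` is a multiple of
`b`; this keeps all addresses inside the array. -/
theorem div_mul_add_le {b M q : ℕ} (hb : b ∣ M) (hq : q < M) : q / b * b + b ≤ M := by
  obtain ⟨c, rfl⟩ := hb
  have : q / b < c := Nat.div_lt_of_lt_mul hq
  calc q / b * b + b = (q / b + 1) * b := by ring
    _ ≤ c * b := Nat.mul_le_mul_right _ this
    _ = b * c := mul_comm _ _

theorem safe_stageExpr (hA : ((2 ^ w : ℕ) : A) = 0) {r l k : ℕ} {v m : ℕ → ℕ} (hr : v vR = r)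
    (hl : v vL = l) (hw : 4 < 2 ^ w)
    (hv : v vSrc + N < 2 ^ w) (hl0 : 0 < l) (hr0 : 0 < r) (hlr : l ∣ r)
    (hN : 2 * l * r ∣ N) (hk : k < N) (hF : Holds w F m (v vSrc) N) :
    stageExpr.Safe w ⟨Function.update v vI k, m⟩ ∧
      Word w (stageExpr.val w ⟨Function.update v vI k, m⟩) (stage r l F k) := by
  have hj : k % r < r := Nat.mod_lt _ hr0
  have hi : k / r % l < l := Nat.mod_lt _ hl0
  obtain ⟨ρ, hρ⟩ := hlr
  have hρ' : r / l = ρ := by rw [hρ, Nat.mul_div_cancel_left _ hl0]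
  have hρ0 : 0 < ρ := Nat.pos_of_ne_zero fun h => by simp [h] at hρ; omega
  have hc : k / r % l * (r / l) < r := by
    rw [hρ', hρ, ← hρ]
    calc k / r % l * ρ < l * ρ := Nat.mul_lt_mul_of_pos_right hi hρ0
      _ = r := hρ.symm
  obtain ⟨M, rfl⟩ : r ∣ N := (dvd_mul_left r (2 * l)).trans hN
  have hM : 2 * l ∣ M := by
    rw [mul_comm r M] at hN
    exact Nat.dvd_of_mul_dvd_mul_right hr0 hN
  have hq : k / r < M := Nat.div_lt_of_lt_mul hk
  have hblk := div_mul_add_le hM hq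
  have hdd : k / r / l / 2 = k / r / (2 * l) := by rw [Nat.div_div_eq_div_mul, mul_comm l 2]
  -- The row at offset `u` and its partner `l` rows further on both end inside the array. All bounds
  -- on addresses follow from this.
  have hu : (k / r / l / 2 * (2 * l) + k / r % l) * r + l * r + r ≤ r * M := by
    rw [hdd]
    calc _ = (k / r / (2 * l) * (2 * l) + k / r % l + l + 1) * r := by ring
      _ ≤ M * r := Nat.mul_le_mul_right _ (by omega)
      _ = r * M := mul_comm _ _
  have hkr : k / r ≤ k := Nat.div_le_self _ _
  have h1 : k / r / l / 2 * (2 * l) + k / r % l ≤ M := by rw [hdd]; omega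
  have hMr : M ≤ r * M := Nat.le_mul_of_pos_left _ hr0
  have h2l : 2 * l ≤ M := Nat.le_of_dvd (by omega) hM
  have hread : ∀ x < r * M, Word w (m (v vSrc + x)) (F x) := hF
  have h2r : r * 2 ≤ r * M := Nat.mul_le_mul_left _ (by omega)
  subst hr hl
  constructor
  · simp only [stageExpr, entry, Expr.safe_iteLt, Expr.safe_wrap, Expr.safe_load, Expr.safe_add,
      Expr.safe_sub, Expr.safe_mul, Expr.safe_div, Expr.safe_mod, Expr.safe_var, Expr.safe_ofNat,
      Expr.val_add, Expr.val_sub, Expr.val_mul, Expr.val_div, Expr.val_mod, Expr.val_var,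
      Expr.val_ofNat, Function.update_self, ne_eq, Nat.reduceEqDiff,
      not_false_eq_true, Function.update_of_ne, true_and, and_true]
    clear hF hread hA hN hM hblk
    repeat' first | apply And.intro | intro _
    all_goals omega
  · simp only [stageExpr, entry, Expr.val_iteLt, Expr.val_wrap, Expr.val_load,
      Expr.val_add, Expr.val_sub, Expr.val_mul, Expr.val_div, Expr.val_mod, Expr.val_var,
      Expr.val_ofNat, Function.update_self, ne_eq, Nat.reduceEqDiff,
      not_false_eq_true, Function.update_of_ne]
    simp only [stage]
    split_ifs
    · exact (hread _ (by omega)).add hA (hread _ (by omega))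
    · exact (hread _ (by omega)).sub hA (hread _ (by omega))
    · exact (hread _ (by omega)).sub hA (hread _ (by omega))

theorem safe_unstageExpr (hA : ((2 ^ w : ℕ) : A) = 0) {r l k : ℕ} {v m : ℕ → ℕ} (hr : v vR = r)
    (hl : v vL = l) (hw : 4 < 2 ^ w)
    (hv : v vSrc + N < 2 ^ w) (hl0 : 0 < l) (hr0 : 0 < r) (hlr : l ∣ r)
    (hN : 2 * l * r ∣ N) (hk : k < N) (hF : Holds w F m (v vSrc) N) :
    unstageExpr.Safe w ⟨Function.update v vI k, m⟩ ∧
      Word w (unstageExpr.val w ⟨Function.update v vI k, m⟩) (unstage r l F k) := by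
  have hj : k % r < r := Nat.mod_lt _ hr0
  have hi : k / r % (2 * l) % l < l := Nat.mod_lt _ hl0
  obtain ⟨ρ, hρ⟩ := hlr
  have hρ' : r / l = ρ := by rw [hρ, Nat.mul_div_cancel_left _ hl0]
  have hρ0 : 0 < ρ := Nat.pos_of_ne_zero fun h => by simp [h] at hρ; omega
  have hc : k / r % (2 * l) % l * (r / l) < r := by
    rw [hρ', hρ, ← hρ]
    calc k / r % (2 * l) % l * ρ < l * ρ := Nat.mul_lt_mul_of_pos_right hi hρ0
      _ = r := hρ.symm
  obtain ⟨M, rfl⟩ : r ∣ N := (dvd_mul_left r (2 * l)).trans hN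
  have hM : 2 * l ∣ M := by
    rw [mul_comm r M] at hN
    exact Nat.dvd_of_mul_dvd_mul_right hr0 hN
  have hq : k / r < M := Nat.div_lt_of_lt_mul hk
  have hblk := div_mul_add_le hM hq
  have hu : (k / r / (2 * l) * (2 * l) + k / r % (2 * l) % l) * r + l * r + r ≤ r * M := by
    calc _ = (k / r / (2 * l) * (2 * l) + k / r % (2 * l) % l + l + 1) * r := by ring
      _ ≤ M * r := Nat.mul_le_mul_right _ (by omega)
      _ = r * M := mul_comm _ _
  have hkr : k / r ≤ k := Nat.div_le_self _ _
  have h1 : k / r / (2 * l) * (2 * l) + k / r % (2 * l) % l ≤ M := by omega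
  have hMr : M ≤ r * M := Nat.le_mul_of_pos_left _ hr0
  have h2l : 2 * l ≤ M := Nat.le_of_dvd (by omega) hM
  have hread : ∀ x < r * M, Word w (m (v vSrc + x)) (F x) := hF
  have h2r : r * 2 ≤ r * M := Nat.mul_le_mul_left _ (by omega)
  subst hr hl
  constructor
  · simp only [unstageExpr, entry, Expr.safe_iteLt, Expr.safe_wrap, Expr.safe_load, Expr.safe_add,
      Expr.safe_sub, Expr.safe_mul, Expr.safe_div, Expr.safe_mod, Expr.safe_var, Expr.safe_ofNat,
      Expr.val_add, Expr.val_sub, Expr.val_mul, Expr.val_div, Expr.val_mod, Expr.val_var,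
      Expr.val_ofNat, Function.update_self, ne_eq, Nat.reduceEqDiff,
      not_false_eq_true, Function.update_of_ne, true_and, and_true]
    clear hF hread hA hN hM hblk
    repeat' first | apply And.intro | intro _
    all_goals omega
  · simp only [unstageExpr, entry, Expr.val_iteLt, Expr.val_wrap, Expr.val_load,
      Expr.val_add, Expr.val_sub, Expr.val_mul, Expr.val_div, Expr.val_mod, Expr.val_var,
      Expr.val_ofNat, Function.update_self, ne_eq, Nat.reduceEqDiff,
      not_false_eq_true, Function.update_of_ne]
    simp only [unstage]
    split_ifs
    · exact (hread _ (by omega)).add hA (hread _ (by omega))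
    · exact (hread _ (by omega)).sub hA (hread _ (by omega))
    · exact (hread _ (by omega)).sub hA (hread _ (by omega))
    · exact (hread _ (by omega)).add hA (hread _ (by omega))

theorem safe_padExpr {r s k : ℕ} {v m : ℕ → ℕ} (hr : v vR = r)
    (hs : v vS = s) (hw : 4 < 2 ^ w)
    (hv : v vSrc + 2 * N < 2 ^ w) (hs0 : 0 < s) (hr0 : 0 < r)
    (hN : s * r ∣ N) (hk : k < 2 * N) (hF : Holds w F m (v vSrc) N) :
    padExpr.Safe w ⟨Function.update v vI k, m⟩ ∧
      Word w (padExpr.val w ⟨Function.update v vI k, m⟩) (pad s r F k) := by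
  have hj : k % r < r := Nat.mod_lt _ hr0
  have hi : k / r % (2 * s) < 2 * s := Nat.mod_lt _ (by omega)
  have hq : k / r / (2 * s) = 2 * k / 2 / r / (2 * s) := by rw [Nat.mul_div_cancel_left _ two_pos]
  obtain ⟨M, rfl⟩ := hN
  have hB : k / r / (2 * s) < M := by
    rw [Nat.div_div_eq_div_mul]
    exact Nat.div_lt_of_lt_mul (by calc k < 2 * (s * r * M) := hk
      _ = r * (2 * s) * M := by ring)
  have hB' : k / r / (2 * s) * (s * r) + s * r ≤ s * r * M := by
    calc _ = (k / r / (2 * s) + 1) * (s * r) := by ring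
      _ ≤ M * (s * r) := Nat.mul_le_mul_right _ hB
      _ = s * r * M := mul_comm _ _
  have hsj : s * (k % r) + s ≤ s * r := by
    calc _ = s * (k % r + 1) := by ring
      _ ≤ s * r := Nat.mul_le_mul_left _ hj
  have hread : ∀ x < s * r * M, Word w (m (v vSrc + x)) (F x) := hF
  subst hr hs
  constructor
  · simp only [padExpr, entry, Expr.safe_iteLt, Expr.safe_wrap, Expr.safe_load, Expr.safe_add,
      Expr.safe_sub, Expr.safe_mul, Expr.safe_div, Expr.safe_mod, Expr.safe_var, Expr.safe_ofNat,
      Expr.val_add, Expr.val_sub, Expr.val_mul, Expr.val_div, Expr.val_mod, Expr.val_var,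
      Expr.val_ofNat, Function.update_self, ne_eq, Nat.reduceEqDiff,
      not_false_eq_true, Function.update_of_ne, true_and, and_true]
    clear hF hread hq
    repeat' first | apply And.intro | intro _
    all_goals omega
  · simp only [padExpr, entry, Expr.val_iteLt, Expr.val_wrap, Expr.val_load,
      Expr.val_add, Expr.val_sub, Expr.val_mul, Expr.val_div, Expr.val_mod, Expr.val_var,
      Expr.val_ofNat, Function.update_self, ne_eq, Nat.reduceEqDiff,
      not_false_eq_true, Function.update_of_ne]
    simp only [pad]
    split_ifs
    · exact hread _ (by omega)
    · exact Word.zero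

theorem safe_baseExpr (hA : ((2 ^ w : ℕ) : A) = 0) {k : ℕ} {v m : ℕ → ℕ} (hr : v vTot = N)
    (hw : 4 < 2 ^ w) (hv : v vSrc + 2 * N < 2 ^ w)
    (hN : 2 ∣ N) (hk : k < N) (hF : Holds w F m (v vSrc) (2 * N)) :
    baseExpr.Safe w ⟨Function.update v vI k, m⟩ ∧
      Word w (baseExpr.val w ⟨Function.update v vI k, m⟩) (base N F k) := by
  have hread : ∀ x < 2 * N, Word w (m (v vSrc + x)) (F x) := hF
  obtain ⟨M, rfl⟩ := hN
  constructor
  · simp only [baseExpr, entry, hr, Expr.safe_iteLt, Expr.safe_wrap, Expr.safe_load, Expr.safe_add,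
      Expr.safe_sub, Expr.safe_mul, Expr.safe_div, Expr.safe_mod, Expr.safe_var, Expr.safe_ofNat,
      Expr.val_add, Expr.val_sub, Expr.val_mul, Expr.val_div, Expr.val_mod, Expr.val_var,
      Expr.val_ofNat, Function.update_self, ne_eq, Nat.reduceEqDiff,
      not_false_eq_true, Function.update_of_ne, true_and, and_true]
    clear hF hread hA
    repeat' first | apply And.intro | intro _
    all_goals omega
  · simp only [baseExpr, entry, hr, Expr.val_iteLt, Expr.val_wrap, Expr.val_load,
      Expr.val_add, Expr.val_sub, Expr.val_mul, Expr.val_div, Expr.val_mod, Expr.val_var,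
      Expr.val_ofNat, Function.update_self, ne_eq, Nat.reduceEqDiff,
      not_false_eq_true, Function.update_of_ne]
    simp only [base]
    split_ifs
    · exact ((hread _ (by omega)).mul hA (hread _ (by omega))).sub hA
        ((hread _ (by omega)).mul hA (hread _ (by omega)))
    · exact ((hread _ (by omega)).mul hA (hread _ (by omega))).add hA
        ((hread _ (by omega)).mul hA (hread _ (by omega)))

theorem safe_unpadExpr (hA : ((2 ^ w : ℕ) : A) = 0) {r s k : ℕ} {v m : ℕ → ℕ} (hr : v vR = r)
    (hs : v vS = s) (hw : 4 < 2 ^ w)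
    (hv : v vSrc + 2 * N < 2 ^ w) (hs0 : 0 < s) (hr0 : 0 < r)
    (hN : s * r ∣ N) (hk : k < N) (hF : Holds w F m (v vSrc) (2 * N)) :
    unpadExpr.Safe w ⟨Function.update v vI k, m⟩ ∧
      Word w (unpadExpr.val w ⟨Function.update v vI k, m⟩) (unpad s r F k) := by
  have hpos : k % (s * r) < s * r := Nat.mod_lt _ (by positivity)
  have hi : k % (s * r) % s < s := Nat.mod_lt _ hs0
  have hj : k % (s * r) / s < r := Nat.div_lt_of_lt_mul hpos
  have hblk := div_mul_add_le hN hk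
  have hu : (k / (s * r) * (2 * s) + k % (s * r) % s) * r + s * r + r ≤ 2 * N := by
    calc _ = (k / (s * r) * (2 * s) + (k % (s * r) % s + 1) + s) * r := by ring
      _ ≤ (k / (s * r) * (2 * s) + s + s) * r := Nat.mul_le_mul_right _ (by omega)
      _ = 2 * (k / (s * r) * (s * r) + s * r) := by ring
      _ ≤ 2 * N := by omega
  have h1 : k / (s * r) * (2 * s) + k % (s * r) % s ≤
      (k / (s * r) * (2 * s) + k % (s * r) % s) * r := Nat.le_mul_of_pos_right _ hr0
  have h2 : s ≤ s * r := Nat.le_mul_of_pos_right _ hr0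
  have hread : ∀ x < 2 * N, Word w (m (v vSrc + x)) (F x) := hF
  subst hr hs
  constructor
  · simp only [unpadExpr, entry, Expr.safe_iteLt, Expr.safe_wrap, Expr.safe_load, Expr.safe_add,
      Expr.safe_sub, Expr.safe_mul, Expr.safe_div, Expr.safe_mod, Expr.safe_var, Expr.safe_ofNat,
      Expr.val_add, Expr.val_sub, Expr.val_mul, Expr.val_div, Expr.val_mod, Expr.val_var,
      Expr.val_ofNat, Function.update_self, ne_eq, Nat.reduceEqDiff,
      not_false_eq_true, Function.update_of_ne, true_and, and_true]
    clear hF hread hA hN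
    repeat' first | apply And.intro | intro _
    all_goals omega
  · simp only [unpadExpr, entry, Expr.val_iteLt, Expr.val_wrap, Expr.val_load,
      Expr.val_add, Expr.val_sub, Expr.val_mul, Expr.val_div, Expr.val_mod, Expr.val_var,
      Expr.val_ofNat, Function.update_self, ne_eq, Nat.reduceEqDiff,
      not_false_eq_true, Function.update_of_ne]
    simp only [unpad]
    split_ifs
    · exact (hread _ (by omega)).sub hA (hread _ (by omega))
    · exact (hread _ (by omega)).add hA (hread _ (by omega))

end Spec

end Nussbaumer

namespace WordRAM

@[simp] theorem Store.set_var (σ : Store) (x a y : ℕ) :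
    (σ.set x a).var y = if y = x then a else σ.var y := Function.update_apply _ _ _ _

@[simp] theorem Store.set_mem (σ : Store) (x a : ℕ) : (σ.set x a).mem = σ.mem := rfl

theorem Exec.assign_seq {w : ℕ} {σ : Store} {T : ℕ} {Q : Store → Prop} {x : ℕ} {e : Expr} {S : Stmt}
    (he : e.Safe w σ) (h : Exec w S (σ.set x (e.val w σ)) T Q) :
    Exec w (x ≔ e ;; S) σ (e.cost + 1 + T) Q := Exec.seq (Exec.assign he h)

end WordRAM

/-! ### The loops of the convolution program and their running time -/

namespace Nussbaumer

open WordRAM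

variable {A : Type*} [CommRing A] {w P Z : ℕ} {m₀ : ℕ → ℕ} {F G : ℕ → A} {N : ℕ} {σ : Store}

/-- The bound `400` covers each of the five expressions used in the passes, which gives all passes
the same time bound. -/
theorem exec_mapArray_of_cost {F' : ℕ → A} {e : Expr} (hc : e.cost ≤ 400)
    (hB : Buffer w P Z m₀ F N σ) (hN' : σ.var vTot ≤ Z)
    (he : ∀ k < σ.var vTot, ∀ m : ℕ → ℕ, Holds w F m (σ.var vSrc) N →
      e.Safe w ⟨Function.update σ.var vI k, m⟩ ∧
      Word w (e.val w ⟨Function.update σ.var vI k, m⟩) (F' k)) :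
    Exec w (mapArray e) σ ((Z + 1) * 420) fun σ' =>
      Buffer w P Z m₀ F' (σ.var vTot) σ' ∧
      ∀ x ∉ [vI, vAux, vSrc, vDst], σ'.var x = σ.var x :=
  (exec_mapArray hB hN' he).mono (Nat.mul_le_mul_left _ (by omega)) fun _ h => h

theorem exec_fft (hA : ((2 ^ w : ℕ) : A) = 0) (hw : 4 < 2 ^ w) {e f : ℕ} (hfe : f ≤ e)
    (hB : Buffer w P Z m₀ F N σ) (htot : σ.var vTot = N) (hr : σ.var vR = 2 ^ e)
    (hl : σ.var vL = 2 ^ f) (hN : 2 ^ (f + 1) * 2 ^ e ∣ N) :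
    Exec w fftStmt σ ((f + 2) * ((Z + 1) * 430)) fun σ' =>
      Buffer w P Z m₀ (fft (2 ^ e) (f + 1) F) N σ' ∧
      ∀ x ∉ [vI, vAux, vSrc, vDst, vL], σ'.var x = σ.var x := by
  have hsub : Exec w fftStmt σ ((f + 2) * ((Z + 1) * 430)) fun σ' =>
      Buffer w P Z m₀ (fft (2 ^ e) (f + 1) F) N σ' := by
    -- Invariant: the stages that are still due, applied to the current data `G`, yield the whole
    -- transform of `F`. The loop ends when halving turns the half-length `1` into `0`.
    refine Exec.mono (Exec.whileLt_const (f + 1) (fun k σ' => ∃ G : ℕ → A,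
      Buffer w P Z m₀ G N σ' ∧ fft (2 ^ e) (f + 1 - k) G = fft (2 ^ e) (f + 1) F ∧
      σ'.var vTot = N ∧ σ'.var vR = 2 ^ e ∧ σ'.var vL = 2 ^ f / 2 ^ k) ((Z + 1) * 420 + 4)
      ⟨F, hB, rfl, htot, hr, by simpa using hl⟩ (fun k _ σ' _ => by simp) ?_ ?_) ?_ fun _ h => h
    · rintro k hk σ' ⟨G, hG, hfft, htot', hr', hl'⟩
      have hdiv : 2 ^ f / 2 ^ k = 2 ^ (f - k) := Nat.pow_div (by omega) (by omega)
      refine ⟨by simp [hl', hdiv], Exec.seq (T' := 4) ?_⟩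
      have hdvd : 2 * 2 ^ (f - k) * 2 ^ e ∣ N := by
        refine Dvd.dvd.trans ?_ hN
        rw [← pow_succ']
        exact Nat.mul_dvd_mul (pow_dvd_pow 2 (by omega)) dvd_rfl
      refine (exec_mapArray_of_cost (F' := stage (2 ^ e) (2 ^ (f - k)) G) (by decide) hG
        (by rw [htot']; exact hG.le) fun i hi m hm => ?_).mono le_rfl fun σ'' h => ?_
      · rw [htot'] at hi
        exact safe_stageExpr hA hr' (by rw [hl', hdiv]) hw
          (by have := hG.src_lt; have := hG.le; omega) (by positivity) (by positivity)
          (pow_dvd_pow 2 (by omega)) hdvd hi hm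
      · refine Exec.mono (Exec.assign (by simp; omega) ?_) (by simp) fun _ h => h
        obtain ⟨h1, h2⟩ := h
        refine ⟨stage (2 ^ e) (2 ^ (f - k)) G, ?_, ?_, ?_, ?_, ?_⟩
        · rw [htot'] at h1
          exact h1.congr (by simp) (by simp) rfl
        · rw [← hfft, show f + 1 - k = f - k + 1 by omega, show f + 1 - (k + 1) = f - k by omega, fft]
        · simp [h2, htot']
        · simp [h2, hr']
        · simp [h2, hl', Nat.div_div_eq_div_mul, pow_succ]
    · rintro σ' ⟨G, hG, hfft, -, -, hl'⟩
      have : 2 ^ f / 2 ^ (f + 1) = 0 := Nat.div_eq_of_lt (Nat.pow_lt_pow_right one_lt_two (by omega))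
      refine ⟨by simp [hl', this], ?_⟩
      rw [← hfft, Nat.sub_self, fft]
      exact hG
    · refine Nat.mul_le_mul_left _ ?_
      simp
      omega
  exact hsub.frame.mono le_rfl fun σ' h => ⟨h.1, fun x hx => h.2 x (by
    simpa [fftStmt, mapArray, Stmt.fill, Stmt.writes] using hx)⟩

theorem exec_ifft (hA : ((2 ^ w : ℕ) : A) = 0) (hw : 4 < 2 ^ w) {e f : ℕ} (hfe : f ≤ e)
    (hB : Buffer w P Z m₀ F N σ) (htot : σ.var vTot = N) (hr : σ.var vR = 2 ^ e)
    (hs : σ.var vS = 2 ^ f) (hl : σ.var vL = 1) (hN : 2 ^ (f + 1) * 2 ^ e ∣ N) (hN0 : 0 < N) :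
    Exec w ifftStmt σ ((f + 2) * ((Z + 1) * 430)) fun σ' =>
      Buffer w P Z m₀ (ifft (2 ^ e) (f + 1) F) N σ' ∧
      ∀ x ∉ [vI, vAux, vSrc, vDst, vL], σ'.var x = σ.var x := by
  -- At the final test the half-length has grown to `2 ^ (f + 1)`. It is still a word because the
  -- array has at least that many entries.
  have hf : 2 ^ (f + 1) < 2 ^ w := by
    have h1 := Nat.le_of_dvd hN0 ((dvd_mul_right _ _).trans hN)
    have := hB.src_lt
    have := hB.le
    omega
  have hsub : Exec w ifftStmt σ ((f + 2) * ((Z + 1) * 430)) fun σ' =>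
      Buffer w P Z m₀ (ifft (2 ^ e) (f + 1) F) N σ' := by
    refine Exec.mono (Exec.whileLt_const (f + 1) (fun k σ' =>
      Buffer w P Z m₀ (ifft (2 ^ e) k F) N σ' ∧
      σ'.var vTot = N ∧ σ'.var vR = 2 ^ e ∧ σ'.var vS = 2 ^ f ∧ σ'.var vL = 2 ^ k)
      ((Z + 1) * 420 + 4)
      ⟨hB, htot, hr, hs, by simpa using hl⟩ ?_ ?_ ?_) ?_ fun _ h => h
    · rintro k hk σ' ⟨-, -, -, hs', -⟩
      simp only [Expr.safe_var, Expr.safe_add, Expr.safe_ofNat, Expr.val_var, Expr.val_ofNat, hs',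
        true_and]
      have : 2 ^ (f + 1) = 2 ^ f + 2 ^ f := by ring
      have : 1 ≤ 2 ^ f := Nat.one_le_two_pow
      omega
    · rintro k hk σ' ⟨hG, htot', hr', hs', hl'⟩
      have hkf : 2 ^ k ≤ 2 ^ f := Nat.pow_le_pow_right two_pos (by omega)
      refine ⟨by simp [hl', hs']; omega, Exec.seq (T' := 4) ?_⟩
      have hdvd : 2 * 2 ^ k * 2 ^ e ∣ N := by
        refine Dvd.dvd.trans ?_ hN
        rw [← pow_succ']
        exact Nat.mul_dvd_mul (pow_dvd_pow 2 (by omega)) dvd_rfl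
      refine (exec_mapArray_of_cost (F' := unstage (2 ^ e) (2 ^ k) (ifft (2 ^ e) k F)) (by decide) hG
        (by rw [htot']; exact hG.le) fun i hi m hm => ?_).mono le_rfl fun σ'' h => ?_
      · rw [htot'] at hi
        exact safe_unstageExpr hA hr' hl' hw
          (by have := hG.src_lt; have := hG.le; omega) (by positivity) (by positivity)
          (pow_dvd_pow 2 (by omega)) hdvd hi hm
      · obtain ⟨h1, h2⟩ := h
        have hl'' : σ''.var vL = 2 ^ k := by rw [h2 _ (by decide), hl']
        have : 2 ^ (f + 1) = 2 * 2 ^ f := by ring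
        refine Exec.mono (Exec.assign ?_ ?_) (by simp) fun _ h => h
        · simp only [Expr.safe_mul, Expr.safe_var, Expr.safe_ofNat, Expr.val_var, Expr.val_ofNat,
            true_and, hl'']
          omega
        · refine ⟨?_, ?_, ?_, ?_, ?_⟩
          · rw [htot'] at h1
            exact h1.congr (by simp) (by simp) rfl
          · simp [h2, htot']
          · simp [h2, hr']
          · simp [h2, hs']
          · simp [hl'', pow_succ']
    · rintro σ' ⟨hG, -, -, hs', hl'⟩
      have : 2 ^ (f + 1) = 2 ^ f + 2 ^ f := by ring
      have : 1 ≤ 2 ^ f := Nat.one_le_two_pow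
      exact ⟨by simp [hl', hs']; omega, hG⟩
    · refine Nat.mul_le_mul_left _ ?_
      simp
      omega
  exact hsub.frame.mono le_rfl fun σ' h => ⟨h.1, fun x hx => h.2 x (by
    simpa [ifftStmt, mapArray, Stmt.fill, Stmt.writes] using hx)⟩

theorem exec_setLengths {b : ℕ} (hb : σ.var vB = b) (hw : 4 < 2 ^ w) (hlt : 2 ^ (b + 1) < 2 ^ w)
    {S : Stmt} {T : ℕ} {Q : Store → Prop}
    (h : Exec w S ((σ.set vR (2 ^ (b / 2 + 1))).set vS (2 ^ (b - b / 2))) T Q) :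
    Exec w (setLengths ;; S) σ (16 + T) Q := by
  have hb2 : b < 2 ^ w := by
    have : b + 1 < 2 ^ (b + 1) := Nat.lt_two_pow_self
    omega
  have h1 : 2 ^ (b / 2 + 1) ≤ 2 ^ (b + 1) := Nat.pow_le_pow_right two_pos (by omega)
  have h2 : 2 ^ (b - b / 2) ≤ 2 ^ (b + 1) := Nat.pow_le_pow_right two_pos (by omega)
  have hb1 : b + 1 < 2 ^ w := lt_trans Nat.lt_two_pow_self hlt
  refine Exec.mono (Exec.seq (T' := T) (Exec.assign_seq ?_ (Exec.assign ?_ ?_))) ?_ fun _ h => h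
  · simp only [Expr.safe_shl, Expr.safe_add, Expr.safe_div, Expr.safe_var, Expr.safe_ofNat,
      Expr.val_add, Expr.val_div, Expr.val_var, Expr.val_ofNat, hb, Nat.shiftLeft_eq, true_and,
      one_mul]
    omega
  · simp only [Expr.safe_shl, Expr.safe_sub, Expr.safe_div, Expr.safe_var, Expr.safe_ofNat,
      Expr.val_sub, Expr.val_div, Expr.val_var, Expr.val_ofNat, hb, Nat.shiftLeft_eq, true_and,
      one_mul, Store.set_var, Nat.reduceEqDiff, if_false]
    omega
  · simp only [Expr.val_shl, Expr.val_sub, Expr.val_div, Expr.val_var, Expr.val_ofNat, Expr.val_add,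
      hb, Nat.shiftLeft_eq, one_mul, Store.set_var, Nat.reduceEqDiff, if_false]
    exact h
  · simp

/-- The exponent at depth `k` is `a / 2 ^ k`, a shift of `a`. Hence the recursion can be run as two
loops without a stack: the way back recomputes the exponent from the level. -/
theorem levels_div (a k : ℕ) : levels (a / 2 ^ k) = levels a - k := by
  induction k generalizing a with
  | zero => simp
  | succ k ih =>
    rw [pow_succ', ← Nat.div_div_eq_div_mul, ih]
    conv_rhs => rw [levels]
    split_ifs with ha
    · subst ha
      rw [levels]
      simp
    · omega

theorem levels_eq_zero {a : ℕ} : levels a = 0 ↔ a = 0 := by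
  rw [levels]
  split_ifs with h <;> simp [h]

theorem exec_forward (hA : ((2 ^ w : ℕ) : A) = 0) (hw : 4 < 2 ^ w) {a : ℕ}
    (hB : Buffer w P Z m₀ F N σ) (htot : σ.var vTot = N) (ha : σ.var vB = a)
    (hlev : σ.var vLev = 0) (hN : 2 ^ (a + 1) ∣ N) (hN0 : 0 < N) (hZ : N * 2 ^ levels a ≤ Z) :
    Exec w forwardStmt σ ((levels a + 1) * ((a + 4) * ((Z + 1) * 500))) fun σ' =>
      Buffer w P Z m₀ (forward a F) (N * 2 ^ levels a) σ' ∧ σ'.var vTot = N * 2 ^ levels a ∧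
        σ'.var vLev = levels a := by
  have hZw : Z < 2 ^ w := by have := hB.src_lt; omega
  -- Invariant: after `k` levels the array has doubled `k` times, and the remaining levels applied
  -- to its contents `G` complete the transform of `F`.
  refine Exec.mono (Exec.whileLt_const (levels a) (fun k σ' => ∃ G : ℕ → A,
    Buffer w P Z m₀ G (N * 2 ^ k) σ' ∧ forward (a / 2 ^ k) G = forward a F ∧
    σ'.var vTot = N * 2 ^ k ∧ σ'.var vB = a / 2 ^ k ∧ σ'.var vLev = k)
    ((a + 3) * ((Z + 1) * 430) + (Z + 1) * 420 + 40)
    ⟨F, by simpa using hB, by simp, by simpa using htot, by simpa using ha, hlev⟩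
    (fun k _ σ' _ => by simp) ?_ ?_) ?_ fun _ h => h
  · rintro k hk σ' ⟨G, hG, hfw, htot', hb, hlev'⟩
    set b := a / 2 ^ k with hbdef
    have hb0 : b ≠ 0 := fun h => by
      have := levels_div a k
      rw [← hbdef, levels_eq_zero.2 h] at this
      omega
    refine ⟨by simp [hb]; omega, ?_⟩
    have hba : b ≤ a := Nat.div_le_self _ _
    have hdvd : 2 ^ (b + 1) ∣ N * 2 ^ k :=
      ((pow_dvd_pow 2 (by omega)).trans hN).trans (dvd_mul_right _ _)
    have hNk : N * 2 ^ (k + 1) ≤ Z :=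
      (Nat.mul_le_mul_left _ (Nat.pow_le_pow_right two_pos (by omega))).trans hZ
    have hNk' : N * 2 ^ (k + 1) = 2 * (N * 2 ^ k) := by ring
    have hpos : 0 < N * 2 ^ k := by positivity
    have hble := Nat.le_of_dvd hpos hdvd
    have hkN : k < N * 2 ^ k := by
      have : k < 2 ^ k := Nat.lt_two_pow_self
      nlinarith
    have hsr : 2 ^ (b + 1) = 2 ^ (b - b / 2) * 2 ^ (b / 2 + 1) := by
      rw [← pow_add]; congr 1; omega
    refine Exec.mono (T := 16 + (4 + ((Z + 1) * 420 + (2 + ((a + 2) * ((Z + 1) * 430) + (4 + 4))))))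
      (exec_setLengths hb hw (by omega) (Exec.assign_seq ?_ (Exec.seq ?_))) ?_ fun _ h => h
    · simp only [Expr.safe_mul, Expr.safe_ofNat, Expr.safe_var, Expr.val_ofNat, Expr.val_var,
        Store.set_var, Nat.reduceEqDiff, if_false, htot', true_and]
      omega
    · set σ₁ := ((σ'.set vR (2 ^ (b / 2 + 1))).set vS (2 ^ (b - b / 2))).set vTot
        (2 * (N * 2 ^ k)) with hσ₁
      have hval : Expr.val w ((σ'.set vR (2 ^ (b / 2 + 1))).set vS (2 ^ (b - b / 2)))
          (2 * Expr.var vTot) = 2 * (N * 2 ^ k) := by simp [htot']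
      rw [hval, ← hσ₁]
      have hG₁ : Buffer w P Z m₀ G (N * 2 ^ k) σ₁ := hG.congr (by simp [hσ₁]) (by simp [hσ₁]) rfl
      have ht₁ : σ₁.var vTot = 2 * (N * 2 ^ k) := by simp [hσ₁]
      have hr₁ : σ₁.var vR = 2 ^ (b / 2 + 1) := by simp [hσ₁]
      have hs₁ : σ₁.var vS = 2 ^ (b - b / 2) := by simp [hσ₁]
      have hb₁ : σ₁.var vB = b := by simp [hσ₁, hb]
      have hl₁ : σ₁.var vLev = k := by simp [hσ₁, hlev']
      clear_value σ₁
      refine (exec_mapArray_of_cost (F' := pad (2 ^ (b - b / 2)) (2 ^ (b / 2 + 1)) G) (by decide) hG₁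
        (by rw [ht₁]; omega) fun i hi m hm => ?_).mono le_rfl fun σ₂ h₂ => ?_
      · rw [ht₁] at hi
        exact safe_padExpr hr₁ hs₁ hw (by have := hG₁.src_lt; omega) (by positivity)
          (by positivity) (by rwa [← hsr]) hi hm
      · obtain ⟨hB₂, hv₂⟩ := h₂
        rw [ht₁] at hB₂
        refine Exec.assign_seq (by simp) (Exec.seq ((Exec.mono (exec_fft (e := b / 2 + 1)
          (σ := σ₂.set vL (Expr.val w σ₂ (.var vS)))
          (f := b - b / 2) hA hw (by omega)
          (hB₂.congr (by simp) (by simp) rfl) ?_ ?_ ?_ ?_)) ?_ fun σ₃ h₃ => ?_))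
        · simp [hv₂, ht₁]
        · simp [hv₂, hr₁]
        · simp [hv₂, hs₁]
        · rw [pow_succ', mul_assoc, ← hsr]
          exact Nat.mul_dvd_mul_left 2 hdvd
        · exact Nat.mul_le_mul_right _ (by omega)
        · obtain ⟨hB₃, hv₃⟩ := h₃
          have hb₃ : σ₃.var vB = b := by rw [hv₃ _ (by decide)]; simp [hv₂, hb₁]
          have hl₃ : σ₃.var vLev = k := by rw [hv₃ _ (by decide)]; simp [hv₂, hl₁]
          have ht₃ : σ₃.var vTot = 2 * (N * 2 ^ k) := by rw [hv₃ _ (by decide)]; simp [hv₂, ht₁]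
          refine Exec.assign_seq (by simp; omega) (Exec.assign ?_ ?_)
          · simp only [Expr.safe_add, Expr.safe_ofNat, Expr.safe_var, Expr.val_ofNat, Expr.val_var,
              Store.set_var, Nat.reduceEqDiff, if_false, hl₃, true_and]
            omega
          · rw [hNk']
            refine ⟨_, hB₃.congr (σ' := (σ₃.set vB _).set vLev _) (by simp) (by simp) rfl,
              ?_, ?_, ?_, ?_⟩
            · rw [← hfw, pow_succ, ← Nat.div_div_eq_div_mul, ← hbdef]
              conv_rhs => rw [forward, if_neg hb0]
            · simp [ht₃]
            · simp [hb₃, hbdef, pow_succ, Nat.div_div_eq_div_mul]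
            · simp [hl₃]
    · simp
      nlinarith
  · rintro σ' ⟨G, hG, hfw, htot', hb, hlev'⟩
    have h0 : a / 2 ^ levels a = 0 := by
      rw [← levels_eq_zero, levels_div, Nat.sub_self]
    refine ⟨by simp [hb, h0], ?_, htot', hlev'⟩
    rw [h0, forward, if_pos rfl] at hfw
    rwa [← hfw]
  · refine Nat.mul_le_mul_left _ ?_
    simp
    nlinarith

theorem exec_base (hA : ((2 ^ w : ℕ) : A) = 0) (hw : 4 < 2 ^ w)
    (hB : Buffer w P Z m₀ F (2 * N) σ) (htot : σ.var vTot = 2 * N) (hN : 2 ∣ N) :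
    Exec w baseStmt σ ((Z + 1) * 430) fun σ' =>
      Buffer w P Z m₀ (base N F) N σ' ∧ σ'.var vTot = N ∧ σ'.var vLev = σ.var vLev := by
  have hle := hB.le
  have hval : Expr.val w σ (Expr.var vTot / 2) = N := by simp [htot]
  refine Exec.mono (T := 4 + (Z + 1) * 420) (Exec.assign_seq (by simp; omega) ?_) (by omega)
    fun _ h => h
  rw [hval]
  refine (exec_mapArray_of_cost (F' := base N F) (by decide)
    (hB.congr (σ' := σ.set vTot N) (by simp) (by simp) rfl)
    (by simp; omega) fun i hi m hm => ?_).mono le_rfl fun σ₂ h₂ => ?_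
  · simp only [Store.set_var, if_true] at hi
    exact safe_baseExpr hA (by simp) hw (by simp; have := hB.src_lt; omega) hN hi hm
  · obtain ⟨hB₂, hv₂⟩ := h₂
    simp only [Store.set_var, if_true] at hB₂
    exact ⟨hB₂, by simp [hv₂], by simp [hv₂]⟩

theorem exec_backward (hA : ((2 ^ w : ℕ) : A) = 0) (hw : 4 < 2 ^ w) {a : ℕ}
    (hB : Buffer w P Z m₀ F (N * 2 ^ levels a) σ) (htot : σ.var vTot = N * 2 ^ levels a)
    (ha : σ.var vA = a) (hlev : σ.var vLev = levels a) (hN : 2 ^ (a + 1) ∣ N) (hN0 : 0 < N) :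
    Exec w backwardStmt σ ((levels a + 1) * ((a + 4) * ((Z + 1) * 500))) fun σ' =>
      Buffer w P Z m₀ (backward a F) N σ' := by
  have hZw : Z < 2 ^ w := by have := hB.src_lt; omega
  have hZ := hB.le
  have haN := Nat.le_of_dvd hN0 hN
  have hNZ : N ≤ Z := (Nat.le_mul_of_pos_right _ (by positivity)).trans hZ
  -- The levels are traversed from the deepest one outwards: after `k` iterations the inverse
  -- transforms of the `k` innermost levels are done, and the array has been halved `k` times.
  refine Exec.mono (Exec.whileLt_const (levels a) (fun k σ' =>
    Buffer w P Z m₀ (backward (a / 2 ^ (levels a - k)) F) (N * 2 ^ (levels a - k)) σ' ∧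
    σ'.var vTot = N * 2 ^ (levels a - k) ∧ σ'.var vA = a ∧ σ'.var vLev = levels a - k)
    ((a + 2) * ((Z + 1) * 430) + (Z + 1) * 420 + 40)
    ⟨?_, by simpa using htot, ha, hlev⟩ (fun k _ σ' _ => by simp) ?_ ?_) ?_ fun _ h => h
  · have h0 : a / 2 ^ levels a = 0 := by
      rw [← levels_eq_zero, levels_div, Nat.sub_self]
    rw [Nat.sub_zero, h0, backward, if_pos rfl]
    exact hB
  · rintro k hk σ' ⟨hG, htot', ha', hlev'⟩
    obtain ⟨j, hj⟩ : ∃ j, levels a - k = j + 1 := ⟨levels a - k - 1, by omega⟩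
    rw [hj] at hG htot' hlev'
    rw [show levels a - (k + 1) = j by omega]
    refine ⟨by simp [hlev'], ?_⟩
    obtain ⟨b, hbdef⟩ : ∃ b, b = a / 2 ^ j := ⟨_, rfl⟩
    rw [← hbdef]
    have hb0 : b ≠ 0 := fun h => by
      have := levels_div a j
      rw [← hbdef, levels_eq_zero.2 h] at this
      omega
    have hb2 : a / 2 ^ (j + 1) = b / 2 := by
      rw [pow_succ, ← Nat.div_div_eq_div_mul, hbdef]
    rw [hb2] at hG
    have hba : b ≤ a := hbdef ▸ Nat.div_le_self _ _
    have hab : 2 ^ (b + 1) ≤ 2 ^ (a + 1) := Nat.pow_le_pow_right two_pos (by omega)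
    have hdvd : 2 ^ (b + 1) ∣ N * 2 ^ j :=
      ((pow_dvd_pow 2 (by omega)).trans hN).trans (dvd_mul_right _ _)
    have hNk' : N * 2 ^ (j + 1) = 2 * (N * 2 ^ j) := by ring
    have hpos : 0 < N * 2 ^ j := by positivity
    have hGle := hG.le
    have hkN : j < N * 2 ^ j := by
      have : j < 2 ^ j := Nat.lt_two_pow_self
      nlinarith
    rw [hNk'] at hG htot' hGle
    have hsr : 2 ^ (b + 1) = 2 ^ (b - b / 2) * 2 ^ (b / 2 + 1) := by
      rw [← pow_add]; congr 1; omega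
    refine Exec.mono (T := 4 + (4 + (16 + (2 + ((a + 2) * ((Z + 1) * 430) +
      (4 + (Z + 1) * 420)))))) (Exec.assign_seq ?_ (Exec.assign_seq (by simp)
        (exec_setLengths (b := b) ?_ hw (by omega) (Exec.assign_seq ?_ (Exec.seq ?_)))))
      ?_ fun _ h => h
    · simp only [Expr.safe_sub, Expr.safe_ofNat, Expr.safe_var, Expr.val_ofNat, Expr.val_var,
        hlev', true_and]
      omega
    · simp [ha', hlev', Nat.shiftRight_eq_div_pow, hbdef]
    · simp only [Expr.safe_ofNat]
      omega
    · generalize hσ₁ : Store.set _ _ _ = σ₁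
      have hG₁ : Buffer w P Z m₀ (backward (b / 2) F) (2 * (N * 2 ^ j)) σ₁ :=
        hG.congr (by simp [← hσ₁]) (by simp [← hσ₁]) (by rw [← hσ₁]; rfl)
      have ht₁ : σ₁.var vTot = 2 * (N * 2 ^ j) := by simp [← hσ₁, htot']
      have hr₁ : σ₁.var vR = 2 ^ (b / 2 + 1) := by simp [← hσ₁]
      have hs₁ : σ₁.var vS = 2 ^ (b - b / 2) := by simp [← hσ₁]
      have ha₁ : σ₁.var vA = a := by simp [← hσ₁, ha']
      have hl₁ : σ₁.var vL = 1 := by simp [← hσ₁]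
      have hlev₁ : σ₁.var vLev = j := by simp [← hσ₁, hlev']
      clear hσ₁
      refine Exec.mono (exec_ifft (e := b / 2 + 1) (f := b - b / 2) hA hw (by omega) hG₁ ht₁ hr₁ hs₁
        hl₁ ?_ (by omega)) (Nat.mul_le_mul_right _ (by omega)) fun σ₂ h₂ => ?_
      · rw [pow_succ', mul_assoc, ← hsr]
        exact Nat.mul_dvd_mul_left 2 hdvd
      · obtain ⟨hB₂, hv₂⟩ := h₂
        have ht₂ : σ₂.var vTot = 2 * (N * 2 ^ j) := by rw [hv₂ _ (by decide), ht₁]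
        have hval : Expr.val w σ₂ (Expr.var vTot / 2) = N * 2 ^ j := by simp [ht₂]
        refine Exec.assign_seq (by simp; omega) ?_
        rw [hval]
        refine (exec_mapArray_of_cost (F' := unpad (2 ^ (b - b / 2)) (2 ^ (b / 2 + 1))
          (ifft (2 ^ (b / 2 + 1)) (b - b / 2 + 1) (backward (b / 2) F)))
          (by decide)
          (hB₂.congr (σ' := σ₂.set vTot (N * 2 ^ j)) (by simp) (by simp) rfl)
          (by simp; omega) fun i hi m hm => ?_).mono le_rfl fun σ₃ h₃ => ?_
        · simp only [Store.set_var, if_true] at hi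
          exact safe_unpadExpr hA (by simp [hv₂, hr₁]) (by simp [hv₂, hs₁]) hw
            (by simp; have := hB₂.src_lt; omega) (by positivity) (by positivity) (by rwa [← hsr])
            hi hm
        · obtain ⟨hB₃, hv₃⟩ := h₃
          simp only [Store.set_var, if_true] at hB₃
          refine ⟨?_, by simp [hv₃], by simp [hv₃, hv₂, ha₁], by simp [hv₃, hv₂, hlev₁]⟩
          rw [backward, if_neg hb0]
          exact hB₃
    · linarith
  · rintro σ' ⟨hG, -, -, hlev'⟩
    rw [Nat.sub_self] at hlev'
    refine ⟨by simp [hlev'], ?_⟩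
    simpa using hG
  · refine Nat.mul_le_mul_left _ ?_
    simp
    nlinarith

theorem levels_le (a : ℕ) : levels a ≤ a := by
  induction a using Nat.strong_induction_on with
  | _ a ih =>
    rw [levels]
    split_ifs with ha
    · omega
    · have := ih (a / 2) (by omega)
      omega

/-- Each level runs at most about `a` passes of cost proportional to `Z`, and the number of levels
is crudely bounded by `a`; a further logarithmic factor is harmless. -/
theorem exec_mul (hA : ((2 ^ w : ℕ) : A) = 0) (hw : 4 < 2 ^ w) {a : ℕ}
    (hB : Buffer w P Z m₀ F (2 * 2 ^ (a + 1)) σ) (htot : σ.var vTot = 2 * 2 ^ (a + 1))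
    (ha : σ.var vA = a) (hZ : 2 * 2 ^ (a + 1) * 2 ^ levels a ≤ Z) :
    Exec w mulStmt σ ((a + 4) ^ 2 * ((Z + 1) * 1500)) fun σ' =>
      Buffer w P Z m₀ (backward a (base (2 ^ (a + 1) * 2 ^ levels a) (forward a F)))
        (2 ^ (a + 1)) σ' := by
  refine Exec.mono (T := 2 + (2 + ((levels a + 1) * ((a + 4) * ((Z + 1) * 500)) + ((Z + 1) * 430 +
    (levels a + 1) * ((a + 4) * ((Z + 1) * 500)))))) (Exec.assign_seq (by simp)
      (Exec.assign_seq (by simp) (Exec.seq ?_))) ?_ fun _ h => h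
  · refine (exec_forward (a := a) (σ := (σ.set vB _).set vLev _) hA hw
      (hB.congr (by simp) (by simp) rfl) (by simp [htot])
      (by simp [ha]) (by simp) (dvd_mul_left _ _) (by positivity) hZ).frame.mono le_rfl ?_
    rintro σ₁ ⟨⟨hB₁, ht₁, hl₁⟩, hv₁⟩
    have ha₁ : σ₁.var vA = a := by rw [hv₁ _ (by decide)]; simp [ha]
    rw [mul_assoc] at hB₁ ht₁
    refine Exec.seq ((exec_base hA hw hB₁ ht₁
      ((dvd_pow_self 2 (by omega)).trans (dvd_mul_right _ _))).frame.mono le_rfl ?_)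
    rintro σ₂ ⟨⟨hB₂, ht₂, hl₂⟩, hv₂⟩
    exact exec_backward hA hw hB₂ ht₂ (by rw [hv₂ _ (by decide), ha₁]) (by rw [hl₂, hl₁]) dvd_rfl
      (by positivity)
  · have h1 := levels_le a
    have h2 : (levels a + 1) * ((a + 4) * ((Z + 1) * 500)) ≤
        (a + 1) * ((a + 4) * ((Z + 1) * 500)) := Nat.mul_le_mul_right _ (by omega)
    nlinarith

end Nussbaumer

/-! ### Combinatorics of optimal solutions -/

namespace ChangeMaking

open Finset

/-- A coin is sparse if fewer than `m` coins lie in the interval `(y, 2 * y]`. -/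
def Sparse (V : Finset ℕ) (m y : ℕ) : Prop := #{x ∈ V | y < x ∧ x ≤ 2 * y} < m

instance (V : Finset ℕ) (m y : ℕ) : Decidable (Sparse V m y) := by
  unfold Sparse
  infer_instance

/-- Group the sparse coins by their binary logarithm. If `y` is the smallest of a group, the others
are less than `2 * y`, so they are among the fewer than `m` coins in `(y, 2 * y]`. -/
theorem card_sparse_le {V : Finset ℕ} {m K : ℕ} (hV : ∀ y ∈ V, 0 < y ∧ y < 2 ^ K) :
    #{y ∈ V | Sparse V m y} ≤ m * K := by
  have hmaps : image (Nat.log 2) {y ∈ V | Sparse V m y} ⊆ range K := by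
    intro i hi
    obtain ⟨y, hy, rfl⟩ := mem_image.1 hi
    have := hV y (mem_filter.1 hy).1
    exact mem_range.2 (Nat.log_lt_of_lt_pow (by omega) this.2)
  refine (card_le_mul_card_image (f := Nat.log 2) _ m fun i _ => ?_).trans
    (Nat.mul_le_mul_left _ (by simpa using card_le_card hmaps))
  set C := {y ∈ {y ∈ V | Sparse V m y} | Nat.log 2 y = i} with hC
  rcases C.eq_empty_or_nonempty with h0 | hne
  · simp [h0]
  · have hmin := C.min'_mem hne
    set y := C.min' hne with hy
    obtain ⟨⟨hyV, hys⟩, hyi⟩ : (y ∈ V ∧ Sparse V m y) ∧ Nat.log 2 y = i := by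
      simpa [hC] using hmin
    have hsub : C.erase y ⊆ {x ∈ V | y < x ∧ x ≤ 2 * y} := by
      intro x hx
      obtain ⟨hxy, hxC⟩ := mem_erase.1 hx
      obtain ⟨⟨hxV, -⟩, hxi⟩ : (x ∈ V ∧ Sparse V m x) ∧ Nat.log 2 x = i := by
        simpa [hC] using hxC
      have h1 : y ≤ x := C.min'_le x hxC
      have h2 : x < 2 ^ (i + 1) := hxi ▸ Nat.lt_pow_succ_log_self one_lt_two x
      have h3 : 2 ^ i ≤ y := hyi ▸ Nat.pow_log_le_self 2 (hV y hyV).1.ne'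
      rw [pow_succ] at h2
      exact mem_filter.2 ⟨hxV, by omega, by omega⟩
    have := (card_le_card hsub).trans_lt hys
    rw [card_erase_of_mem hmin] at this
    omega

/-- One step of the greedy construction of a hitting set. -/
theorem exists_card_filter_mul_le {y : ℕ} [NeZero y] (A U : Finset (ZMod y)) :
    ∃ h : ZMod y, #{x ∈ U | h - x ∉ A} * y + #U * #A ≤ #U * y := by
  -- Averaging over `h`: each `x ∈ U` satisfies `h - x ∈ A` for exactly `#A` of the `y` residues
  -- `h`, so some `h` serves at least the fraction `#A / y` of `U`.
  by_contra! hcon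
  have h1 : ∑ h : ZMod y, #U * y < ∑ h : ZMod y, (#{x ∈ U | h - x ∉ A} * y + #U * #A) :=
    sum_lt_sum_of_nonempty univ_nonempty fun h _ => hcon h
  have h2 : ∑ h : ZMod y, #{x ∈ U | h - x ∉ A} + #U * #A = #U * y := by
    have h3 : ∑ h : ZMod y, #{x ∈ U | h - x ∈ A} = #U * #A := by
      simp_rw [card_filter]
      rw [sum_comm]
      simp_rw [← card_filter]
      rw [sum_const_nat fun x _ => ?_]
      refine card_bij (fun h _ => h - x) (by simp) (by simp) fun b hb => ⟨b + x, by simpa, by simp⟩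
    rw [← h3, ← sum_add_distrib]
    simp_rw [add_comm (#{x ∈ U | _ - x ∉ A}), card_filter_add_card_filter_not]
    simp [ZMod.card, mul_comm]
  rw [sum_add_distrib, ← sum_mul univ (fun h => #{x ∈ U | h - x ∉ A})] at h1
  simp only [sum_const, card_univ, ZMod.card, smul_eq_mul] at h1
  have h4 := congrArg (· * y) h2
  simp only [add_mul] at h4
  linarith

/-- Greedy hitting set for all the translates of `A`. -/
theorem exists_hitting_set {y m K : ℕ} [NeZero y] (A : Finset (ZMod y)) (hA : #A = m)
    (hy : y ≤ m ^ 2) (hK : y < 2 ^ K) :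
    ∃ H : Finset (ZMod y), #H ≤ m * K ∧ ∀ x, ∃ a ∈ A, x + a ∈ H := by
  -- Every new element of `H` reduces the number of translates not yet hit by the factor `1 - m /
  -- y`; the inequality is multiplied out to stay in `ℕ`.
  have key : ∀ i : ℕ, ∃ H : Finset (ZMod y), #H ≤ i ∧
      #{x : ZMod y | ∀ a ∈ A, x + a ∉ H} * y ^ i ≤ y * (y - m) ^ i := by
    intro i
    induction i with
    | zero =>
      refine ⟨∅, by simp, ?_⟩
      simp [ZMod.card]
    | succ i ih =>
      obtain ⟨H, hH, hle⟩ := ih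
      set U := ({x : ZMod y | ∀ a ∈ A, x + a ∉ H} : Finset (ZMod y)) with hU
      obtain ⟨h, hh⟩ := exists_card_filter_mul_le A U
      refine ⟨insert h H, (card_insert_le _ _).trans (by omega), ?_⟩
      have hsub : ({x : ZMod y | ∀ a ∈ A, x + a ∉ insert h H} : Finset (ZMod y)) ⊆
          {x ∈ U | h - x ∉ A} := by
        intro x hx
        simp only [mem_filter, mem_univ, true_and, mem_insert, not_or, hU] at hx ⊢
        exact ⟨fun a ha => (hx a ha).2, fun ha => (hx _ ha).1 (by simp)⟩
      have h1 : #{x ∈ U | h - x ∉ A} * y ≤ #U * (y - m) := by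
        rw [Nat.mul_sub, ← hA]
        omega
      calc _ ≤ #{x ∈ U | h - x ∉ A} * y ^ (i + 1) := Nat.mul_le_mul_right _ (card_le_card hsub)
        _ = #{x ∈ U | h - x ∉ A} * y * y ^ i := by ring
        _ ≤ #U * (y - m) * y ^ i := Nat.mul_le_mul_right _ h1
        _ = #U * y ^ i * (y - m) := by ring
        _ ≤ y * (y - m) ^ i * (y - m) := Nat.mul_le_mul_right _ hle
        _ = _ := by ring
  obtain ⟨H, hH, hle⟩ := key (m * K)
  refine ⟨H, hH, ?_⟩
  have hy0 : 0 < y := NeZero.pos y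
  have hmy : m ≤ y := by
    have := card_le_univ A
    rwa [ZMod.card, hA] at this
  -- After `m * K` steps fewer than one translate is left: `y * (1 - m / y) ^ (m * K) ≤ y * exp (-(K
  -- * m ^ 2 / y)) ≤ y * exp (-K) < 1`, by `y ≤ m ^ 2` and `y < 2 ^ K`.
  have hlt : y * (y - m) ^ (m * K) < y ^ (m * K) := by
    have hyR : (0 : ℝ) < y := by exact_mod_cast hy0
    have h1 : ((y : ℝ) - m) ≤ y * Real.exp (-(m / y)) := by
      have := Real.one_sub_le_exp_neg ((m : ℝ) / y)
      calc ((y : ℝ) - m) = y * (1 - m / y) := by field_simp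
        _ ≤ _ := by gcongr
    have h2 : (y : ℝ) * ((y : ℝ) - m) ^ (m * K) < (y : ℝ) ^ (m * K) := by
      have h3 : ((y : ℝ) - m) ^ (m * K) ≤ (y : ℝ) ^ (m * K) * Real.exp (-K) := by
        calc ((y : ℝ) - m) ^ (m * K) ≤ (y * Real.exp (-(m / y))) ^ (m * K) :=
              pow_le_pow_left₀ (by simpa using hmy) h1 _
          _ = (y : ℝ) ^ (m * K) * Real.exp ((m * K : ℕ) * (-(m / y))) := by
              rw [mul_pow, Real.exp_nat_mul]
          _ ≤ _ := by
              gcongr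
              have : (1 : ℝ) ≤ m ^ 2 / y := by
                rw [one_le_div hyR]
                exact_mod_cast hy
              have hK0 : (0 : ℝ) ≤ K := Nat.cast_nonneg K
              have e : ((m * K : ℕ) : ℝ) * (-(m / y)) = -(K * (m ^ 2 / y)) := by
                push_cast
                ring
              rw [e]
              nlinarith
      have h4 : (y : ℝ) * Real.exp (-K) < 1 := by
        rw [Real.exp_neg, ← div_eq_mul_inv, div_lt_one (Real.exp_pos _)]
        calc (y : ℝ) < 2 ^ K := by exact_mod_cast hK
          _ ≤ Real.exp 1 ^ K := by
              gcongr
              have := Real.add_one_le_exp (1 : ℝ)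
              linarith
          _ = _ := by rw [← Real.exp_nat_mul, mul_one]
      have h5 : (0 : ℝ) < (y : ℝ) ^ (m * K) := by positivity
      nlinarith
    rw [← Nat.cast_sub hmy] at h2
    exact_mod_cast h2
  have hcard : #{x : ZMod y | ∀ a ∈ A, x + a ∉ H} = 0 := by
    by_contra h0
    have := Nat.le_mul_of_pos_left (y ^ (m * K)) (Nat.pos_of_ne_zero h0)
    omega
  intro x
  by_contra! hx
  have : x ∈ ({x : ZMod y | ∀ a ∈ A, x + a ∉ H} : Finset (ZMod y)) := by simpa using hx
  rw [card_eq_zero.1 hcard] at this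
  simp at this

/-- A collection of many coins in `(y, 2 * y]` contains a short multiset whose sum is a multiple of
`y`. -/
theorem exists_multiset_sum_eq_mul {V : Finset ℕ} {y m K : ℕ} (hy0 : 0 < y) (hns : ¬ Sparse V m y)
    (hy : y ≤ m ^ 2) (hK : y < 2 ^ K) :
    ∃ (b : Multiset ℕ) (k : ℕ), (∀ x ∈ b, x ∈ V) ∧ b.sum = k * y ∧ b.card < k ∧
      k ≤ 2 * (m * K) := by
  have : NeZero y := ⟨hy0.ne'⟩
  obtain ⟨A, hAsub, hAm⟩ := exists_subset_card_eq (not_lt.1 hns)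
  have hmem : ∀ a ∈ A, a ∈ V ∧ y < a ∧ a ≤ 2 * y := fun a ha => mem_filter.1 (hAsub ha)
  -- The half-open interval `(y, 2 * y]` contains every residue modulo `y` exactly once.
  have hinj : Set.InjOn (fun a : ℕ => (a : ZMod y)) A := by
    intro a ha b hb hab
    obtain ⟨-, ha1, ha2⟩ := hmem a ha
    obtain ⟨-, hb1, hb2⟩ := hmem b hb
    have h := (ZMod.natCast_eq_natCast_iff _ _ _).1 hab
    rcases le_total a b with hle | hle
    · obtain ⟨c, hc⟩ := (Nat.modEq_iff_dvd' hle).1 h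
      rcases Nat.eq_zero_or_pos c with rfl | hc0
      · omega
      · have := Nat.le_mul_of_pos_right y hc0
        omega
    · obtain ⟨c, hc⟩ := (Nat.modEq_iff_dvd' hle).1 h.symm
      rcases Nat.eq_zero_or_pos c with rfl | hc0
      · omega
      · have := Nat.le_mul_of_pos_right y hc0
        omega
  obtain ⟨H, hH, hit⟩ := exists_hitting_set (A.image fun a : ℕ => (a : ZMod y))
    ((card_image_of_injOn hinj).trans hAm) hy hK
  have hit' : ∀ x : ZMod y, ∃ a : ℕ, a ∈ A ∧ x + a ∈ H := fun x => by
    obtain ⟨a, ha, h⟩ := hit x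
    obtain ⟨a', ha', rfl⟩ := mem_image.1 ha
    exact ⟨a', ha', h⟩
  choose f hfA hfH using hit'
  -- A walk from `0` whose steps are coins of `A`, each chosen so as to land in `H`.
  set X : ℕ → ZMod y := fun i => (fun x => x + (f x : ZMod y))^[i] 0 with hX
  have hXs : ∀ i, X (i + 1) = X i + f (X i) := fun i => by
    simp only [hX, Function.iterate_succ_apply']
  -- Pigeonhole in `H`. The indices start at `1` because the starting point `X 0 = 0` need not lie
  -- in `H`.
  obtain ⟨i, hi, j, hj, hij, he⟩ : ∃ i ∈ Icc 1 (#H + 1), ∃ j ∈ Icc 1 (#H + 1), i ≠ j ∧ X i = X j := by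
    refine exists_ne_map_eq_of_card_lt_of_maps_to (t := H) (by simp) fun i hi => ?_
    obtain ⟨k, rfl⟩ : ∃ k, i = k + 1 := ⟨i - 1, by have := (mem_Icc.1 hi).1; omega⟩
    rw [hXs]
    exact hfH _
  wlog hlt : i < j generalizing i j
  · exact this j hj i hi hij.symm he.symm (by omega)
  rw [mem_Icc] at hi hj
  have hsum : ((∑ l ∈ Ico i j, f (X l) : ℕ) : ZMod y) = 0 := by
    push_cast
    have : ∀ l, ((f (X l) : ℕ) : ZMod y) = X (l + 1) - X l := fun l => by rw [hXs]; ring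
    simp_rw [this]
    rw [sum_Ico_sub X hlt.le, he, sub_self]
  obtain ⟨k, hk⟩ := (ZMod.natCast_eq_zero_iff _ _).1 hsum
  have hcard : #(Ico i j) = j - i := Nat.card_Ico i j
  -- The `j - i` coins of the closed part of the walk are larger than `y` and at most `2 * y`, which
  -- places `k` strictly above `j - i` and at most at `2 * (j - i)`.
  have h1 : (j - i) * y < y * k := by
    rw [← hk, ← hcard, ← smul_eq_mul, ← sum_const]
    exact sum_lt_sum_of_nonempty (nonempty_Ico.2 hlt) fun l _ => (hmem _ (hfA _)).2.1
  have h2 : y * k ≤ (j - i) * (2 * y) := by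
    rw [← hk, ← hcard, ← smul_eq_mul, ← sum_const]
    exact sum_le_sum fun l _ => (hmem _ (hfA _)).2.2
  refine ⟨(Ico i j).val.map fun l => f (X l), k, ?_, ?_, ?_, ?_⟩
  · intro x hx
    obtain ⟨l, -, rfl⟩ := Multiset.mem_map.1 hx
    exact (hmem _ (hfA _)).1
  · rw [mul_comm]
    exact hk
  · rw [Multiset.card_map, card_val, hcard]
    exact lt_of_mul_lt_mul_left (a := y) (by linarith) (Nat.zero_le _)
  · have : k ≤ 2 * (j - i) := le_of_mul_le_mul_left (a := y) (by linarith) hy0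
    omega

end ChangeMaking

/-! ### Optimal solutions with few non-sparse coins -/

namespace ChangeMaking

open Finset

/-- The multiset `s` of coins from `V` has sum `j`. -/
def Pays (V : Finset ℕ) (s : Multiset ℕ) (j : ℕ) : Prop := (∀ x ∈ s, x ∈ V) ∧ s.sum = j

theorem Pays.zero (V : Finset ℕ) : Pays V 0 0 := ⟨by simp, by simp⟩

theorem Pays.cons {V : Finset ℕ} {s : Multiset ℕ} {j y : ℕ} (h : Pays V s j) (hy : y ∈ V) :
    Pays V (y ::ₘ s) (y + j) := by
  refine ⟨fun x hx => ?_, by simp [h.2]⟩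
  rcases Multiset.mem_cons.1 hx with rfl | hx
  · exact hy
  · exact h.1 x hx

theorem Pays.card_le {V : Finset ℕ} (hV : ∀ y ∈ V, 0 < y) {s : Multiset ℕ} {j : ℕ}
    (h : Pays V s j) : s.card ≤ j := by
  rw [← h.2]
  have := Multiset.card_nsmul_le_sum (s := s) (a := 1) fun x hx => hV x (h.1 x hx)
  simpa using this

/-- Every solution can be replaced by one that is no larger and has few non-sparse coins. -/
theorem exists_pays_card_filter_le {V : Finset ℕ} {t m K j : ℕ} (hV : ∀ y ∈ V, 0 < y)
    (ht : t < m ^ 3) (hK : t + 1 < 2 ^ K) (hj : j ≤ t) {s₀ : Multiset ℕ} (hs₀ : Pays V s₀ j) :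
    ∃ s, Pays V s j ∧ s.card ≤ s₀.card ∧
      (s.filter fun y => ¬ Sparse V m y).card ≤ 2 * (m * K) * K := by
  -- Ties between solutions of the same size are broken by the sum of `2 ^ x`, because this weight
  -- takes different values on different sets of coins.
  obtain ⟨s, hs, hmin⟩ := WellFounded.has_min (InvImage.wf
    (fun s : Multiset ℕ => toLex (s.card, (s.map (2 ^ ·)).sum)) wellFounded_lt)
    {s | Pays V s j} ⟨s₀, hs₀⟩
  replace hmin : ∀ s', Pays V s' j → s.card ≤ s'.card ∧
      (s'.card = s.card → (s.map (2 ^ ·)).sum ≤ (s'.map (2 ^ ·)).sum) := by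
    intro s' hs'
    have h := hmin s' hs'
    rw [InvImage, Prod.Lex.toLex_lt_toLex, not_or, not_and] at h
    exact ⟨not_lt.1 h.1, fun he => not_lt.1 (h.2 he)⟩
  have hexch : ∀ A B : Multiset ℕ, B ≤ s → A.sum = B.sum → (∀ x ∈ A, x ∈ V) →
      B.card ≤ A.card ∧ (A.card = B.card → (B.map (2 ^ ·)).sum ≤ (A.map (2 ^ ·)).sum) := by
    intro A B hB hsum hA
    obtain ⟨C, rfl⟩ := Multiset.le_iff_exists_add.1 hB
    have h := hmin (A + C) ⟨fun x hx => ?_, ?_⟩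
    · simp only [Multiset.card_add, Multiset.map_add, Multiset.sum_add] at h
      exact ⟨by omega, fun he => by have := h.2 (by omega); omega⟩
    · rcases Multiset.mem_add.1 hx with hx | hx
      · exact hA x hx
      · exact hs.1 x (Multiset.mem_add.2 (.inr hx))
    · rw [← hs.2, Multiset.sum_add, Multiset.sum_add, hsum]
  have hle : ∀ A ∈ s.toFinset.powerset, A.val ≤ s := fun A hA =>
    (Multiset.le_iff_subset A.nodup).2 fun x hx =>
      Multiset.mem_toFinset.1 (mem_powerset.1 hA hx)
  -- All subsets of the support have sums in `0, …, t`, and with `K` or more coins there are at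
  -- least `2 ^ K > t + 1` subsets. Two of them share their sum, and exchanging them in both
  -- directions shows equal size and equal weight, so they coincide.
  have hsupp : #s.toFinset ≤ K := by
    by_contra! hlt
    obtain ⟨A, hA, B, hB, hne, he⟩ := exists_ne_map_eq_of_card_lt_of_maps_to
      (s := s.toFinset.powerset) (t := range (t + 1)) (f := fun A => A.val.sum) (by
        rw [card_powerset, card_range]
        exact hK.trans_le (Nat.pow_le_pow_right two_pos hlt.le)) (fun A hA => by
        obtain ⟨C, hC⟩ := Multiset.le_iff_exists_add.1 (hle A hA)
        have := congrArg Multiset.sum hC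
        rw [Multiset.sum_add, hs.2] at this
        exact mem_coe.2 (mem_range.2 (by simp only; omega)))
    have h1 := hexch A.val B.val (hle B hB) he fun x hx => hs.1 x (Multiset.mem_of_le (hle A hA) hx)
    have h2 := hexch B.val A.val (hle A hA) he.symm fun x hx =>
      hs.1 x (Multiset.mem_of_le (hle B hB) hx)
    have h3 : A.card = B.card := le_antisymm h2.1 h1.1
    exact hne (geomSum_injective le_rfl (le_antisymm (h2.2 h3.symm) (h1.2 h3)))
  have hmult : ∀ y ∈ s, ¬ Sparse V m y → s.count y ≤ 2 * (m * K) := by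
    intro y hy hns
    by_contra! hlt
    have hyV := hs.1 y hy
    have hrep : ∀ k ≤ s.count y, Multiset.replicate k y ≤ s := fun k hk =>
      Multiset.le_count_iff_replicate_le.1 hk
    have hsum : ∀ k ≤ s.count y, k * y ≤ t := fun k hk => by
      obtain ⟨C, hC⟩ := Multiset.le_iff_exists_add.1 (hrep k hk)
      have := congrArg Multiset.sum hC
      rw [Multiset.sum_add, hs.2, Multiset.sum_replicate, smul_eq_mul] at this
      omega
    have hy0 := hV y hyV
    have hyt : y ≤ t := by simpa using hsum 1 (Multiset.one_le_count_iff_mem.2 hy)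
    -- A small coin occurring too often would allow `k` of its copies to be replaced by fewer coins;
    -- for a large one, `m` copies already exceed `t`.
    rcases le_or_gt y (m ^ 2) with hym | hym
    · obtain ⟨b, k, hbV, hbs, hbk, hk⟩ := exists_multiset_sum_eq_mul hy0 hns hym
        (show y < 2 ^ K by omega)
      have := (hexch b (Multiset.replicate k y) (hrep k (by omega))
        (by rw [hbs, Multiset.sum_replicate, smul_eq_mul]) hbV).1
      rw [Multiset.card_replicate] at this
      omega
    · have hK0 : 0 < K := by
        rcases Nat.eq_zero_or_pos K with rfl | h
        · omega
        · exact h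
      have h1 := hsum m (by nlinarith)
      have : m ^ 3 ≤ m * y := by
        rw [pow_succ']
        exact Nat.mul_le_mul_left _ hym.le
      omega
  refine ⟨s, hs, (hmin s₀ hs₀).1, ?_⟩
  rw [← Multiset.toFinset_sum_count_eq]
  refine (sum_le_card_nsmul _ _ (2 * (m * K)) fun y hy => ?_).trans ?_
  · obtain ⟨hys, hns⟩ := Multiset.mem_filter.1 (Multiset.mem_toFinset.1 hy)
    exact (Multiset.count_le_of_le _ (Multiset.filter_le _ _)).trans (hmult y hys hns)
  · rw [smul_eq_mul, mul_comm]
    refine Nat.mul_le_mul_left _ ((card_le_card ?_).trans hsupp)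
    exact Multiset.toFinset_subset.2 (Multiset.filter_subset _ _)

/-! ### Optimal values, bounded solutions and the dynamic program -/

open Classical in
/-- The minimal number of coins from `V` with sum `j`, plus one; zero if there is no solution. -/
noncomputable def opt (V : Finset ℕ) (j : ℕ) : ℕ :=
  if h : ∃ d s, Pays V s j ∧ s.card = d then Nat.find h + 1 else 0

theorem Pays.opt_pos {V : Finset ℕ} {s : Multiset ℕ} {j : ℕ} (h : Pays V s j) : 0 < opt V j := by
  rw [opt, dif_pos ⟨_, s, h, rfl⟩]
  omega

theorem Pays.opt_le {V : Finset ℕ} {s : Multiset ℕ} {j : ℕ} (h : Pays V s j) :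
    opt V j ≤ s.card + 1 := by
  classical
  rw [opt, dif_pos ⟨_, s, h, rfl⟩]
  exact Nat.succ_le_succ (Nat.find_min' _ ⟨s, h, rfl⟩)

theorem exists_pays {V : Finset ℕ} {j : ℕ} (h : 0 < opt V j) :
    ∃ s, Pays V s j ∧ s.card + 1 = opt V j := by
  classical
  rw [opt] at h ⊢
  split_ifs at h ⊢ with hex
  · obtain ⟨s, hs, he⟩ := Nat.find_spec hex
    exact ⟨s, hs, by omega⟩
  · omega

/-- The solutions with at most `k` coins. -/
noncomputable def trunc (V : Finset ℕ) (k j : ℕ) : ℕ := if opt V j ≤ k + 1 then opt V j else 0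

theorem trunc_zero (V : Finset ℕ) (j : ℕ) : trunc V 0 j = if j = 0 then 1 else 0 := by
  rw [trunc]
  split_ifs with h1 h2 h2
  · subst h2
    have := (Pays.zero V).opt_pos
    omega
  · by_contra h0
    obtain ⟨s, hs, he⟩ := exists_pays (Nat.pos_of_ne_zero h0)
    have : s = 0 := Multiset.card_eq_zero.1 (by omega)
    exact h2 (by rw [← hs.2, this, Multiset.sum_zero])
  · subst h2
    exact absurd (Pays.zero V).opt_le h1
  · rfl

-- A target that is payable with `k + 1` coins but not with `k` needs exactly `k + 1`, and its
-- encoding is `k + 2`. So only payability must be propagated: no minimum over the last coin is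
-- taken, and a Boolean convolution does the round.
open Classical in
theorem trunc_succ (V : Finset ℕ) (k j : ℕ) : trunc V (k + 1) j =
    if 0 < trunc V k j then trunc V k j
    else if ∃ x ∈ antidiagonal j, 0 < trunc V k x.1 ∧ x.2 ∈ V then k + 2 else 0 := by
  have hpos : 0 < trunc V k j ↔ 0 < opt V j ∧ opt V j ≤ k + 1 := by
    rw [trunc]
    split_ifs with h <;> simp [h]
  split_ifs with h1 h2
  · have := hpos.1 h1
    rw [trunc, trunc, if_pos (by omega), if_pos (by omega)]
  · obtain ⟨x, hx, hx1, hx2⟩ := h2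
    rw [HasAntidiagonal.mem_antidiagonal] at hx
    obtain ⟨s, hs, he⟩ := exists_pays (V := V) (j := x.1) (by
      rw [trunc] at hx1
      split_ifs at hx1
      · exact hx1
      · omega)
    have hle : opt V x.1 ≤ k + 1 := by
      by_contra hc
      rw [trunc, if_neg hc] at hx1
      omega
    have h3 := hs.cons hx2
    rw [add_comm, hx] at h3
    have h4 := h3.opt_pos
    have h5 := h3.opt_le
    rw [Multiset.card_cons] at h5
    have : ¬ opt V j ≤ k + 1 := fun h => h1 (hpos.2 ⟨h4, h⟩)
    rw [trunc, if_pos (by omega)]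
    omega
  · rw [trunc]
    split_ifs with h3
    swap
    · rfl
    by_contra h0
    obtain ⟨s, hs, he⟩ := exists_pays (Nat.pos_of_ne_zero h0)
    have h4 : ¬ opt V j ≤ k + 1 := fun h => h1 (hpos.2 ⟨by omega, h⟩)
    obtain ⟨y, hy⟩ := Multiset.card_pos_iff_exists_mem.1 (show 0 < s.card by omega)
    obtain ⟨s', rfl⟩ := Multiset.exists_cons_of_mem hy
    have hs' : Pays V s' s'.sum := ⟨fun x hx => hs.1 x (Multiset.mem_cons_of_mem hx), rfl⟩
    have hsum := hs.2
    rw [Multiset.sum_cons] at hsum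
    rw [Multiset.card_cons] at he
    have h5 := hs'.opt_le
    refine h2 ⟨(s'.sum, y), by rw [HasAntidiagonal.mem_antidiagonal]; simpa [add_comm] using hsum, ?_, hs.1 y hy⟩
    rw [trunc, if_pos (by simp only; omega)]
    exact hs'.opt_pos

/-- One pass of the textbook dynamic program: use the coin `y` arbitrarily often. -/
def relax (y : ℕ) (D : ℕ → ℕ) (j : ℕ) : ℕ :=
  if h : 0 < y ∧ y ≤ j then
    if 0 < relax y D (j - y) then
      if 0 < D j then min (relax y D (j - y) + 1) (D j) else relax y D (j - y) + 1
    else D j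
  else D j
termination_by j

/-- All the entries of `D` are realized by solutions. -/
def Sound (V : Finset ℕ) (t : ℕ) (D : ℕ → ℕ) : Prop :=
  ∀ j ≤ t, 0 < D j → ∃ s, Pays V s j ∧ s.card + 1 = D j

/-- `D` is at least as good as all the solutions that consist of at most `L` coins and arbitrarily
many coins from `W`. -/
def Covers (V : Finset ℕ) (L t : ℕ) (W : Finset ℕ) (D : ℕ → ℕ) : Prop :=
  ∀ j ≤ t, ∀ s s' : Multiset ℕ, (∀ x ∈ s, x ∈ V) → s.card ≤ L → (∀ x ∈ s', x ∈ W) →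
    s.sum + s'.sum = j → 0 < D j ∧ D j ≤ s.card + s'.card + 1

theorem Sound.le {V : Finset ℕ} (hV : ∀ y ∈ V, 0 < y) {t : ℕ} {D : ℕ → ℕ} (h : Sound V t D) {j : ℕ}
    (hj : j ≤ t) : D j ≤ j + 1 := by
  rcases Nat.eq_zero_or_pos (D j) with h0 | h0
  · omega
  · obtain ⟨s, hs, he⟩ := h j hj h0
    have := hs.card_le hV
    omega

theorem Sound.relax {V : Finset ℕ} {t y : ℕ} {D : ℕ → ℕ} (h : Sound V t D) (hy : y ∈ V) :
    Sound V t (relax y D) := by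
  intro j
  induction j using Nat.strong_induction_on with
  | _ j ih =>
    intro hj h0
    rw [ChangeMaking.relax] at h0 ⊢
    split_ifs at h0 ⊢ with h1 h2 h3
    · rcases min_choice (ChangeMaking.relax y D (j - y) + 1) (D j) with hm | hm
      · obtain ⟨s, hs, he⟩ := ih (j - y) (by omega) (by omega) h2
        refine ⟨y ::ₘ s, ?_, by rw [hm, Multiset.card_cons, he]⟩
        have := hs.cons hy
        rwa [Nat.add_sub_cancel' h1.2] at this
      · rw [hm]
        exact h j hj h3
    · obtain ⟨s, hs, he⟩ := ih (j - y) (by omega) (by omega) h2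
      refine ⟨y ::ₘ s, ?_, by rw [Multiset.card_cons, he]⟩
      have := hs.cons hy
      rwa [Nat.add_sub_cancel' h1.2] at this
    · exact h j hj h0
    · exact h j hj h0

theorem relax_le_of_pos {y : ℕ} {D : ℕ → ℕ} {j : ℕ} (h : 0 < D j) :
    0 < relax y D j ∧ relax y D j ≤ D j := by
  rw [relax]
  split_ifs
  · exact ⟨by simp; omega, min_le_right _ _⟩
  · exact ⟨h, le_rfl⟩
  · exact ⟨h, le_rfl⟩

/-- If `y` occurs in `s'`, remove one copy and use the already improved entry at `j - y`; this is
what permits arbitrarily many copies. Otherwise `s'` uses only coins of `W`. -/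
theorem Covers.relax {V W : Finset ℕ} {L t y : ℕ} {D : ℕ → ℕ} (h : Covers V L t W D) (hy : 0 < y) :
    Covers V L t (insert y W) (relax y D) := by
  intro j
  induction j using Nat.strong_induction_on with
  | _ j ih =>
    intro hj s s' hs hL hs' hsum
    by_cases hmem : y ∈ s'
    · obtain ⟨u, rfl⟩ := Multiset.exists_cons_of_mem hmem
      rw [Multiset.sum_cons] at hsum
      obtain ⟨h1, h2⟩ := ih (j - y) (by omega) (by omega) s u hs hL
        (fun x hx => hs' x (Multiset.mem_cons_of_mem hx)) (by omega)
      rw [Multiset.card_cons]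
      rw [ChangeMaking.relax, dif_pos ⟨hy, by omega⟩, if_pos h1]
      split_ifs with h3
      · have := min_le_left (ChangeMaking.relax y D (j - y) + 1) (D j)
        exact ⟨by simp; omega, by omega⟩
      · omega
    · obtain ⟨h1, h2⟩ := h j hj s s' hs hL (fun x hx => by
        rcases mem_insert.1 (hs' x hx) with rfl | hx'
        · exact absurd hx hmem
        · exact hx') hsum
      have := relax_le_of_pos (y := y) h1
      exact ⟨this.1, this.2.trans h2⟩

theorem sound_trunc (V : Finset ℕ) (k t : ℕ) : Sound V t (trunc V k) := by
  intro j _ h0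
  rw [trunc] at h0 ⊢
  split_ifs at h0 ⊢ with h
  · exact exists_pays h0
  · omega

theorem covers_trunc (V : Finset ℕ) (k t : ℕ) : Covers V k t ∅ (trunc V k) := by
  intro j _ s s' hs hk hs' hsum
  obtain rfl : s' = 0 := Multiset.eq_zero_of_forall_notMem fun x hx => by simpa using hs' x hx
  have hp : Pays V s j := ⟨hs, by simpa using hsum⟩
  have := hp.opt_le
  rw [trunc, if_pos (by omega)]
  exact ⟨hp.opt_pos, by simpa using this⟩

/-- Soundness bounds the entry from below. For the upper bound, take an optimal solution with few
non-sparse coins: these are the at most `2 * (m * K) * K` free coins in `Covers`, and the rest of it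
is sparse and hence comes from `W`. -/
theorem eq_opt {V W : Finset ℕ} {t m K j : ℕ} {D : ℕ → ℕ} (hV : ∀ y ∈ V, 0 < y) (ht : t < m ^ 3)
    (hK : t + 1 < 2 ^ K) (hj : j ≤ t) (hW : ∀ y ∈ V, Sparse V m y → y ∈ W) (hs : Sound V t D)
    (hc : Covers V (2 * (m * K) * K) t W D) : D j = opt V j := by
  rcases Nat.eq_zero_or_pos (opt V j) with h0 | h0
  · by_contra hne
    obtain ⟨s, hs, -⟩ := hs j hj (by omega)
    have := hs.opt_pos
    omega
  · obtain ⟨s₀, hs₀, he⟩ := exists_pays h0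
    obtain ⟨s, hps, hle, hL⟩ := exists_pays_card_filter_le hV ht hK hj hs₀
    have hsplit := Multiset.filter_add_not (fun y => ¬ Sparse V m y) s
    have h1 := congrArg Multiset.sum hsplit
    have h2 := congrArg Multiset.card hsplit
    rw [Multiset.sum_add, hps.2] at h1
    rw [Multiset.card_add] at h2
    obtain ⟨h3, h4⟩ := hc j hj _ _ (fun x hx => hps.1 x (Multiset.mem_of_mem_filter hx)) hL
      (fun x hx => by
        obtain ⟨hx, hsp⟩ := Multiset.mem_filter.1 hx
        exact hW x (hps.1 x hx) (not_not.1 hsp)) h1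
    obtain ⟨s', hs', he'⟩ := hs j hj h3
    have := hs'.opt_le
    omega

/-! ### From multisets of coins to the multiplicities in the problem -/

theorem exists_coeff {n : ℕ} (v : Fin n → ℕ) (s : Multiset ℕ) (hs : ∀ x ∈ s, ∃ i, v i = x) :
    ∃ m : Fin n → ℕ, ∑ i, m i * v i = s.sum ∧ ∑ i, m i = s.card := by
  induction s using Multiset.induction with
  | empty => exact ⟨0, by simp, by simp⟩
  | cons a s ih =>
    obtain ⟨m, h1, h2⟩ := ih fun x hx => hs x (Multiset.mem_cons_of_mem hx)
    obtain ⟨i, rfl⟩ := hs a (Multiset.mem_cons_self _ _)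
    refine ⟨m + Pi.single i 1, ?_, ?_⟩
    · simp [add_mul, sum_add_distrib, h1, Pi.single_apply, add_comm]
    · simp [sum_add_distrib, h2]

/-- A coin that is used at all is at most `j ≤ t`, so the coins above `t` can be dropped. The shift
by one in `opt` agrees with the encoding of `∞` by `0`. -/
theorem encode_minCoins {n t j : ℕ} (v : Fin n → ℕ) (hj : j ≤ t) :
    encode (minCoins v j) = opt {x ∈ univ.image v | x ≤ t} j := by
  set V := {x ∈ univ.image v | x ≤ t} with hVdef
  have hto : ∀ m : Fin n → ℕ, ∑ i, m i * v i = j → ∃ s, Pays V s j ∧ s.card = ∑ i, m i := by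
    intro m hm
    refine ⟨∑ i, Multiset.replicate (m i) (v i), ⟨fun x hx => ?_, ?_⟩, ?_⟩
    · obtain ⟨i, -, hi⟩ := Multiset.mem_sum.1 hx
      obtain ⟨h0, rfl⟩ := Multiset.mem_replicate.1 hi
      refine mem_filter.2 ⟨mem_image_of_mem _ (mem_univ _), ?_⟩
      have h1 : m i * v i ≤ j := hm ▸ single_le_sum (f := fun i => m i * v i) (by simp) (mem_univ i)
      have := Nat.le_mul_of_pos_left (v i) (Nat.pos_of_ne_zero h0)
      omega
    · rw [← hm, ← Multiset.coe_sumAddMonoidHom, map_sum]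
      simp
    · simp
  have hfrom : ∀ s, Pays V s j → ∃ m : Fin n → ℕ, ∑ i, m i * v i = j ∧ ∑ i, m i = s.card := by
    intro s hs
    rw [← hs.2]
    refine exists_coeff v s fun x hx => ?_
    obtain ⟨i, -, hi⟩ := mem_image.1 (mem_filter.1 (hs.1 x hx)).1
    exact ⟨i, hi⟩
  rcases Nat.eq_zero_or_pos (opt V j) with h0 | h0
  · have : minCoins v j = ⊤ := by
      rw [minCoins]
      refine iInf₂_eq_top.2 fun m hm => ?_
      obtain ⟨s, hs, -⟩ := hto m hm
      have := hs.opt_pos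
      omega
    rw [h0, encode, if_pos this]
  · obtain ⟨s, hs, he⟩ := exists_pays h0
    have : minCoins v j = (s.card : ℕ∞) := by
      refine le_antisymm ?_ (le_iInf₂ fun m hm => ?_)
      · obtain ⟨m, hm, hc⟩ := hfrom s hs
        rw [← hc]
        exact iInf₂_le m hm
      · obtain ⟨s', hs', hc⟩ := hto m hm
        have := hs'.opt_le
        rw [← hc]
        exact_mod_cast (by omega : s.card ≤ s'.card)
    rw [encode, this, if_neg (ENat.natCast_ne_top _), ENat.toNat_natCast, he]

end ChangeMaking

/-! ### The program -/

namespace ChangeMaking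

open Finset WordRAM Nussbaumer

/-- The number of coins; also the address of the table of the numbers of coins. -/
notation "vNum" => 0
/-- The largest target. -/
notation "vMax" => 1
/-- The number of targets. -/
notation "vLen" => 13
/-- The address of the indicator function of the set of coins. -/
notation "vCoins" => 15
/-- The address of the counting function of the set of coins. -/
notation "vCum" => 16
/-- The address of the work space. -/
notation "vWork" => 17
/-- The density threshold. -/
notation "vDens" => 18
/-- The length of the convolutions. -/
notation "vPow" => 19
/-- The binary logarithm of the length of the convolutions. -/
notation "vLog" => 20
/-- The size of each half of the work space. -/
notation "vRoom" => 21
/-- The current round. -/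
notation "vRound" => 22
/-- The number of rounds. -/
notation "vRounds" => 23
/-- The current coin. -/
notation "vCoin" => 24
/-- The current target. -/
notation "vTarget" => 26
/-- The address of the output. -/
notation "vOut" => 27

/-- The values of the variables that are computed once and for all. -/
structure Regs (n t m K : ℕ) (σ : Store) : Prop where
  num : σ.var vNum = n
  max : σ.var vMax = t
  len : σ.var vLen = t + 1
  coins : σ.var vCoins = n + (t + 1)
  cum : σ.var vCum = n + 2 * (t + 1)
  work : σ.var vWork = n + 3 * (t + 1)
  dens : σ.var vDens = m
  pow : σ.var vPow = 2 ^ K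
  log : σ.var vLog = K
  room : σ.var vRoom = 4 * 2 ^ K * K
  rounds : σ.var vRounds = 2 * (m * K) * K

theorem Regs.congr {n t m K : ℕ} {σ σ' : Store} (h : Regs n t m K σ)
    (he : ∀ x ∈ [0, 1, 13, 15, 16, 17, 18, 19, 20, 21, 23], σ'.var x = σ.var x) :
    Regs n t m K σ' := by
  obtain ⟨h1, h2, h3, h4, h5, h6, h7, h8, h9, h10, h11⟩ := h
  simp only [List.forall_mem_cons, List.not_mem_nil, IsEmpty.forall_iff, implies_true,
    and_true] at he
  constructor <;> simp_all

/-- The word size suffices for all the numbers that occur. -/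
structure Fits (n t w m K : ℕ) : Prop where
  four : 4 < 2 ^ w
  pow : 2 * (t + 1) ≤ 2 ^ K
  mem : n + 3 * (t + 1) + 2 * (4 * 2 ^ K * K) < 2 ^ w
  prod : 2 ^ K * (2 ^ K * (2 * K)) < 2 ^ w
  rounds : 2 * (m * K) * K + 2 < 2 ^ w
  cube : m * m * m < 2 ^ w
  dens : m + (t + 1) < 2 ^ w

/-- The table `D` of the numbers of coins and the set `V` of coins are in memory. -/
structure Arrays (n t : ℕ) (V : Finset ℕ) (D : ℕ → ℕ) (mem : ℕ → ℕ) : Prop where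
  table : ∀ j < t + 1, mem (n + j) = D j
  coins : ∀ j < t + 1, mem (n + (t + 1) + j) = if j ∈ V then 1 else 0

theorem Arrays.congr {n t : ℕ} {V : Finset ℕ} {D : ℕ → ℕ} {mem mem' : ℕ → ℕ}
    (h : Arrays n t V D mem) (he : ∀ a < n + 2 * (t + 1), mem' a = mem a) :
    Arrays n t V D mem' :=
  ⟨fun j hj => by rw [he _ (by omega), h.table j hj],
    fun j hj => by rw [he _ (by omega), h.coins j hj]⟩

/-- The entries of the two arrays which are convolved. -/
def pairExpr : Expr :=
  .iteLt (.var vI) (.var vPow)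
    (.iteLt (.var vI) (.var vLen) (.iteLt 0 (.load (.var vNum + .var vI)) 1 0) 0)
    (.iteLt (.var vI - .var vPow) (.var vLen) (.load (.var vCoins + (.var vI - .var vPow))) 0)

/-- The new entries of the table of the numbers of coins. -/
def updateExpr : Expr :=
  .iteLt 0 (.load (.var vNum + .var vTarget)) (.load (.var vNum + .var vTarget))
    (.iteLt 0 (.load (.var vSrc + .var vTarget)) (.var vRound + 2) 0)

/-- One round: find the targets that need one more coin than those found so far. -/
def roundStmt : Stmt :=
  vSrc ≔ .var vWork ;; vDst ≔ .var vWork + .var vRoom ;; vTot ≔ 2 * .var vPow ;;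
  vA ≔ .var vLog - 1 ;; .fill vI vSrc vTot pairExpr ;; mulStmt ;;
  .fill vTarget vNum vLen updateExpr

/-- The two arrays which are convolved. -/
def pairFun (t K : ℕ) (V : Finset ℕ) (D : ℕ → ℕ) (i : ℕ) : ℕ :=
  if i < 2 ^ K then if i < t + 1 then if 0 < D i then 1 else 0 else 0
  else if i - 2 ^ K < t + 1 then if i - 2 ^ K ∈ V then 1 else 0 else 0

theorem pairFun_le_one (t K : ℕ) (V : Finset ℕ) (D : ℕ → ℕ) (i : ℕ) : pairFun t K V D i ≤ 1 := by
  unfold pairFun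
  split_ifs <;> omega

theorem sum_pairFun_pos {t K j : ℕ} {V : Finset ℕ} {D : ℕ → ℕ} (hj : j < t + 1)
    (hK : t + 1 ≤ 2 ^ K) :
    0 < ∑ x ∈ antidiagonal j, pairFun t K V D x.1 * pairFun t K V D (2 ^ K + x.2) ↔
      ∃ x ∈ antidiagonal j, 0 < D x.1 ∧ x.2 ∈ V := by
  rw [Finset.sum_pos_iff]
  refine exists_congr fun x => and_congr_right fun hx => ?_
  rw [HasAntidiagonal.mem_antidiagonal] at hx
  have h1 : pairFun t K V D x.1 = if 0 < D x.1 then 1 else 0 := by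
    rw [pairFun, if_pos (by omega), if_pos (by omega)]
  have h2 : pairFun t K V D (2 ^ K + x.2) = if x.2 ∈ V then 1 else 0 := by
    rw [pairFun, if_neg (by omega), Nat.add_sub_cancel_left, if_pos (by omega)]
  rw [h1, h2]
  split_ifs with h3 h4 <;> simp_all

theorem sum_pairFun_le (t K j : ℕ) (V : Finset ℕ) (D : ℕ → ℕ) :
    ∑ x ∈ antidiagonal j, pairFun t K V D x.1 * pairFun t K V D (2 ^ K + x.2) ≤ j + 1 := by
  refine (sum_le_card_nsmul _ _ 1 fun x _ => ?_).trans (by simp)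
  exact (Nat.mul_le_mul (pairFun_le_one ..) (pairFun_le_one ..)).trans le_rfl

section

variable {n t w m K k : ℕ} {V : Finset ℕ} {D : ℕ → ℕ} {σ : Store}

theorem Fits.one_le (hF : Fits n t w m K) : 1 ≤ K := by
  have := hF.pow
  rcases Nat.eq_zero_or_pos K with rfl | h
  · omega
  · exact h

/-- With `K = a + 1`, each half of the work space can hold both blocks even after all the paddings.
-/
theorem le_room (a : ℕ) :
    2 * 2 ^ (a + 1) * 2 ^ levels a ≤ 4 * 2 ^ (a + 1) * (a + 1) := by
  have h2 := two_pow_levels_le a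
  calc 2 * 2 ^ (a + 1) * 2 ^ levels a ≤ 2 * 2 ^ (a + 1) * (2 * (a + 1)) :=
        Nat.mul_le_mul_left _ (by omega)
    _ = _ := by ring

/-- The value computed by the convolution. -/
theorem Fits.conv_pos_iff {a : ℕ} {h : ℕ → ℕ} (hF : Fits n t w m (a + 1))
    (hh : ∀ j < 2 ^ (a + 1), Word w (h j) (backward a (base (2 ^ (a + 1) * 2 ^ levels a)
      (forward a fun i => (pairFun t (a + 1) V D i : NegRing w (2 ^ (a + 1))))) j))
    {j : ℕ} (hj : j < t + 1) :
    0 < h j ↔ ∃ x ∈ antidiagonal j, 0 < D x.1 ∧ x.2 ∈ V := by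
  have hpow := hF.pow
  have h2 : 2 ^ (a + 1) = 2 ^ a + 2 ^ a := by ring
  have h4 := hF.four
  -- The convolution is known up to the positive factor `2 ^ scale a`, which does not affect
  -- positivity. The condition `2 * (t + 1) ≤ 2 ^ K` makes both arrays vanish on their upper halves.
  have key := eq_of_backward (f := pairFun t (a + 1) V D) (fun j hj => (hh j hj).1)
    (fun i hi => ⟨?_, ?_⟩) (fun i hi => ?_) ?_ (fun j hj => (hh j hj).2) j (by omega)
  · rw [key, ← sum_pairFun_pos hj (by omega : t + 1 ≤ 2 ^ (a + 1)),
      mul_pos_iff_of_pos_left (by positivity)]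
  · rw [pairFun, if_pos (by omega), if_neg (by omega)]
  · rw [pairFun, if_neg (by omega), if_neg (by omega)]
  · refine lt_of_le_of_lt ?_ hF.prod
    rw [scale_eq, pow_add, mul_comm]
    refine Nat.mul_le_mul ((sum_pairFun_le _ _ _ _ _).trans (by omega)) (Nat.mul_le_mul ?_ ?_)
    · omega
    · have := two_pow_levels_le a
      omega
  · rintro rfl
    omega

-- The `0`-`1` arrays of the payable targets and of the coins are convolved. A positive coefficient
-- at `j` means that one more coin reaches `j`, and entries found in earlier rounds are kept because
-- they are smaller.
open Classical in
theorem exec_round (hF : Fits n t w m K) (hR : Regs n t m K σ) (hD : Arrays n t V D σ.mem)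
    (hk : σ.var vRound = k) (hkw : k + 2 < 2 ^ w) :
    Exec w roundStmt σ ((K + 3) ^ 2 * ((4 * 2 ^ K * K + 1) * 1600)) fun σ' =>
      Arrays n t V (fun j => if 0 < D j then D j
        else if ∃ x ∈ antidiagonal j, 0 < D x.1 ∧ x.2 ∈ V then k + 2 else 0) σ'.mem ∧
      ∀ x ∉ roundStmt.writes, σ'.var x = σ.var x := by
  refine Exec.frame ?_
  have h4 := hF.four
  have hpow := hF.pow
  have hmem := hF.mem
  obtain ⟨a, rfl⟩ : ∃ a, K = a + 1 := ⟨K - 1, by have := hF.one_le; omega⟩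
  have hroom := le_room a
  set Z := 4 * 2 ^ (a + 1) * (a + 1) with hZ
  have hZ' : 4 * 2 ^ (a + 1) ≤ Z := Nat.le_mul_of_pos_right _ (by omega)
  set c₁ := (2 * 2 ^ (a + 1) + 1) * (pairExpr.cost + 12) + 2 with hc₁
  set c₂ := (a + 4) ^ 2 * ((Z + 1) * 1500) with hc₂
  set c₃ := (t + 1 + 1) * (updateExpr.cost + 12) + 2 with hc₃
  refine Exec.mono (T := 2 + (4 + (4 + (4 + (c₁ + (c₂ + c₃))))))
    (Exec.assign_seq (by simp) (Exec.assign_seq ?_ (Exec.assign_seq ?_ (Exec.assign_seq ?_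
      (Exec.seq ?_))))) ?_ fun _ h => h
  · simp only [Expr.safe_add, Expr.safe_var, Expr.val_var, Store.set_var, Nat.reduceEqDiff,
      if_false, hR.work, hR.room, true_and]
    omega
  · simp only [Expr.safe_mul, Expr.safe_ofNat, Expr.safe_var, Expr.val_ofNat, Expr.val_var,
      Store.set_var, Nat.reduceEqDiff, if_false, hR.pow, true_and]
    omega
  · simp only [Expr.safe_sub, Expr.safe_ofNat, Expr.safe_var, Expr.val_ofNat, Expr.val_var,
      Store.set_var, Nat.reduceEqDiff, if_false, hR.log, true_and]
    have : a + 1 < 2 ^ (a + 1) := Nat.lt_two_pow_self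
    omega
  · generalize hσ₁ : Store.set _ _ _ = σ₁
    have hm₁ : σ₁.mem = σ.mem := by rw [← hσ₁]; rfl
    have hsrc : σ₁.var vSrc = n + 3 * (t + 1) := by simp [← hσ₁, hR.work]
    have hdst : σ₁.var vDst = n + 3 * (t + 1) + Z := by simp [← hσ₁, hR.work, hR.room, hZ]
    have htot : σ₁.var vTot = 2 * 2 ^ (a + 1) := by simp [← hσ₁, hR.pow]
    have hA : σ₁.var vA = a := by simp [← hσ₁, hR.log]
    have hR₁ : Regs n t m (a + 1) σ₁ := hR.congr (by simp [← hσ₁])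
    have hk₁ : σ₁.var vRound = k := by simp [← hσ₁, hk]
    clear hσ₁
    have hD₁ : Arrays n t V D σ₁.mem := hm₁ ▸ hD
    refine Exec.fill (pairFun t (a + 1) V D) (by decide) (by decide) (by rw [hsrc, htot]; omega)
      (fun i hi => ?_) (by rw [htot]) ?_
    · rw [htot] at hi
      rw [hsrc]
      simp only [pairExpr, Expr.safe_iteLt, Expr.safe_var, Expr.safe_ofNat, Expr.safe_load,
        Expr.safe_add, Expr.safe_sub, Expr.val_var, Expr.val_ofNat, Expr.val_add, Expr.val_sub,
        Expr.val_load, Expr.val_iteLt, Function.update_self, Function.update_of_ne, ne_eq,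
        Nat.reduceEqDiff, not_false_eq_true, hR₁.pow, hR₁.len, hR₁.num, hR₁.coins, true_and]
      constructor
      · exact ⟨fun h1 => ⟨fun h2 => ⟨by omega, by omega, fun _ => by omega, fun _ => by omega⟩,
          fun _ => by omega⟩, fun h1 => ⟨by omega, fun h2 => by omega, fun _ => by omega⟩⟩
      · rw [pairFun]
        by_cases h1 : i < 2 ^ (a + 1)
        · rw [if_pos h1, if_pos h1]
          by_cases h2 : i < t + 1
          · rw [if_pos h2, if_pos h2, fillMem_of_lt (by omega), hD₁.table i h2]
          · rw [if_neg h2, if_neg h2]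
        · rw [if_neg h1, if_neg h1]
          by_cases h2 : i - 2 ^ (a + 1) < t + 1
          · rw [if_pos h2, if_pos h2, fillMem_of_lt (by omega), hD₁.coins _ h2]
          · rw [if_neg h2, if_neg h2]
    · set σ₂ : Store := ⟨Function.update σ₁.var vI (σ₁.var vTot),
        fillMem σ₁.mem (σ₁.var vSrc) (σ₁.var vTot) (pairFun t (a + 1) V D)⟩ with hσ₂
      have hsrc₂ : σ₂.var vSrc = n + 3 * (t + 1) := by simp [hσ₂, hsrc]
      have hdst₂ : σ₂.var vDst = n + 3 * (t + 1) + Z := by simp [hσ₂, hdst]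
      have hmem₂ : σ₂.mem = fillMem σ₁.mem (n + 3 * (t + 1)) (2 * 2 ^ (a + 1))
          (pairFun t (a + 1) V D) := by
        simp [hσ₂, hsrc, htot]
      have hR₂ : Regs n t m (a + 1) σ₂ := hR₁.congr (by simp [hσ₂])
      have hk₂ : σ₂.var vRound = k := by simp [hσ₂, hk₁]
      have hB : Buffer w (n + 3 * (t + 1)) Z σ₁.mem
          (fun i => (pairFun t (a + 1) V D i : NegRing w (2 ^ (a + 1)))) (2 * 2 ^ (a + 1)) σ₂ := by
        refine ⟨hsrc₂.ge, by omega, .inl (by omega), by omega, by omega, by omega, ?_, ?_⟩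
        · intro i hi
          rw [hsrc₂, hmem₂, fillMem_add hi]
          have := pairFun_le_one t (a + 1) V D i
          exact ⟨by omega, rfl⟩
        · intro a ha
          rw [hmem₂, fillMem_of_lt ha]
      refine Exec.seq ((exec_mul (a := a) (NegRing.natCast_pow w _) h4 hB
        (by simp [hσ₂, htot]) (by simp [hσ₂, hA]) hroom).frame.mono le_rfl ?_)
      rintro σ₃ ⟨hB₃, hv₃⟩
      have hR₃ : Regs n t m (a + 1) σ₃ := hR₂.congr fun x hx => hv₃ x (by
        revert x
        decide)
      have hk₃ : σ₃.var vRound = k := by rw [hv₃ _ (by decide), hk₂]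
      have hD₃ : Arrays n t V D σ₃.mem := hD₁.congr fun a ha => hB₃.prot a (by omega)
      have hsrc₃ := hB₃.le_src
      have hsrc₃' := hB₃.src_lt
      -- The result may be in either half of the work space, but in any case above the tables, so
      -- that overwriting the table of coin numbers does not destroy it.
      have hconv : ∀ j < t + 1, 0 < σ₃.mem (σ₃.var vSrc + j) ↔
          ∃ x ∈ antidiagonal j, 0 < D x.1 ∧ x.2 ∈ V := fun j hj =>
        hF.conv_pos_iff (h := fun j => σ₃.mem (σ₃.var vSrc + j)) hB₃.holds hj
      refine Exec.fill (fun j => if 0 < D j then D j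
        else if ∃ x ∈ antidiagonal j, 0 < D x.1 ∧ x.2 ∈ V then k + 2 else 0) (by decide) (by decide)
        (by rw [hR₃.num, hR₃.len]; omega) (fun j hj => ?_) (by rw [hR₃.len]) ?_
      · rw [hR₃.len] at hj
        rw [hR₃.num]
        simp only [updateExpr, Expr.safe_iteLt, Expr.safe_var, Expr.safe_ofNat, Expr.safe_load,
          Expr.safe_add, Expr.val_var, Expr.val_ofNat, Expr.val_add,
          Expr.val_load, Expr.val_iteLt, Function.update_self, Function.update_of_ne, ne_eq,
          Nat.reduceEqDiff, not_false_eq_true, hR₃.num, hk₃, true_and]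
        rw [fillMem_of_ge (le_refl (n + j)), fillMem_of_ge (by omega), hD₃.table j hj]
        simp only [hconv j hj]
        exact ⟨⟨by omega, by omega, fun _ => by omega, fun _ => ⟨by omega, by omega,
          fun _ => by omega, fun _ => by omega⟩⟩, trivial⟩
      · rw [hR₃.num, hR₃.len]
        exact ⟨fun j hj => by simp only; rw [fillMem_add hj], fun j hj => by
          simp only
          rw [fillMem_of_ge (by omega), hD₃.coins j hj]⟩
  · have e1 : pairExpr.cost + 12 ≤ 100 := by decide
    have e2 : updateExpr.cost + 12 ≤ 100 := by decide
    have e3 : c₁ ≤ (2 * 2 ^ (a + 1) + 1) * 100 + 2 := by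
      rw [hc₁]; exact Nat.add_le_add_right (Nat.mul_le_mul_left _ e1) _
    have e4 : c₃ ≤ (t + 1 + 1) * 100 + 2 := by
      rw [hc₃]; exact Nat.add_le_add_right (Nat.mul_le_mul_left _ e2) _
    have e5 : (Z + 1) * 100 ≤ (a + 4) ^ 2 * ((Z + 1) * 100) :=
      Nat.le_mul_of_pos_left _ (by positivity)
    have e6 : (a + 1 + 3) ^ 2 * ((Z + 1) * 1600) =
        (a + 4) ^ 2 * ((Z + 1) * 1500) + (a + 4) ^ 2 * ((Z + 1) * 100) := by ring
    rw [e6]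
    omega

end

end ChangeMaking

/-! ### The rounds of convolution and the passes for the sparse coins -/

namespace ChangeMaking

open Finset WordRAM Nussbaumer

/-- Find all the solutions with few coins. -/
def roundsStmt : Stmt :=
  vRound ≔ 0 ;; .whileLt (.var vRound) (.var vRounds) (roundStmt ;; vRound ≔ .var vRound + 1)

/-- The counting function of the set of coins. -/
def cumExpr : Expr :=
  .iteLt 0 (.var vTarget)
    (.load (.var vCum + (.var vTarget - 1)) + .load (.var vCoins + .var vTarget))
    (.load (.var vCoins + .var vTarget))

/-- The textbook dynamic program for a single coin. -/
def relaxExpr : Expr :=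
  .iteLt (.var vTarget) (.var vCoin) (.load (.var vNum + .var vTarget))
    (.iteLt 0 (.load (.var vNum + (.var vTarget - .var vCoin)))
      (.iteLt 0 (.load (.var vNum + .var vTarget))
        (.iteLt (.load (.var vNum + (.var vTarget - .var vCoin)) + 1)
          (.load (.var vNum + .var vTarget))
          (.load (.var vNum + (.var vTarget - .var vCoin)) + 1)
          (.load (.var vNum + .var vTarget)))
        (.load (.var vNum + (.var vTarget - .var vCoin)) + 1))
      (.load (.var vNum + .var vTarget)))

/-- The treatment of one coin: nothing happens unless it is sparse. -/
def coinStmt : Stmt :=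
  .ifLt 0 (.load (.var vCoins + .var vCoin))
    (.ifLt
      (.load (.var vCum + .iteLt (.var vMax) (2 * .var vCoin) (.var vMax) (2 * .var vCoin)))
      (.var vDens + .load (.var vCum + .var vCoin))
      (.fill vTarget vNum vLen relaxExpr) (vTarget ≔ 0))
    (vTarget ≔ 0)

/-- Run the textbook dynamic program for all the sparse coins. -/
def sparseStmt : Stmt :=
  .fill vTarget vCum vLen cumExpr ;;
  vCoin ≔ 0 ;; .whileLt (.var vCoin) (.var vLen) (coinStmt ;; vCoin ≔ .var vCoin + 1)

section

variable {n t w m K k y : ℕ} {V : Finset ℕ} {D : ℕ → ℕ} {σ : Store}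

theorem exec_rounds (hF : Fits n t w m K) (hR : Regs n t m K σ)
    (hD : Arrays n t V (trunc V 0) σ.mem) :
    Exec w roundsStmt σ
      ((2 * (m * K) * K + 2) * ((K + 3) ^ 2 * ((4 * 2 ^ K * K + 1) * 1610))) fun σ' =>
      Regs n t m K σ' ∧ Arrays n t V (trunc V (2 * (m * K) * K)) σ'.mem := by
  have hL := hF.rounds
  set L := 2 * (m * K) * K with hLdef
  set c := (K + 3) ^ 2 * ((4 * 2 ^ K * K + 1) * 1600) with hc
  refine Exec.mono (T := 2 + (L + 1) * (3 + (c + 4))) (Exec.assign_seq (by simp)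
    (Exec.mono (Exec.whileLt_const L (fun k σ' => Regs n t m K σ' ∧ Arrays n t V (trunc V k) σ'.mem ∧
      σ'.var vRound = k) (c + 4) ⟨hR.congr (by simp), hD, by simp⟩ (fun k _ σ' _ => by simp)
      ?_ ?_) le_rfl fun _ h => h)) ?_ fun _ h => h
  · rintro k hk σ' ⟨hR', hD', hk'⟩
    refine ⟨by simp [hk', hR'.rounds, ← hLdef, hk], Exec.seq ?_⟩
    refine (exec_round hF hR' hD' hk' (by omega)).mono le_rfl ?_
    rintro σ'' ⟨hD'', hv⟩
    have hk'' : σ''.var vRound = k := by rw [hv _ (by decide), hk']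
    refine Exec.assign ?_ ⟨?_, ?_, by simp [hk'']⟩
    · simp only [Expr.safe_add, Expr.safe_ofNat, Expr.safe_var, Expr.val_ofNat, Expr.val_var, hk'',
        true_and]
      omega
    · refine Regs.congr (hR'.congr fun x hx => hv x ?_) (by simp)
      revert x
      decide
    · rw [Store.set_mem]
      convert hD'' using 1
      funext j
      exact trunc_succ V k j
  · rintro σ' ⟨hR', hD', hk'⟩
    exact ⟨by simp [hk', hR'.rounds, ← hLdef], hR', hD'⟩
  · have h1 : 10 ≤ (K + 3) ^ 2 * ((4 * 2 ^ K * K + 1) * 10) := by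
      have : 0 < (K + 3) ^ 2 * (4 * 2 ^ K * K + 1) := by positivity
      linarith
    have h2 : (K + 3) ^ 2 * ((4 * 2 ^ K * K + 1) * 1610) =
      c + (K + 3) ^ 2 * ((4 * 2 ^ K * K + 1) * 10) := by rw [hc]; ring
    rw [h2]
    nlinarith

theorem card_filter_le_succ (V : Finset ℕ) (j : ℕ) :
    #{x ∈ V | x ≤ j + 1} = #{x ∈ V | x ≤ j} + if j + 1 ∈ V then 1 else 0 := by
  have : {x ∈ V | x ≤ j + 1} = {x ∈ V | x ≤ j} ∪ {x ∈ V | x = j + 1} := by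
    ext x
    simp only [mem_filter, mem_union]
    constructor
    · rintro ⟨h, h'⟩
      by_cases he : x = j + 1
      · exact .inr ⟨h, he⟩
      · exact .inl ⟨h, by omega⟩
    · rintro (⟨h, h'⟩ | ⟨h, h'⟩) <;> exact ⟨h, by omega⟩
  rw [this, card_union_of_disjoint]
  · congr 1
    rw [filter_eq']
    split_ifs <;> simp
  · rw [disjoint_filter]
    intro x _ h
    omega

theorem card_filter_le_zero (V : Finset ℕ) : #{x ∈ V | x ≤ 0} = if 0 ∈ V then 1 else 0 := by
  simp only [Nat.le_zero]
  rw [filter_eq']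
  split_ifs <;> simp

/-- The number of coins in `(y, 2 * y]` is a difference of two values of the counting function. Its
table ends at `t`, and since no coin exceeds `t`, the upper end may be cut off there. The
subtraction is avoided by moving one term across. -/
theorem sparse_iff (hV : ∀ y ∈ V, y ≤ t) :
    #{x ∈ V | x ≤ if t < 2 * y then t else 2 * y} < m + #{x ∈ V | x ≤ y} ↔ Sparse V m y := by
  have h1 : {x ∈ V | x ≤ if t < 2 * y then t else 2 * y} =
      {x ∈ V | x ≤ y} ∪ {x ∈ V | y < x ∧ x ≤ 2 * y} := by
    ext x
    simp only [mem_filter, mem_union]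
    constructor
    · rintro ⟨h, h'⟩
      have := hV x h
      by_cases hx : x ≤ y
      · exact .inl ⟨h, hx⟩
      · exact .inr ⟨h, by omega, by split_ifs at h' <;> omega⟩
    · rintro (⟨h, h'⟩ | ⟨h, h'⟩) <;> have := hV x h <;> exact ⟨h, by split_ifs <;> omega⟩
  rw [h1, card_union_of_disjoint, Sparse]
  · omega
  · rw [disjoint_filter]
    intro x _ h
    omega

theorem card_filter_le_le (V : Finset ℕ) (j : ℕ) : #{x ∈ V | x ≤ j} ≤ j + 1 := by
  rw [← card_range (j + 1)]
  refine card_le_card fun x hx => mem_range.2 ?_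
  have := (mem_filter.1 hx).2
  omega

/-- The table, the set of coins and its counting function are in memory. -/
structure Arrays' (n t : ℕ) (V : Finset ℕ) (D : ℕ → ℕ) (mem : ℕ → ℕ) : Prop
    extends Arrays n t V D mem where
  cum : ∀ j < t + 1, mem (n + 2 * (t + 1) + j) = #{x ∈ V | x ≤ j}

theorem exec_cum (hF : Fits n t w m K) (hR : Regs n t m K σ) (hD : Arrays n t V D σ.mem) :
    Exec w (.fill vTarget vCum vLen cumExpr) σ ((t + 2) * 100) fun σ' =>
      Regs n t m K σ' ∧ Arrays' n t V D σ'.mem := by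
  have hmem := hF.mem
  have h4 := hF.four
  refine Exec.fill (fun j => #{x ∈ V | x ≤ j}) (by decide) (by decide)
    (by rw [hR.cum, hR.len]; omega) (fun j hj => ?_) ?_ ?_
  · rw [hR.len] at hj
    rw [hR.cum]
    simp only [cumExpr, Expr.safe_iteLt, Expr.safe_var, Expr.safe_ofNat, Expr.safe_load,
      Expr.safe_add, Expr.safe_sub, Expr.val_var, Expr.val_ofNat, Expr.val_add, Expr.val_sub,
      Expr.val_load, Expr.val_iteLt, Function.update_self, Function.update_of_ne, ne_eq,
      Nat.reduceEqDiff, not_false_eq_true, hR.cum, hR.coins, true_and]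
    rw [fillMem_of_lt (by omega : n + (t + 1) + j < n + 2 * (t + 1)), hD.coins j hj]
    rcases Nat.eq_zero_or_pos j with rfl | h0
    · simp only [lt_irrefl, if_false, card_filter_le_zero, IsEmpty.forall_iff, not_false_eq_true,
        forall_const, true_and, and_true]
      omega
    · obtain ⟨i, rfl⟩ : ∃ i, j = i + 1 := ⟨j - 1, by omega⟩
      rw [Nat.add_sub_cancel, fillMem_add (by omega), if_pos h0, card_filter_le_succ]
      have := card_filter_le_le V i
      refine ⟨⟨by omega, fun _ => ⟨by omega, by omega, ?_⟩, fun _ => by omega⟩, rfl⟩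
      split_ifs <;> omega
  · rw [hR.len]
    have : cumExpr.cost + 12 ≤ 50 := by decide
    have := Nat.mul_le_mul_left (t + 1 + 1) this
    omega
  · rw [hR.len, hR.cum]
    exact ⟨hR.congr (by simp), hD.congr fun a ha => by simp only; rw [fillMem_of_lt ha],
      fun j hj => by simp only; rw [fillMem_add hj]⟩

/-- The pass works in place in ascending order: the entry at `j - y` is already the new one while
the entry at `j` is still the old one, exactly as in the recursion of `relax`. Soundness bounds the
entries by `j + 1`, so adding one coin cannot overflow. -/
theorem exec_relax (hF : Fits n t w m K) (hR : Regs n t m K σ) (hD : Arrays' n t V D σ.mem)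
    (hy : σ.var vCoin = y) (hV : ∀ x ∈ V, 0 < x) (hyV : y ∈ V) (hS : Sound V t D) :
    Exec w (.fill vTarget vNum vLen relaxExpr) σ ((t + 2) * 100) fun σ' =>
      Regs n t m K σ' ∧ σ'.var vCoin = y ∧ Arrays' n t V (relax y D) σ'.mem := by
  have hmem := hF.mem
  have h4 := hF.four
  have hdens := hF.dens
  have hy0 := hV y hyV
  refine Exec.fill (relax y D) (by decide) (by decide)
    (by rw [hR.num, hR.len]; omega) (fun j hj => ?_) ?_ ?_
  · rw [hR.len] at hj
    rw [hR.num]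
    simp only [relaxExpr, Expr.safe_iteLt, Expr.safe_var, Expr.safe_ofNat, Expr.safe_load,
      Expr.safe_add, Expr.safe_sub, Expr.val_var, Expr.val_ofNat, Expr.val_add, Expr.val_sub,
      Expr.val_load, Expr.val_iteLt, Function.update_self, Function.update_of_ne, ne_eq,
      Nat.reduceEqDiff, not_false_eq_true, hR.num, hy, true_and]
    rw [fillMem_of_ge (le_refl (n + j)), hD.table j hj, relax]
    by_cases hjy : j < y
    · rw [if_pos hjy, dif_neg (by omega)]
      exact ⟨⟨fun _ => by omega, fun h => absurd hjy h⟩, rfl⟩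
    · rw [if_neg hjy, dif_pos (by omega), fillMem_add (by omega)]
      have hle := (hS.relax hyV).le hV (show j - y ≤ t by omega)
      refine ⟨⟨fun h => absurd h hjy, fun _ => ⟨by omega, by omega, fun _ => ⟨by omega, by omega,
        fun _ => ⟨by omega, by omega, fun _ => by omega, fun _ => by omega⟩, fun _ => by omega⟩,
        fun _ => by omega⟩⟩, ?_⟩
      congr 1
      rw [min_def]
      split_ifs <;> omega
  · rw [hR.len]
    have : relaxExpr.cost + 12 ≤ 80 := by decide
    have := Nat.mul_le_mul_left (t + 1 + 1) this
    omega
  · rw [hR.len, hR.num]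
    refine ⟨hR.congr (by simp), by simpa using hy, ⟨fun j hj => by simp only; rw [fillMem_add hj],
      fun j hj => ?_⟩, fun j hj => ?_⟩
    · simp only
      rw [fillMem_of_ge (by omega), hD.coins j hj]
    · simp only
      rw [fillMem_of_ge (by omega), hD.cum j hj]

theorem exec_coin (hF : Fits n t w m K) (hR : Regs n t m K σ) (hD : Arrays' n t V D σ.mem)
    (hy : σ.var vCoin = y) (hyt : y ≤ t) (hV : ∀ x ∈ V, 0 < x ∧ x ≤ t) (hS : Sound V t D) :
    Exec w coinStmt σ (40 + if y ∈ V ∧ Sparse V m y then (t + 2) * 100 else 0) fun σ' =>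
      Regs n t m K σ' ∧ σ'.var vCoin = y ∧
        Arrays' n t V (if y ∈ V ∧ Sparse V m y then relax y D else D) σ'.mem := by
  have hmem := hF.mem
  have h4 := hF.four
  have hdens := hF.dens
  have hskip : ¬ (y ∈ V ∧ Sparse V m y) → Exec w (vTarget ≔ 0) σ 2 fun σ' =>
      Regs n t m K σ' ∧ σ'.var vCoin = y ∧
        Arrays' n t V (if y ∈ V ∧ Sparse V m y then relax y D else D) σ'.mem := fun h =>
    Exec.assign (by simp) ⟨hR.congr (by simp), by simpa using hy, by rw [if_neg h]; exact hD⟩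
  have hcoin := hD.coins y (by omega)
  have hcy := hD.cum y (by omega)
  have hc2 := hD.cum (if t < 2 * y then t else 2 * y) (by split_ifs <;> omega)
  have hle := card_filter_le_le V y
  have hsp := sparse_iff (m := m) (y := y) fun x hx => (hV x hx).2
  set F := if y ∈ V ∧ Sparse V m y then (t + 2) * 100 else 0 with hFdef
  refine Exec.mono (T := 6 + (30 + (2 + F))) (Exec.ifLt ?_ ?_ (fun h => ?_) fun h => ?_)
    (by omega) fun _ h => h
  · simp only [Expr.safe_ofNat]
    omega
  · simp only [Expr.safe_load, Expr.safe_add, Expr.safe_var, Expr.val_var, hR.coins, hy, true_and]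
    omega
  · simp only [Expr.val_ofNat, Expr.val_load, Expr.val_add, Expr.val_var, hR.coins, hy,
      hcoin] at h
    have hyV : y ∈ V := by
      by_contra hc
      simp [hc] at h
    refine Exec.mono (Exec.ifLt (T := 2 + F) ?_ ?_ (fun h' => ?_) fun h' => ?_)
      (Nat.add_le_add_right (by decide) _) fun _ h => h
    · simp only [Expr.safe_load, Expr.safe_add, Expr.safe_var, Expr.safe_iteLt, Expr.safe_mul,
        Expr.safe_ofNat, Expr.val_ofNat, Expr.val_mul, Expr.val_iteLt, Expr.val_var, hR.cum, hR.max,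
        hy, true_and]
      refine ⟨⟨by omega, fun _ => trivial, fun _ => by omega⟩, ?_⟩
      split_ifs <;> omega
    · simp only [Expr.safe_load, Expr.safe_add, Expr.safe_var, Expr.val_load, Expr.val_add,
        Expr.val_var, hR.cum, hR.dens, hy, hcy, true_and]
      omega
    · simp only [Expr.val_load, Expr.val_add, Expr.val_mul, Expr.val_ofNat, Expr.val_iteLt,
        Expr.val_var, hR.cum, hR.max, hR.dens, hy, hc2, hcy, hsp] at h'
      have hb : y ∈ V ∧ Sparse V m y := ⟨hyV, h'⟩
      rw [hFdef, if_pos hb, if_pos hb]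
      exact (exec_relax hF hR hD hy (fun x hx => (hV x hx).1) hyV hS).mono (by omega) fun _ h => h
    · simp only [Expr.val_load, Expr.val_add, Expr.val_mul, Expr.val_ofNat, Expr.val_iteLt,
        Expr.val_var, hR.cum, hR.max, hR.dens, hy, hc2, hcy, hsp] at h'
      exact (hskip fun hb => h' hb.2).mono (by omega) fun _ h => h
  · simp only [Expr.val_ofNat, Expr.val_load, Expr.val_add, Expr.val_var, hR.coins, hy,
      hcoin] at h
    refine (hskip fun hb => h (by simp [hb.1])).mono (by omega) fun _ h => h

/-- Only a sparse coin costs a full pass, and every other value costs a constant. The loop therefore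
needs the rule with varying costs, and the sum is bounded by the number of sparse coins. -/
theorem exec_sparse (hF : Fits n t w m K) (hR : Regs n t m K σ) (hm : t < m ^ 3)
    (hV : ∀ x ∈ V, 0 < x ∧ x ≤ t) (hD : Arrays n t V (trunc V (2 * (m * K) * K)) σ.mem) :
    Exec w sparseStmt σ ((m * K + 2) * ((t + 2) * 200)) fun σ' =>
      Regs n t m K σ' ∧ ∀ j < t + 1, σ'.mem (n + j) = opt V j := by
  have h4 := hF.four
  have hpow := hF.pow
  have hmem := hF.mem
  set L := 2 * (m * K) * K with hL
  set c : ℕ → ℕ := fun y => 40 + (if y ∈ V ∧ Sparse V m y then (t + 2) * 100 else 0) + 4 with hc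
  refine Exec.mono (T := (t + 2) * 100 + (2 + (3 + ∑ y ∈ range (t + 1), (3 + c y))))
    (Exec.seq ((exec_cum hF hR hD).mono le_rfl ?_)) ?_ fun _ h => h
  · rintro σ₁ ⟨hR₁, hD₁⟩
    -- Invariant: the table is sound and covers arbitrary use of the sparse coins below `y`. It
    -- starts with the result of the rounds, which covers no such coin.
    refine Exec.assign_seq (by simp) (Exec.whileLt (t + 1) (fun y σ' => Regs n t m K σ' ∧
      σ'.var vCoin = y ∧ ∃ D, Arrays' n t V D σ'.mem ∧ Sound V t D ∧
        Covers V L t {x ∈ V | x < y ∧ Sparse V m x} D) c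
      ⟨hR₁.congr (by simp), by simp, _, hD₁, sound_trunc V L t, ?_⟩
      (fun y _ σ' _ => by simp) ?_ ?_)
    · simpa using covers_trunc V L t
    · rintro y hy σ' ⟨hR', hy', D, hD', hS, hC⟩
      refine ⟨by simpa [hy', hR'.len] using hy, Exec.seq ((exec_coin hF hR' hD' hy' (by omega) hV
        hS).mono le_rfl ?_)⟩
      rintro σ'' ⟨hR'', hy'', hD''⟩
      refine Exec.assign ?_ ⟨hR''.congr (by simp), by simp [hy''], _, hD'', ?_, ?_⟩
      · simp only [Expr.safe_add, Expr.safe_ofNat, Expr.safe_var, Expr.val_ofNat, Expr.val_var,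
          hy'', true_and]
        omega
      · split_ifs with hb
        · exact hS.relax hb.1
        · exact hS
      · split_ifs with hb
        · convert hC.relax (hV y hb.1).1 using 1
          ext x
          simp only [mem_filter, mem_insert]
          constructor
          · rintro ⟨h1, h2, h3⟩
            by_cases hx : x = y
            · exact .inl hx
            · exact .inr ⟨h1, by omega, h3⟩
          · rintro (rfl | ⟨h1, h2, h3⟩)
            · exact ⟨hb.1, by omega, hb.2⟩
            · exact ⟨h1, by omega, h3⟩
        · convert hC using 1
          ext x
          simp only [mem_filter]
          refine and_congr_right fun h1 => and_congr_left fun h3 => ?_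
          have : x ≠ y := fun h => hb (h ▸ ⟨h1, h3⟩)
          omega
    · rintro σ' ⟨hR', hy', D, hD', hS, hC⟩
      refine ⟨by simp [hy', hR'.len], hR', fun j hj => ?_⟩
      rw [hD'.table j hj]
      refine eq_opt (fun y hy => (hV y hy).1) hm (by omega : t + 1 < 2 ^ K) (by omega)
        (fun y hy hs => ?_) hS hC
      have := (hV y hy).2
      exact mem_filter.2 ⟨hy, by omega, hs⟩
  · have h1 : ∑ y ∈ range (t + 1), (3 + c y) ≤ (t + 1) * 47 + m * K * ((t + 2) * 100) := by
      have h2 : ∀ y, 3 + c y = 47 + if y ∈ V ∧ Sparse V m y then (t + 2) * 100 else 0 := by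
        intro y
        simp only [hc]
        omega
      simp_rw [h2]
      rw [sum_add_distrib, sum_const, card_range, smul_eq_mul, ← sum_filter, sum_const, smul_eq_mul]
      refine Nat.add_le_add_left (Nat.mul_le_mul_right _ ?_) _
      refine (card_le_card fun y hy => ?_).trans (card_sparse_le (V := V) (m := m) (K := K)
        fun y hy => ⟨(hV y hy).1, by have := (hV y hy).2; omega⟩)
      exact mem_filter.2 (mem_filter.1 hy).2
    have e : (m * K + 2) * ((t + 2) * 200) =
        2 * (m * K * ((t + 2) * 100)) + (t + 2) * 400 := by ring
    rw [e]
    generalize m * K * ((t + 2) * 100) = x at h1 ⊢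
    omega

end

end ChangeMaking

/-! ### Initialization, input, output and the whole algorithm -/

namespace ChangeMaking

open Finset WordRAM Nussbaumer

/-- Compute the parameters. -/
def initStmt : Stmt :=
  vLen ≔ .var vMax + 1 ;; vCoins ≔ .var vNum + .var vLen ;; vCum ≔ .var vCoins + .var vLen ;;
  vWork ≔ .var vCum + .var vLen ;; vDens ≔ 0 ;;
  .whileLt (.var vDens * .var vDens * .var vDens) (.var vLen) (vDens ≔ .var vDens + 1) ;;
  vPow ≔ 1 ;; vLog ≔ 0 ;;
  .whileLt (.var vPow) (2 * .var vLen) (vPow ≔ 2 * .var vPow ;; vLog ≔ .var vLog + 1) ;;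
  vRoom ≔ 4 * .var vPow * .var vLog ;; vRounds ≔ 2 * (.var vDens * .var vLog) * .var vLog

/-- Compute the indicator function of the set of coins, and pay the target zero. -/
def scatterStmt : Stmt :=
  vCoin ≔ 0 ;;
  .whileLt (.var vCoin) (.var vNum)
    (.ifLt (.load (.var vCoin)) (.var vLen) (.store (.var vCoins + .load (.var vCoin)) 1)
      (vTarget ≔ 0) ;;
    vCoin ≔ .var vCoin + 1) ;;
  .store (.var vNum) 1

/-- Copy the table to the beginning of the memory. -/
def outputStmt : Stmt :=
  vOut ≔ 0 ;; .fill vTarget vOut vLen (.load (.var vNum + .var vTarget))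

/-- The whole algorithm. -/
def mainStmt : Stmt :=
  initStmt ;; scatterStmt ;; roundsStmt ;; sparseStmt ;; outputStmt

section

variable {n t w m K : ℕ} {V : Finset ℕ} {σ : Store}

/-- The cube root `m` and the logarithm `K` are found by counting up, which is affordable since it
takes only about `m + K` steps. -/
theorem exec_init (hF : Fits n t w m K) (hn : σ.var vNum = n) (ht : σ.var vMax = t)
    (hm : t < m ^ 3) (hm' : ∀ k < m, k ^ 3 ≤ t) (hK' : ∀ k < K, 2 ^ k < 2 * (t + 1)) :
    Exec w initStmt σ ((m + K + 2) * 100) fun σ' => Regs n t m K σ' ∧ σ'.mem = σ.mem := by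
  have hmem := hF.mem
  have h4 := hF.four
  have hpow := hF.pow
  have hK := hF.one_le
  have hroom : 4 * 2 ^ K ≤ 4 * 2 ^ K * K := Nat.le_mul_of_pos_right _ hK
  have hcube := hF.cube
  have hrounds := hF.rounds
  have hdens := hF.dens
  refine Exec.mono (T := 4 + (4 + (4 + (4 + (2 + ((m + 1) * 11 + (2 + (2 + ((K + 1) * 20 +
    (6 + 8)))))))))) (Exec.assign_seq ?_ (Exec.assign_seq ?_ (Exec.assign_seq ?_ (Exec.assign_seq ?_
    (Exec.assign_seq (by simp) (Exec.seq ?_)))))) (by nlinarith) fun _ h => h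
  · simp only [Expr.safe_add, Expr.safe_var, Expr.safe_ofNat, Expr.val_var, Expr.val_ofNat, ht,
      true_and]
    omega
  · simp only [Expr.safe_add, Expr.safe_var, Expr.val_add, Expr.val_var, Expr.val_ofNat, ht, hn,
      Store.set_var, Nat.reduceEqDiff, if_false, if_true, true_and]
    omega
  · simp only [Expr.safe_add, Expr.safe_var, Expr.val_add, Expr.val_var, Expr.val_ofNat, ht, hn,
      Store.set_var, Nat.reduceEqDiff, if_false, if_true, true_and]
    omega
  · simp only [Expr.safe_add, Expr.safe_var, Expr.val_add, Expr.val_var, Expr.val_ofNat, ht, hn,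
      Store.set_var, Nat.reduceEqDiff, if_false, if_true, true_and]
    omega
  generalize hσ₁ : Store.set _ _ _ = σ₁
  have hn₁ : σ₁.var vNum = n := by simp [← hσ₁, hn]
  have ht₁ : σ₁.var vMax = t := by simp [← hσ₁, ht]
  have hl₁ : σ₁.var vLen = t + 1 := by simp [← hσ₁, ht]
  have hc₁ : σ₁.var vCoins = n + (t + 1) := by simp [← hσ₁, ht, hn]
  have hu₁ : σ₁.var vCum = n + 2 * (t + 1) := by simp [← hσ₁, ht, hn]; ring
  have hw₁ : σ₁.var vWork = n + 3 * (t + 1) := by simp [← hσ₁, ht, hn]; ring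
  have hd₁ : σ₁.var vDens = 0 := by simp [← hσ₁]
  have hm₁ : σ₁.mem = σ.mem := by rw [← hσ₁]; rfl
  clear hσ₁
  refine Exec.mono (Exec.frame (Exec.whileLt_const m (fun k σ' => σ'.var vDens = k ∧
    σ'.var vLen = t + 1 ∧ σ'.mem = σ.mem) 4 ⟨hd₁, hl₁, hm₁⟩
    (Q := fun σ' => σ'.var vDens = m ∧ σ'.mem = σ.mem) ?_ ?_ ?_)) (by simp) ?_
  · rintro k hk σ' ⟨h1, h2, -⟩
    have e1 : k * k ≤ m * m := Nat.mul_le_mul hk hk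
    have e2 : k * k * k ≤ m * m * m := Nat.mul_le_mul e1 hk
    have e3 : k * k ≤ k * k * k := by
      rcases Nat.eq_zero_or_pos k with rfl | h
      · simp
      · exact Nat.le_mul_of_pos_right _ h
    simp only [Expr.safe_mul, Expr.safe_var, Expr.val_mul, Expr.val_var, h1, true_and, and_true]
    omega
  · rintro k hk σ' ⟨h1, h2, h3⟩
    have := hm' k hk
    refine ⟨?_, Exec.assign ?_ ?_⟩
    · simp only [Expr.val_mul, Expr.val_var, h1, h2]
      rw [pow_succ, pow_two] at this
      omega
    · simp only [Expr.safe_add, Expr.safe_var, Expr.safe_ofNat, Expr.val_var, Expr.val_ofNat, h1,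
        true_and]
      omega
    · exact ⟨by simp [h1], by simp [h2], h3⟩
  · rintro σ' ⟨h1, h2, h3⟩
    refine ⟨?_, h1, h3⟩
    simp only [Expr.val_mul, Expr.val_var, h1, h2]
    rw [pow_succ, pow_two] at hm
    omega
  rintro σ₂ ⟨⟨hd₂, hm₂⟩, hv₂⟩
  have hl₂ : σ₂.var vLen = t + 1 := by rw [hv₂ _ (by decide), hl₁]
  refine Exec.assign_seq (by simp only [Expr.safe_ofNat]; omega)
    (Exec.assign_seq (by simp) (Exec.seq ?_))
  refine Exec.mono (Exec.frame (Exec.whileLt_const K (fun k σ' => σ'.var vPow = 2 ^ k ∧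
    σ'.var vLog = k ∧ σ'.var vLen = t + 1 ∧ σ'.mem = σ.mem) 8
    ⟨by simp, by simp, by simp [hl₂], hm₂⟩
    (Q := fun σ' => σ'.var vPow = 2 ^ K ∧ σ'.var vLog = K ∧ σ'.mem = σ.mem) ?_ ?_ ?_))
    (Nat.mul_le_mul_left _ (by decide)) ?_
  · rintro k hk σ' ⟨h1, h2, h3, -⟩
    simp only [Expr.safe_mul, Expr.safe_var, Expr.safe_ofNat, Expr.val_var, Expr.val_ofNat, h3,
      true_and]
    omega
  · rintro k hk σ' ⟨h1, h2, h3, h5⟩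
    have := hK' k hk
    have hkk : k < 2 ^ k := Nat.lt_two_pow_self
    refine ⟨?_, Exec.assign_seq ?_ (Exec.assign ?_ ⟨?_, ?_, ?_, ?_⟩)⟩
    · simpa only [Expr.val_mul, Expr.val_var, Expr.val_ofNat, h1, h3] using this
    · simp only [Expr.safe_mul, Expr.safe_var, Expr.safe_ofNat, Expr.val_var, Expr.val_ofNat, h1,
        true_and]
      omega
    · simp only [Expr.safe_add, Expr.safe_var, Expr.safe_ofNat, Expr.val_var, Expr.val_ofNat, h2,
        Store.set_var, Nat.reduceEqDiff, if_false, true_and]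
      omega
    · simp [h1, pow_succ']
    · simp [h2]
    · simp [h3]
    · exact h5
  · rintro σ' ⟨h1, h2, h3, h5⟩
    refine ⟨?_, h1, h2, h5⟩
    simp only [Expr.val_mul, Expr.val_var, Expr.val_ofNat, h1, h3]
    omega
  rintro σ₃ ⟨⟨hp₃, hl₃, hm₃⟩, hv₃⟩
  have hd₃ : σ₃.var vDens = m := by rw [hv₃ _ (by decide)]; simp [hd₂]
  have hmK2 : 2 * (m * K) ≤ 2 * (m * K) * K := Nat.le_mul_of_pos_right _ hK
  have hmK : m * K ≤ 2 * (m * K) * K := (Nat.le_mul_of_pos_left _ two_pos).trans hmK2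
  refine Exec.assign_seq ?_ (Exec.assign ?_ ⟨?_, hm₃⟩)
  · simp only [Expr.safe_mul, Expr.safe_var, Expr.safe_ofNat, Expr.val_mul, Expr.val_var,
      Expr.val_ofNat, hp₃, hl₃, true_and]
    omega
  · simp only [Expr.safe_mul, Expr.safe_var, Expr.safe_ofNat, Expr.val_mul, Expr.val_var,
      Expr.val_ofNat, hd₃, hl₃, Store.set_var, Nat.reduceEqDiff, if_false, true_and]
    omega
  · have hv : ∀ x ∈ [0, 1, 13, 15, 16, 17], σ₃.var x = σ₁.var x := by
      intro x hx
      have h1 : x ≠ 19 ∧ x ≠ 20 ∧ x ≠ 18 := by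
        revert x
        decide
      rw [hv₃ x (by simp [Stmt.writes, h1]), ← hv₂ x (by simp [Stmt.writes, h1])]
      simp [h1]
    simp only [List.forall_mem_cons, List.not_mem_nil, IsEmpty.forall_iff, implies_true,
      and_true] at hv
    obtain ⟨v0, v1, v2, v3, v4, v5⟩ := hv
    constructor <;> simp_all

/-- The memory behind the input is zero at the start, so an indicator function is obtained by
writing ones only. A coin above `t` costs no more than its inspection. The entry `1` for target `0`
encodes the empty payment. -/
theorem exec_scatter {v : Fin n → ℕ} (hF : Fits n t w m K) (hR : Regs n t m K σ)
    (hvw : ∀ i, v i < 2 ^ w) (hmem : ∀ a, σ.mem a = if h : a < n then v ⟨a, h⟩ else 0) :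
    Exec w scatterStmt σ ((n + 2) * 50) fun σ' => Regs n t m K σ' ∧
      Arrays n t {x ∈ univ.image v | x ≤ t} (trunc {x ∈ univ.image v | x ≤ t} 0) σ'.mem := by
  have hmw := hF.mem
  have h4 := hF.four
  refine Exec.mono (T := 2 + ((n + 1) * 30 + 3)) (Exec.assign_seq (by simp) (Exec.seq ?_)) (by omega)
    fun _ h => h
  refine Exec.mono (Exec.whileLt_const n (fun k σ' => Regs n t m K σ' ∧ σ'.var vCoin = k ∧
    (∀ a < n + (t + 1), σ'.mem a = σ.mem a) ∧ ∀ x < t + 1, σ'.mem (n + (t + 1) + x) =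
      if ∃ i : Fin n, i < k ∧ v i = x then 1 else 0) 20
    ⟨hR.congr (by simp), by simp, fun _ _ => rfl, fun x hx => ?_⟩
    (Q := fun σ' => Regs n t m K σ' ∧ (∀ a < n + (t + 1), σ'.mem a = σ.mem a) ∧
      ∀ x < t + 1, σ'.mem (n + (t + 1) + x) = if ∃ i : Fin n, v i = x then 1 else 0)
    (fun k _ σ' _ => by simp) ?_ ?_) (Nat.mul_le_mul_left _ (by decide)) ?_
  · simp only [Store.set_mem, hmem]
    rw [dif_neg (by omega), if_neg (by simp)]
  · rintro k hk σ' ⟨hR', hk', ha, hx⟩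
    refine ⟨by simpa [hk', hR'.num] using hk, ?_⟩
    have hload : σ'.mem k = v ⟨k, hk⟩ := by rw [ha k (by omega), hmem, dif_pos hk]
    have hvk := hvw ⟨k, hk⟩
    have hnext : ∀ x, (∃ i : Fin n, i < k + 1 ∧ v i = x) ↔
        (∃ i : Fin n, i < k ∧ v i = x) ∨ v ⟨k, hk⟩ = x := by
      intro x
      constructor
      · rintro ⟨i, hi, rfl⟩
        by_cases hik : (i : ℕ) = k
        · subst hik
          exact .inr rfl
        · exact .inl ⟨i, by omega, rfl⟩
      · rintro (⟨i, hi, rfl⟩ | h)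
        · exact ⟨i, by omega, rfl⟩
        · exact ⟨⟨k, hk⟩, by simp, h⟩
    refine Exec.mono (T := 4 + 7 + 4) (Exec.seq (Exec.mono (Exec.ifLt (T := 7)
      (Q := fun σ'' => (∀ x ≠ vTarget, σ''.var x = σ'.var x) ∧
        (∀ a < n + (t + 1), σ''.mem a = σ.mem a) ∧ ∀ x < t + 1, σ''.mem (n + (t + 1) + x) =
          if ∃ i : Fin n, i < k + 1 ∧ v i = x then 1 else 0)
      (by simp) (by simp) (fun h => ?_) fun h => ?_) le_rfl ?_)) (by decide) fun _ h => h
    · simp only [Expr.val_load, Expr.val_var, hk', hload, hR'.len] at h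
      refine Exec.mono (Exec.store ?_ ?_ ⟨fun _ _ => rfl, fun a ha' => ?_, fun x hxt => ?_⟩)
        (by decide) fun _ h => h
      · simp only [Expr.safe_add, Expr.safe_load, Expr.safe_var, Expr.val_load, Expr.val_var, hk',
          hload, hR'.coins, true_and]
        omega
      · simp only [Expr.safe_ofNat]
        omega
      · simp only [Store.write, Expr.val_add, Expr.val_load, Expr.val_var, hk', hload, hR'.coins]
        rw [Function.update_of_ne (by omega), ha a ha']
      · simp only [Store.write, Expr.val_add, Expr.val_load, Expr.val_var, hk', hload, hR'.coins,
          Expr.val_ofNat, hnext, Function.update_apply, hx x hxt]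
        by_cases hxv : x = v ⟨k, hk⟩
        · simp [hxv]
        · simp only [Nat.add_left_cancel_iff, hxv, Ne.symm hxv, or_false, if_false]
    · simp only [Expr.val_load, Expr.val_var, hk', hload, hR'.len] at h
      refine Exec.mono (Exec.assign (by simp) ⟨fun x hx => by simp [hx], ha, fun x hxt => ?_⟩)
        (by decide) fun _ h => h
      rw [Store.set_mem, hx x hxt]
      have : v ⟨k, hk⟩ ≠ x := by omega
      simp only [hnext, this, or_false]
    · rintro σ'' ⟨hv'', ha'', hx''⟩
      have hk'' : σ''.var vCoin = k := by rw [hv'' _ (by decide), hk']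
      refine Exec.assign ?_ ⟨Regs.congr (hR'.congr fun x hx => hv'' x ?_) (by simp), by simp [hk''],
        ha'', hx''⟩
      · simp only [Expr.safe_add, Expr.safe_var, Expr.safe_ofNat, Expr.val_var, Expr.val_ofNat, hk'',
          true_and]
        omega
      · revert x
        decide
  · rintro σ' ⟨hR', hk', ha, hx⟩
    refine ⟨by simp [hk', hR'.num], hR', ha, fun x hxt => ?_⟩
    simpa using hx x hxt
  · rintro σ₁ ⟨hR₁, ha₁, hx₁⟩
    refine Exec.store (by simp) (by simp only [Expr.safe_ofNat]; omega)
      ⟨hR₁.congr (by simp [Store.write]), ⟨fun j hj => ?_, fun j hj => ?_⟩⟩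
    · simp only [Store.write, Expr.val_var, Expr.val_ofNat, hR₁.num, Function.update_apply,
        trunc_zero]
      by_cases hj0 : j = 0
      · simp [hj0]
      · rw [if_neg (by omega), if_neg hj0, ha₁ _ (by omega), hmem, dif_neg (by omega)]
    · simp only [Store.write, Expr.val_var, Expr.val_ofNat, hR₁.num]
      rw [Function.update_of_ne (by omega), hx₁ j hj]
      have : j ≤ t := by omega
      simp [this]

/-- Source and destination may overlap, but ascending order is safe: when entry `n + j` is read,
only addresses below `j` have been overwritten. -/
theorem exec_output (hF : Fits n t w m K) (hR : Regs n t m K σ) {f : ℕ → ℕ}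
    (hf : ∀ j < t + 1, σ.mem (n + j) = f j) :
    Exec w outputStmt σ ((t + 2) * 50) fun σ' => ∀ j < t + 1, σ'.mem j = f j := by
  have hmw := hF.mem
  refine Exec.mono (T := 2 + ((t + 2) * 16 + 2)) (Exec.assign_seq (by simp) (Exec.fill f (by decide)
    (by decide) ?_ (fun j hj => ?_) ?_ fun j hj => ?_)) (by omega) fun _ h => h
  · simp only [Store.set_var, Nat.reduceEqDiff, if_false, if_true, Expr.val_ofNat, hR.len]
    omega
  · simp only [Store.set_var, Nat.reduceEqDiff, if_false, hR.len] at hj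
    simp only [Expr.safe_load, Expr.safe_add, Expr.safe_var, Expr.val_load, Expr.val_add,
      Expr.val_var, Function.update_self, Function.update_of_ne, ne_eq, Nat.reduceEqDiff,
      not_false_eq_true, Store.set_var, if_false, if_true, hR.num, Expr.val_ofNat, Store.set_mem,
      true_and]
    rw [fillMem_of_ge (by omega), hf j hj]
    exact ⟨by omega, rfl⟩
  · simp [hR.len]
  · simp only [Store.set_var, Nat.reduceEqDiff, if_false, if_true, hR.len, Expr.val_ofNat]
    have := fillMem_add (m := (σ.set vOut 0).mem) (d := 0) (f := f) hj
    rwa [zero_add] at this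

/-- The running time of the algorithm. -/
def mainTime (n t m K : ℕ) : ℕ :=
  (m + K + 2) * 100 + ((n + 2) * 50 +
    ((2 * (m * K) * K + 2) * ((K + 3) ^ 2 * ((4 * 2 ^ K * K + 1) * 1610)) +
    ((m * K + 2) * ((t + 2) * 200) + (t + 2) * 50)))

theorem exec_main {v : Fin n → ℕ} (hF : Fits n t w m K) (hn : σ.var vNum = n) (ht : σ.var vMax = t)
    (hm : t < m ^ 3) (hm' : ∀ k < m, k ^ 3 ≤ t) (hK' : ∀ k < K, 2 ^ k < 2 * (t + 1))
    (hv : ∀ i, 0 < v i) (hvw : ∀ i, v i < 2 ^ w)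
    (hmem : ∀ a, σ.mem a = if h : a < n then v ⟨a, h⟩ else 0) :
    Exec w mainStmt σ (mainTime n t m K) fun σ' =>
      ∀ j < t + 1, σ'.mem j = encode (minCoins v j) := by
  have hV : ∀ x ∈ ({x ∈ univ.image v | x ≤ t} : Finset ℕ), 0 < x ∧ x ≤ t := by
    intro x hx
    obtain ⟨h1, h2⟩ := mem_filter.1 hx
    obtain ⟨i, -, rfl⟩ := mem_image.1 h1
    exact ⟨hv i, h2⟩
  refine Exec.seq ((exec_init hF hn ht hm hm' hK').mono le_rfl ?_)
  rintro σ₁ ⟨hR₁, hm₁⟩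
  refine Exec.seq ((exec_scatter hF hR₁ hvw fun a => by rw [hm₁, hmem]).mono le_rfl ?_)
  rintro σ₂ ⟨hR₂, hD₂⟩
  refine Exec.seq ((exec_rounds hF hR₂ hD₂).mono le_rfl ?_)
  rintro σ₃ ⟨hR₃, hD₃⟩
  refine Exec.seq ((exec_sparse hF hR₃ hm hV hD₃).mono le_rfl ?_)
  rintro σ₄ ⟨hR₄, hD₄⟩
  refine (exec_output hF hR₄ hD₄).mono le_rfl fun σ₅ h j hj => ?_
  rw [h j hj, encode_minCoins v (by omega : j ≤ t)]

end

end ChangeMaking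

/-! ### Running time and word size -/

namespace ChangeMaking

open Finset WordRAM

/-- The rounds dominate: there are about `m * K ^ 2` of them, and each is a convolution with about
`K ^ 2` passes over about `(t + 1) * K` entries. This is the source of `K ^ 5`. -/
theorem mainTime_le {n t m K : ℕ} (hm : 1 ≤ m) (hK : 1 ≤ K) (hpow : 2 ^ K ≤ 4 * (t + 1)) :
    mainTime n t m K + 1 ≤ 50 * n + 2000000 * (m * (t + 1) * K ^ 5) := by
  have hmK : 1 ≤ m * K := Nat.mul_pos hm hK
  have hK4 : 1 ≤ K ^ 4 := Nat.one_le_pow _ _ hK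
  have h1 : m * K ≤ m * (t + 1) * K ^ 5 := by
    calc m * K = m * 1 * (K * 1) := by ring
      _ ≤ m * (t + 1) * (K * K ^ 4) := by gcongr; omega
      _ = _ := by ring
  have h2 : m + K ≤ m * K + 1 := by nlinarith
  have h3 : (2 * (m * K) * K + 2) * ((K + 3) ^ 2 * ((4 * 2 ^ K * K + 1) * 1610)) ≤
      1751680 * (m * (t + 1) * K ^ 5) := by
    have e1 : 2 * (m * K) * K + 2 ≤ 4 * (m * K) * K := by nlinarith
    have e2 : K + 3 ≤ 4 * K := by omega
    have e3 : 4 * 2 ^ K * K + 1 ≤ 17 * ((t + 1) * K) := by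
      have : 4 * 2 ^ K * K ≤ 4 * (4 * (t + 1)) * K := by gcongr
      have : 1 ≤ (t + 1) * K := Nat.mul_pos (by omega) hK
      nlinarith
    calc _ ≤ (4 * (m * K) * K) * ((4 * K) ^ 2 * (17 * ((t + 1) * K) * 1610)) := by gcongr
      _ = _ := by ring
  have h4 : (m * K + 2) * ((t + 2) * 200) ≤ 1200 * (m * (t + 1) * K ^ 5) := by
    have e1 : m * K + 2 ≤ 3 * (m * K) := by omega
    have e2 : t + 2 ≤ 2 * (t + 1) := by omega
    calc _ ≤ 3 * (m * K) * (2 * (t + 1) * 200) := by gcongr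
      _ = 1200 * (m * (t + 1) * (K * 1)) := by ring
      _ ≤ 1200 * (m * (t + 1) * (K * K ^ 4)) := by gcongr
      _ = _ := by ring
  have h5 : t + 1 ≤ m * (t + 1) * K ^ 5 := by
    calc t + 1 = 1 * (t + 1) * 1 := by ring
      _ ≤ _ := by gcongr; exact Nat.one_le_pow _ _ hK
  unfold mainTime
  omega

/-- With `B = n + t + 2`, all the quantities are at most `B ^ 10`. The largest estimate is the one
for the scaled convolution, `2 ^ K * (2 ^ K * (2 * K)) ≤ B ^ 3 * (B ^ 3 * (B * B ^ 3))`. -/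
theorem fits_of_pow_le {n t w m K : ℕ} (hw : (n + t + 2) ^ 20 ≤ 2 ^ w) (hm : m ≤ t + 1)
    (hK : 2 * (t + 1) ≤ 2 ^ K) (hK' : 2 ^ K ≤ 4 * (t + 1)) : Fits n t w m K := by
  obtain ⟨B, hB⟩ : ∃ B, B = n + t + 2 := ⟨_, rfl⟩
  rw [← hB] at hw
  have hB2 : 2 ≤ B := by omega
  have hlt : B ^ 10 < 2 ^ w := (Nat.pow_lt_pow_right (by omega) (by norm_num)).trans_le hw
  have hB3 : 4 * B ≤ B ^ 3 := by
    calc 4 * B = 2 ^ 2 * B := by ring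
      _ ≤ B ^ 2 * B := by gcongr
      _ = _ := by ring
  have hp : 2 ^ K ≤ B ^ 3 := by omega
  have hKB : K ≤ B ^ 3 := (Nat.lt_two_pow_self.le).trans hp
  have hmB : m ≤ B := by omega
  have h8 : B ^ 8 * 4 ≤ B ^ 10 := by
    calc B ^ 8 * 4 = B ^ 8 * 2 ^ 2 := by norm_num
      _ ≤ B ^ 8 * B ^ 2 := by gcongr
      _ = _ := by ring
  have h9 : 8 * B ^ 6 * 2 ≤ B ^ 10 := by
    calc 8 * B ^ 6 * 2 = 2 ^ 4 * B ^ 6 := by ring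
      _ ≤ B ^ 4 * B ^ 6 := by gcongr
      _ = _ := by ring
  have hle : B ^ 3 ≤ B ^ 8 := Nat.pow_le_pow_right (by omega) (by norm_num)
  have hpos : 2 ^ 8 ≤ B ^ 8 := Nat.pow_le_pow_left hB2 8
  refine ⟨by omega, hK, ?_, ?_, ?_, ?_, by omega⟩
  · have : 4 * 2 ^ K * K ≤ 4 * B ^ 3 * B ^ 3 := by gcongr
    have e : 4 * B ^ 3 * B ^ 3 = 4 * B ^ 6 := by ring
    omega
  · refine lt_of_le_of_lt ?_ hlt
    calc 2 ^ K * (2 ^ K * (2 * K)) ≤ B ^ 3 * (B ^ 3 * (B * B ^ 3)) := by gcongr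
      _ = _ := by ring
  · have : 2 * (m * K) * K ≤ B * (B * B ^ 3) * B ^ 3 := by gcongr
    have e : B * (B * B ^ 3) * B ^ 3 = B ^ 8 := by ring
    omega
  · have : m * m * m ≤ B * B * B := by gcongr
    have e : B * B * B = B ^ 3 := by ring
    omega

/-- The whole program: the compiled algorithm, after `t` has been moved to its variable. -/
def program : Program := .seq (.instr (.move 2 1)) mainStmt.compile

/-- Odd registers are temporaries of the compiled code. So `t` has to leave register `1` before
anything else happens, while `n` in register `0` is already in its place. -/
theorem exists_solvesIn {n t w m K : ℕ} {v : Fin n → ℕ} (hF : Fits n t w m K)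
    (hm : t < m ^ 3) (hm' : ∀ k < m, k ^ 3 ≤ t) (hK' : ∀ k < K, 2 ^ k < 2 * (t + 1))
    (hv : ∀ i, 0 < v i) (hvw : ∀ i, v i < 2 ^ w) :
    ∃ T, SolvesIn w program v t T ∧ T ≤ mainTime n t m K + 1 := by
  obtain ⟨T, s, hT, hr, hs⟩ := exec_main (v := v)
    (σ := ((Instr.move 2 1).exec w (inputState v t)).toStore) hF
    (by simp [State.toStore, Instr.exec, inputState]) (by simp [State.toStore, Instr.exec, inputState])
    hm hm' hK' hv hvw (fun a => rfl) _ rfl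
  exact ⟨1 + T, ⟨s, .seq (.instr _ _) hr, fun j hj => hs j (by omega)⟩, by omega⟩

/-- Distinct positive coins that are at most `t` number at most `t`. The time for reading them is
absorbed by the main term, and only the larger coins have to be charged separately. -/
theorem card_le_add_card_filter {n t : ℕ} {v : Fin n → ℕ} (hinj : Function.Injective v)
    (hv : ∀ i, 0 < v i) : n ≤ t + #{i | t < v i} := by
  have h1 : #{i | ¬ t < v i} ≤ t := by
    calc #{i | ¬ t < v i} ≤ #(Icc 1 t) :=
          card_le_card_of_injOn v (fun i hi => by
            have := hv i
            simp only [coe_filter, mem_univ, true_and, Set.mem_ofPred_eq] at hi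
            simp only [coe_Icc, Set.mem_Icc]
            omega) hinj.injOn
      _ = t := by simp
  have h2 := card_filter_add_card_filter_not (s := (univ : Finset (Fin n))) fun i => t < v i
  rw [card_univ, Fintype.card_fin] at h2
  omega

theorem le_two_mul_rpow {t m : ℕ} (hm : ∀ k < m, k ^ 3 ≤ t) :
    (m : ℝ) ≤ 2 * ((t : ℝ) + 1) ^ (1 / 3 : ℝ) := by
  have hc : (1 : ℝ) ≤ ((t : ℝ) + 1) ^ (1 / 3 : ℝ) :=
    Real.one_le_rpow (by have : (0 : ℝ) ≤ t := Nat.cast_nonneg t; linarith) (by norm_num)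
  rcases Nat.eq_zero_or_pos m with rfl | h0
  · simp only [Nat.cast_zero]
    linarith
  · have h1 := hm (m - 1) (by omega)
    have h2 : ((m - 1 : ℕ) : ℝ) ≤ ((t : ℝ) + 1) ^ (1 / 3 : ℝ) := by
      have h3 : (((m - 1 : ℕ) : ℝ) ^ (3 : ℕ)) ≤ (t : ℝ) + 1 := by
        have : (((m - 1) ^ 3 : ℕ) : ℝ) ≤ t := by exact_mod_cast h1
        push_cast at this ⊢
        linarith
      calc ((m - 1 : ℕ) : ℝ) = (((m - 1 : ℕ) : ℝ) ^ (3 : ℕ)) ^ (1 / 3 : ℝ) := by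
            rw [← Real.rpow_natCast, ← Real.rpow_mul (Nat.cast_nonneg _)]
            norm_num
        _ ≤ _ := Real.rpow_le_rpow (by positivity) h3 (by norm_num)
    rw [Nat.cast_sub h0, Nat.cast_one] at h2
    linarith

theorem le_six_mul_log {t K : ℕ} (hK : 2 ^ K ≤ 4 * (t + 1)) :
    (K : ℝ) ≤ 6 * Real.log ((t : ℝ) + 2) ∧ 1 / 2 ≤ Real.log ((t : ℝ) + 2) := by
  have h2 : (0.6931471803 : ℝ) < Real.log 2 := Real.log_two_gt_d9
  have ht : (0 : ℝ) ≤ t := Nat.cast_nonneg t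
  have hl : Real.log 2 ≤ Real.log ((t : ℝ) + 2) := Real.log_le_log (by norm_num) (by linarith)
  have h3 : K * Real.log 2 ≤ 2 * Real.log 2 + Real.log ((t : ℝ) + 2) := by
    rw [← Real.log_pow, show 2 * Real.log 2 = Real.log 4 by
      rw [show (4 : ℝ) = 2 ^ 2 by norm_num, Real.log_pow]; norm_num,
      ← Real.log_mul (by norm_num) (by linarith)]
    refine Real.log_le_log (by positivity) ?_
    have : ((2 ^ K : ℕ) : ℝ) ≤ ((4 * (t + 1) : ℕ) : ℝ) := by exact_mod_cast hK
    push_cast at this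
    linarith
  exact ⟨by nlinarith, by linarith⟩

end ChangeMaking

/-- One fixed program solves every instance `(v, t)` of all-targets change-making, on every word
size `w ≥ c * log₂ (n + t + 2)` for which the coin values fit into words.  The number of coin values
exceeding `t` only accounts for reading them: it is `0` when all coin values are at most `t`. -/
theorem theorem1 :
    ∃ (P : WordRAM.Program) (c k : ℕ) (C : ℝ),
      ∀ (n t w : ℕ) (v : Fin n → ℕ), Function.Injective v → (∀ i, 0 < v i) →
        (∀ i, v i < 2 ^ w) → (n + t + 2) ^ c ≤ 2 ^ w →
        ∃ T : ℕ, ChangeMaking.SolvesIn w P v t T ∧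
          (T : ℝ) ≤ C * (((t : ℝ) + 1) ^ (4 / 3 : ℝ) * Real.log ((t : ℝ) + 2) ^ k
            + ((Finset.univ.filter fun i => t < v i).card : ℝ)) := by
  -- The factor `2000050` is `2000000` from `mainTime_le` plus `50` for reading at most `t` coins
  -- not exceeding `t`. The factor `15552 = 2 * 6 ^ 5` comes from `m ≤ 2 * (t + 1) ^ (1 / 3)` and `K
  -- ≤ 6 * log (t + 2)`.
  refine ⟨ChangeMaking.program, 20, 5, 2000050 * 15552, fun n t w v hinj hv hvw hw => ?_⟩
  have hmex : ∃ m, t < m ^ 3 := ⟨t + 1, lt_of_lt_of_le (Nat.lt_succ_self t)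
    (Nat.le_self_pow (by norm_num) _)⟩
  have hKex : ∃ K, 2 * (t + 1) ≤ 2 ^ K := ⟨2 * (t + 1), Nat.lt_two_pow_self.le⟩
  -- The cube root balances the cases in the exchange argument: `y ≤ m ^ 2` lets the hitting set
  -- have size `m * K`, and `y > m ^ 2` lets `m` copies exceed `t`.
  obtain ⟨m, hm, hm'⟩ : ∃ m, t < m ^ 3 ∧ ∀ k < m, k ^ 3 ≤ t :=
    ⟨Nat.find hmex, Nat.find_spec hmex, fun k hk => not_lt.1 (Nat.find_min hmex hk)⟩
  obtain ⟨K, hK, hK'⟩ : ∃ K, 2 * (t + 1) ≤ 2 ^ K ∧ ∀ k < K, 2 ^ k < 2 * (t + 1) :=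
    ⟨Nat.find hKex, Nat.find_spec hKex, fun k hk => not_le.1 (Nat.find_min hKex hk)⟩
  have hm1 : 1 ≤ m := by
    rcases Nat.eq_zero_or_pos m with rfl | h
    · simp at hm
    · exact h
  have hmt : m ≤ t + 1 := by
    by_contra! h
    have h1 := hm' (t + 1) h
    have h2 := Nat.le_self_pow (n := 3) (by norm_num) (t + 1)
    omega
  have hK1 : 1 ≤ K := by
    rcases Nat.eq_zero_or_pos K with rfl | h
    · omega
    · exact h
  have hK4 : 2 ^ K ≤ 4 * (t + 1) := by
    have := hK' (K - 1) (by omega)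
    have e : 2 ^ K = 2 * 2 ^ (K - 1) := by rw [← pow_succ', Nat.sub_add_cancel hK1]
    omega
  obtain ⟨T, hT, hTle⟩ := ChangeMaking.exists_solvesIn
    (ChangeMaking.fits_of_pow_le hw hmt hK hK4) hm hm' hK' hv hvw
  refine ⟨T, hT, ?_⟩
  have hn := ChangeMaking.card_le_add_card_filter (t := t) hinj hv
  set b := (Finset.univ.filter fun i => t < v i).card with hb
  have hmain := ChangeMaking.mainTime_le (n := n) hm1 hK1 hK4
  have ht1 : t + 1 ≤ m * (t + 1) * K ^ 5 := by
    calc t + 1 = 1 * (t + 1) * 1 := by ring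
      _ ≤ _ := by gcongr; exact Nat.one_le_pow _ _ hK1
  have hTb : T ≤ 2000050 * (m * (t + 1) * K ^ 5) + 50 * b := by omega
  have hTb' : (T : ℝ) ≤ 2000050 * (m * ((t : ℝ) + 1) * K ^ 5) + 50 * b := by exact_mod_cast hTb
  obtain ⟨hKl, hl⟩ := ChangeMaking.le_six_mul_log hK4
  have hmc := ChangeMaking.le_two_mul_rpow hm'
  set l := Real.log ((t : ℝ) + 2)
  have ht0 : (0 : ℝ) < (t : ℝ) + 1 := by positivity
  have hrpow : ((t : ℝ) + 1) ^ (4 / 3 : ℝ) = ((t : ℝ) + 1) ^ (1 / 3 : ℝ) * ((t : ℝ) + 1) := by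
    rw [show (4 / 3 : ℝ) = 1 / 3 + 1 by norm_num, Real.rpow_add_one ht0.ne']
  have hM : (m : ℝ) * ((t : ℝ) + 1) * K ^ 5 ≤ 15552 * (((t : ℝ) + 1) ^ (4 / 3 : ℝ) * l ^ 5) := by
    calc (m : ℝ) * ((t : ℝ) + 1) * K ^ 5
        ≤ 2 * ((t : ℝ) + 1) ^ (1 / 3 : ℝ) * ((t : ℝ) + 1) * (6 * l) ^ 5 := by gcongr
      _ = _ := by rw [hrpow]; ring
  have hb0 : (0 : ℝ) ≤ b := Nat.cast_nonneg b
  linarith
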